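/- **Setting.** Let $K$ be a real quadratic field with ring of integers $\mathcal{O}_K$, let $\mathfrak{c}$ be a nonzero ideal of $\mathcal{O}_K$, and let $$\mathrm{Cl}_{\mathfrak{c}\infty_1\infty_2}=\frac{\{\text{nonzero fractional ideals of }\mathcal{O}_K\text{ coprime to }\mathfrak{c}\}}{\{a\mathcal{O}_K: a\equiv 1 \ (\mathrm{mod}\ \mathfrak{c}),\ a \text{ positive at both real places}\}}$$ be the narrow ray class group modulo $\mathfrak{c}$, where for $a\in K^\times$ the congruence $a\equiv \pm1 \pmod{\mathfrak c}$ means $a=\alpha/\beta$ with $\alpha,\beta\in\mathcal{O}_K$, $\beta\ne0$ coprime to $\mathfrak{c}$ and $\alpha\equiv\pm\beta \pmod{\mathfrak c}$. Let $R$ be the class of the ideals $a\mathcal{O}_K$ with $a\equiv -1\pmod{\mathfrak{c}}$ and $a$ positive at both real places. For a class $A$ put $\zeta(s,A)=\sum_{\mathfrak{a}\in A}N(\mathfrak{a})^{-s}$, the sum being over integral ideals and absolutely convergent for $\mathrm{Re}(s)>1$, and let $Z_A$ be the differenced ray class zeta function: the analytic continuation of $Z_A(s)=\zeta(s,A)-\zeta(s,RA)$.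 For a real symmetric matrix $M$ of signature $(g-1,1)$, fix a holomorphic branch of $\sqrt{-z^\top M z}$ on $R_M=\{z\in\mathbb{C}^g:\overline{z}^\top M z<0\}$ (there are two, negatives of each other), and put $\sqrt{-\tfrac12 z^\top tMz}=\sqrt{t/2}\,\sqrt{-z^\top Mz}$ for $t>0$. Let $\mathcal{E}(\alpha)=\int_0^\alpha e^{-\pi u^2}\,du$ and $e(x)=e^{2\pi i x}$. For a complex symmetric $\Omega$ with $\mathrm{Im}\,\Omega=M$ (or $tM$), for $z\in\mathbb{C}^g$, $c_1,c_2\in R_M$ and $p,q\in\mathbb{R}^g$ put $$\Theta^{c_1,c_2}(z;\Omega)=\sum_{n\in\mathbb{Z}^g}\left(\mathcal{E}\!\left(\frac{c_2^\top\mathrm{Im}(\Omega n+z)}{\sqrt{-\frac12c_2^\top \mathrm{Im}(\Omega) c_2}}\right)-\mathcal{E}\!\left(\frac{c_1^\top\mathrm{Im}(\Omega n+z)}{\sqrt{-\frac12c_1^\top \mathrm{Im}(\Omega) c_1}}\right)\right)e\!\left(\tfrac12n^\top\Omega n+n^\top z\right),$$ $$\Theta^{c_1,c_2}_{p,q}(\Omega)=e\!\left(\tfrac12q^\top\Omega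 q+p^\top q\right)\Theta^{c_1,c_2}(p+\Omega q;\Omega),\qquad \widehat{\zeta}^{c_1,c_2}_{p,q}(\Omega,s)=\int_0^\infty\Theta^{c_1,c_2}_{p,q}(t\Omega)\,t^s\,\frac{dt}{t}.$$ **Theorem 1.3.** Let $A\in\mathrm{Cl}_{\mathfrak{c}\infty_1\infty_2}$. Then $Z_A$ continues to an entire function. For every integral ideal $\mathfrak{b}\in A^{-1}$ there exist a real symmetric $2\times2$ matrix $M$ of signature $(1,1)$ and $q\in\mathbb{Q}^2$ such that holomorphic branches of $\sqrt{-z^\top Mz}$ on $R_M$ exist and, for either choice of branch, there are vectors $c_1,c_2\in\mathbb{R}^2$ with $c_j^\top Mc_j<0$ for which the series $\Theta^{c_1,c_2}_{0,q}(itM)$ converges absolutely for all $t>0$, the integral defining $\widehat{\zeta}^{c_1,c_2}_{0,q}(iM,s)$ converges absolutely for all $s\in\mathbb{C}$ and is entire in $s$, and $$(2\pi N(\mathfrak{b}))^{-s}\,\Gamma(s)\,Z_A(s)=\widehat{\zeta}^{c_1,c_2}_{0,q}(iM,s)$$ for all $s\in\mathbb{C}$ (at the poles $s=0,-1,-2,\dots$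 of $\Gamma$, the left-hand side is extended by continuity). -/

import Mathlib

open scoped nonZeroDivisors NumberField Matrix

noncomputable section

/-! ## Ray class groups and their zeta functions -/

namespace RayClass

variable {K : Type*} [Field K] [NumberField K]

/-- `a ≡ e (mod 𝔠)` for `a` in `K` and an algebraic integer `e`: `a` is a quotient `α / β` of
algebraic integers with `β` coprime to `𝔠` and `α ≡ e β (mod 𝔠)`. -/
def Cong (𝔠 : Ideal (𝓞 K)) (a : K) (e : 𝓞 K) : Prop :=
  ∃ α β : 𝓞 K, β ≠ 0 ∧ IsCoprime (Ideal.span {β}) 𝔠 ∧ α - e * β ∈ 𝔠 ∧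
    a * algebraMap (𝓞 K) K β = algebraMap (𝓞 K) K α

theorem isCoprime_of_sub_mem {𝔠 : Ideal (𝓞 K)} {α e β : 𝓞 K}
    (hβ : IsCoprime (Ideal.span {β}) 𝔠) (he : e * e = 1) (h : α - e * β ∈ 𝔠) :
    IsCoprime (Ideal.span {α}) 𝔠 := by
  rw [Ideal.isCoprime_iff_exists] at hβ ⊢
  obtain ⟨i, hi, j, hj, hij⟩ := hβ
  obtain ⟨x, rfl⟩ := Ideal.mem_span_singleton'.1 hi
  refine ⟨x * e * α, Ideal.mem_span_singleton'.2 ⟨x * e, rfl⟩, j - x * e * (α - e * β),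
    Ideal.sub_mem _ hj (Ideal.mul_mem_left _ _ h), ?_⟩
  linear_combination hij + x * β * he

theorem Cong.mul {𝔠 : Ideal (𝓞 K)} {a b : K} {e f : 𝓞 K} (ha : Cong 𝔠 a e) (hb : Cong 𝔠 b f) :
    Cong 𝔠 (a * b) (e * f) := by
  obtain ⟨α, β, h0, h1, h2, h3⟩ := ha
  obtain ⟨α', β', h0', h1', h2', h3'⟩ := hb
  refine ⟨α * α', β * β', mul_ne_zero h0 h0', ?_, ?_, ?_⟩
  · rw [← Ideal.span_singleton_mul_span_singleton]
    exact h1.mul_left h1'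
  · have : α * α' - e * f * (β * β') = α' * (α - e * β) + e * β * (α' - f * β') := by ring
    rw [this]
    exact Ideal.add_mem _ (Ideal.mul_mem_left _ _ h2) (Ideal.mul_mem_left _ _ h2')
  · rw [map_mul, map_mul, ← h3, ← h3']
    ring

theorem Cong.inv {𝔠 : Ideal (𝓞 K)} {a : K} {e : 𝓞 K} (h : Cong 𝔠 a e) (ha : a ≠ 0)
    (he : e * e = 1) : Cong 𝔠 a⁻¹ e := by
  obtain ⟨α, β, h0, h1, h2, h3⟩ := h
  have hα : α ≠ 0 := by
    rintro rfl
    simp [ha, h0] at h3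
  refine ⟨β, α, hα, isCoprime_of_sub_mem h1 he h2, ?_, ?_⟩
  · have : β - e * α = -e * (α - e * β) := by linear_combination (-β) * he
    rw [this]
    exact Ideal.mul_mem_left _ _ h2
  · rw [← h3, inv_mul_cancel_left₀ ha]

/-- The group of nonzero fractional ideals of `K` coprime to `𝔠`. -/
def coprimeIdeals (𝔠 : Ideal (𝓞 K)) : Subgroup (FractionalIdeal (𝓞 K)⁰ K)ˣ where
  carrier := {I | ∃ 𝔫 𝔡 : Ideal (𝓞 K), 𝔡 ≠ ⊥ ∧ IsCoprime 𝔫 𝔠 ∧ IsCoprime 𝔡 𝔠 ∧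
    (I : FractionalIdeal (𝓞 K)⁰ K) * 𝔡 = 𝔫}
  one_mem' := ⟨1, 1, one_ne_zero, isCoprime_one_left, isCoprime_one_left, by simp⟩
  mul_mem' := by
    rintro I J ⟨n, d, h0, h1, h2, h3⟩ ⟨n', d', h0', h1', h2', h3'⟩
    refine ⟨n * n', d * d', mul_ne_zero h0 h0', h1.mul_left h1', h2.mul_left h2', ?_⟩
    rw [FractionalIdeal.coeIdeal_mul, FractionalIdeal.coeIdeal_mul, ← h3, ← h3', Units.val_mul]
    exact mul_mul_mul_comm _ _ _ _
  inv_mem' := by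
    rintro I ⟨n, d, h0, h1, h2, h3⟩
    refine ⟨d, n, ?_, h2, h1, ?_⟩
    · rintro rfl
      have hI : (I : FractionalIdeal (𝓞 K)⁰ K) ≠ 0 := I.ne_zero
      have hd : (d : FractionalIdeal (𝓞 K)⁰ K) ≠ 0 := FractionalIdeal.coeIdeal_ne_zero.2 h0
      rw [FractionalIdeal.coeIdeal_bot] at h3
      exact mul_ne_zero hI hd h3
    · rw [← h3, Units.inv_mul_cancel_left]

/-- The elements `a` of `Kˣ` with `a ≡ 1 (mod 𝔠)` that are positive at each place in `S`. -/
def rayUnits (𝔠 : Ideal (𝓞 K)) (S : Set (K →+* ℝ)) : Subgroup Kˣ where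
  carrier := {a | Cong 𝔠 (a : K) 1 ∧ ∀ σ ∈ S, 0 < σ a}
  one_mem' := ⟨⟨1, 1, one_ne_zero, by simp [isCoprime_one_left, ← Ideal.one_eq_top],
    by simp, by simp⟩, by simp⟩
  mul_mem' := by
    rintro a b ⟨h1, h2⟩ ⟨h1', h2'⟩
    refine ⟨by simpa using h1.mul h1', fun σ hσ => ?_⟩
    rw [Units.val_mul, map_mul]
    exact mul_pos (h2 σ hσ) (h2' σ hσ)
  inv_mem' := by
    rintro a ⟨h1, h2⟩
    refine ⟨?_, fun σ hσ => ?_⟩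
    · rw [Units.val_inv_eq_inv_val]
      exact h1.inv a.ne_zero (mul_one 1)
    · rw [Units.val_inv_eq_inv_val, map_inv₀]
      exact inv_pos.2 (h2 σ hσ)

/-- The principal fractional ideals `a 𝓞_K` with `a ≡ 1 (mod 𝔠)` and `a` positive at each place
in `S`, as a subgroup of the group of fractional ideals coprime to `𝔠`. -/
def principalRay (𝔠 : Ideal (𝓞 K)) (S : Set (K →+* ℝ)) : Subgroup (coprimeIdeals 𝔠) :=
  ((rayUnits 𝔠 S).map (toPrincipalIdeal (𝓞 K) K)).subgroupOf (coprimeIdeals 𝔠)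

theorem toPrincipalIdeal_mem {𝔠 : Ideal (𝓞 K)} {a : Kˣ} {e : 𝓞 K} (h : Cong 𝔠 (a : K) e)
    (he : e * e = 1) : toPrincipalIdeal (𝓞 K) K a ∈ coprimeIdeals 𝔠 := by
  obtain ⟨α, β, h0, h1, h2, h3⟩ := h
  refine ⟨Ideal.span {α}, Ideal.span {β}, by simpa using h0, isCoprime_of_sub_mem h1 he h2, h1, ?_⟩
  rw [coe_toPrincipalIdeal, FractionalIdeal.coeIdeal_span_singleton,
    FractionalIdeal.coeIdeal_span_singleton, FractionalIdeal.spanSingleton_mul_spanSingleton]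
  exact congrArg _ h3

/-- The ray class group `Cl_{𝔠S}` of `𝓞_K` modulo `𝔠 S`, where `S` is a set of real places. -/
abbrev ClassGroup (𝔠 : Ideal (𝓞 K)) (S : Set (K →+* ℝ)) : Type _ :=
  coprimeIdeals 𝔠 ⧸ principalRay 𝔠 S

theorem exists_negClass (𝔠 : Ideal (𝓞 K)) (h𝔠 : 𝔠 ≠ ⊥) (S : Set (K →+* ℝ)) :
    ∃ R : ClassGroup 𝔠 S, ∀ I : coprimeIdeals 𝔠, (I : ClassGroup 𝔠 S) = R ↔
      ∃ a : Kˣ, Cong 𝔠 (a : K) (-1) ∧ (∀ σ ∈ S, 0 < σ a) ∧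
        (I : (FractionalIdeal (𝓞 K)⁰ K)ˣ) = toPrincipalIdeal (𝓞 K) K a := by
  have hN : 0 < Ideal.absNorm 𝔠 :=
    Nat.pos_of_ne_zero fun h => h𝔠 (Ideal.absNorm_eq_zero_iff.1 h)
  obtain ⟨m, hm, hmN⟩ : ∃ m : ℕ, 0 < m ∧ m + 1 = 2 * Ideal.absNorm 𝔠 :=
    ⟨2 * Ideal.absNorm 𝔠 - 1, by omega, by omega⟩
  have hmK : (m : K) ≠ 0 := Nat.cast_ne_zero.2 hm.ne'
  have hc : Cong 𝔠 (m : K) (-1) := by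
    refine ⟨(m : 𝓞 K), 1, one_ne_zero, by simp [isCoprime_one_left, ← Ideal.one_eq_top], ?_,
      by simp⟩
    have : (m : 𝓞 K) - -1 * 1 = 2 * (Ideal.absNorm 𝔠 : 𝓞 K) := by
      have := congrArg (Nat.cast : ℕ → 𝓞 K) hmN
      push_cast at this
      linear_combination this
    rw [this]
    exact Ideal.mul_mem_left _ _ (Ideal.absNorm_mem 𝔠)
  have hpos : ∀ σ : K →+* ℝ, 0 < σ (m : K) := fun σ => by
    rw [map_natCast]
    exact_mod_cast hm
  let u : Kˣ := Units.mk0 (m : K) hmK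
  have hu : Cong 𝔠 (u : K) (-1) := hc
  refine ⟨QuotientGroup.mk ⟨toPrincipalIdeal (𝓞 K) K u, toPrincipalIdeal_mem hu (by ring)⟩,
    fun I => ?_⟩
  rw [QuotientGroup.eq]
  constructor
  · rintro ⟨v, ⟨hv1, hv2⟩, hv3⟩
    refine ⟨u * v⁻¹, ?_, fun σ hσ => ?_, ?_⟩
    · rw [Units.val_mul, Units.val_inv_eq_inv_val]
      simpa using hu.mul (hv1.inv v.ne_zero (mul_one 1))
    · rw [Units.val_mul, Units.val_inv_eq_inv_val, map_mul, map_inv₀]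
      exact mul_pos (hpos σ) (inv_pos.2 (hv2 σ hσ))
    · have h : toPrincipalIdeal (𝓞 K) K v
          = (I : (FractionalIdeal (𝓞 K)⁰ K)ˣ)⁻¹ * toPrincipalIdeal (𝓞 K) K u := hv3
      rw [map_mul, map_inv, h, mul_inv, inv_inv, mul_comm (I : (FractionalIdeal (𝓞 K)⁰ K)ˣ),
        mul_inv_cancel_left]
  · rintro ⟨a, ha1, ha2, ha3⟩
    refine ⟨a⁻¹ * u, ⟨?_, fun σ hσ => ?_⟩, ?_⟩
    · rw [Units.val_mul, Units.val_inv_eq_inv_val]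
      simpa using (ha1.inv a.ne_zero (by ring)).mul hu
    · rw [Units.val_mul, Units.val_inv_eq_inv_val, map_mul, map_inv₀]
      exact mul_pos (inv_pos.2 (ha2 σ hσ)) (hpos σ)
    · change toPrincipalIdeal (𝓞 K) K (a⁻¹ * u)
          = (I : (FractionalIdeal (𝓞 K)⁰ K)ˣ)⁻¹ * toPrincipalIdeal (𝓞 K) K u
      rw [map_mul, map_inv, ha3]

/-- The class `R` of `Cl_{𝔠S}` that consists of the ideals `a 𝓞_K` with `a ≡ -1 (mod 𝔠)` and `a`
positive at each place in `S`. -/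
def negClass (𝔠 : Ideal (𝓞 K)) (h𝔠 : 𝔠 ≠ ⊥) (S : Set (K →+* ℝ)) : ClassGroup 𝔠 S :=
  (exists_negClass 𝔠 h𝔠 S).choose

theorem mk_eq_negClass_iff (𝔠 : Ideal (𝓞 K)) (h𝔠 : 𝔠 ≠ ⊥) (S : Set (K →+* ℝ))
    (I : coprimeIdeals 𝔠) : (I : ClassGroup 𝔠 S) = negClass 𝔠 h𝔠 S ↔
      ∃ a : Kˣ, Cong 𝔠 (a : K) (-1) ∧ (∀ σ ∈ S, 0 < σ a) ∧
        (I : (FractionalIdeal (𝓞 K)⁰ K)ˣ) = toPrincipalIdeal (𝓞 K) K a :=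
  (exists_negClass 𝔠 h𝔠 S).choose_spec I

/-- The integral ideal `𝔞` belongs to the ray class `A`. -/
def InClass {𝔠 : Ideal (𝓞 K)} {S : Set (K →+* ℝ)} (𝔞 : Ideal (𝓞 K)) (A : ClassGroup 𝔠 S) : Prop :=
  ∃ I : coprimeIdeals 𝔠,
    ((I : (FractionalIdeal (𝓞 K)⁰ K)ˣ) : FractionalIdeal (𝓞 K)⁰ K) = 𝔞 ∧ (I : ClassGroup 𝔠 S) = A

/-- The term `N(𝔞)^{-s}` of the zeta function of the ray class `A`. -/
def zetaTerm {𝔠 : Ideal (𝓞 K)} {S : Set (K →+* ℝ)} (A : ClassGroup 𝔠 S) (s : ℂ)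
    (𝔞 : {𝔞 : Ideal (𝓞 K) // InClass 𝔞 A}) : ℂ :=
  (Ideal.absNorm 𝔞.1 : ℂ) ^ (-s)

/-- The Dirichlet series `ζ(s, A) = ∑ N(𝔞)^{-s}` over the integral ideals in the ray class `A`. -/
def zeta {𝔠 : Ideal (𝓞 K)} {S : Set (K →+* ℝ)} (A : ClassGroup 𝔠 S) (s : ℂ) : ℂ :=
  ∑' 𝔞, zetaTerm A s 𝔞

/-- `Z` is the differenced ray class zeta function `Z_A(s) = ζ(s, A) - ζ(s, R A)` as a function on
the whole complex plane: the Dirichlet series converge absolutely for `Re s > 1`, and `Z` is the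
(unique) entire function that agrees with their difference there. -/
def IsDiffZeta {𝔠 : Ideal (𝓞 K)} (h𝔠 : 𝔠 ≠ ⊥) {S : Set (K →+* ℝ)} (A : ClassGroup 𝔠 S)
    (Z : ℂ → ℂ) : Prop :=
  Differentiable ℂ Z ∧ ∀ s : ℂ, 1 < s.re →
    Summable (zetaTerm A s) ∧ Summable (zetaTerm (negClass 𝔠 h𝔠 S * A) s) ∧
      Z s = zeta A s - zeta (negClass 𝔠 h𝔠 S * A) s

end RayClass

/-! ## Indefinite theta and zeta functions -/

namespace Indefinite

variable {g : ℕ}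

/-- The real symmetric matrix `M` has signature `(j, k)`: it has `j` positive and `k` negative
eigenvalues with multiplicity, and `j + k = g`. -/
def HasSignature (M : Matrix (Fin g) (Fin g) ℝ) (j k : ℕ) : Prop :=
  j + k = g ∧ ∃ h : M.IsHermitian,
    (Finset.univ.filter fun i => 0 < h.eigenvalues i).card = j ∧
      (Finset.univ.filter fun i => h.eigenvalues i < 0).card = k

/-- A real matrix as a complex matrix. -/
def toC (M : Matrix (Fin g) (Fin g) ℝ) : Matrix (Fin g) (Fin g) ℂ :=
  M.map fun x => (x : ℂ)

/-- The region `R_M` of all `z` in `ℂ^g` with `z̄ᵀ M z < 0` (a real number for symmetric `M`). -/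
def negRegion (M : Matrix (Fin g) (Fin g) ℝ) : Set (Fin g → ℂ) :=
  {z | (star z ⬝ᵥ (toC M *ᵥ z)).re < 0}

/-- `r` is a holomorphic branch of `z ↦ √(-zᵀ M z)` on `R_M`. If `M` has signature `(g - 1, 1)`
there are exactly two of them, negatives of each other. -/
def IsNegSqrt (M : Matrix (Fin g) (Fin g) ℝ) (r : (Fin g → ℂ) → ℂ) : Prop :=
  DifferentiableOn ℂ r (negRegion M) ∧ ∀ z ∈ negRegion M, r z ^ 2 = -(z ⬝ᵥ (toC M *ᵥ z))

/-- The branch `√t r` of `√(-zᵀ (t M) z)` belonging to a branch `r` of `√(-zᵀ M z)`. -/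
def scaleBranch (r : (Fin g → ℂ) → ℂ) (t : ℝ) : (Fin g → ℂ) → ℂ :=
  fun z => (Real.sqrt t : ℂ) * r z

theorem IsNegSqrt.smul {M : Matrix (Fin g) (Fin g) ℝ} {r : (Fin g → ℂ) → ℂ} (h : IsNegSqrt M r)
    {t : ℝ} (ht : 0 < t) : IsNegSqrt (t • M) (scaleBranch r t) := by
  have hM : toC (t • M) = (t : ℂ) • toC M := by
    ext i j
    simp [toC]
  have hR : negRegion (t • M) = negRegion M := by
    ext z
    simp only [negRegion, Set.mem_ofPred_eq, hM, Matrix.smul_mulVec, dotProduct_smul, smul_eq_mul,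
      Complex.re_ofReal_mul]
    exact ⟨fun h => by nlinarith, fun h => by nlinarith⟩
  refine ⟨hR ▸ h.1.const_mul _, fun z hz => ?_⟩
  have hs : (Real.sqrt t : ℂ) ^ 2 = t := by exact_mod_cast Real.sq_sqrt ht.le
  rw [hR] at hz
  rw [scaleBranch, mul_pow, hs, h.2 z hz, hM, Matrix.smul_mulVec, dotProduct_smul,
    smul_eq_mul, mul_neg]

/-- `e(z) = exp(2π i z)`. -/
def e (z : ℂ) : ℂ := Complex.exp (2 * Real.pi * Complex.I * z)

/-- `∫_0^α e^{-π u²} du`, along the segment from `0` to `α`. -/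
def incompleteGauss (α : ℂ) : ℂ :=
  ∫ x in (0 : ℝ)..1, α * Complex.exp (-Real.pi * (x * α) ^ 2)

/-- The general term of the indefinite theta series at `n`. Here `r` is the chosen branch of
`√(-cᵀ Im(Ω) c)`, so that `r c / √2` is `√(-½ cᵀ Im(Ω) c)`. -/
def thetaTerm (r : (Fin g → ℂ) → ℂ) (c₁ c₂ : Fin g → ℂ) (z : Fin g → ℂ)
    (Ω : Matrix (Fin g) (Fin g) ℂ) (n : Fin g → ℤ) : ℂ :=
  let v : Fin g → ℂ := fun i => (n i : ℂ)
  let y : Fin g → ℂ := fun i => (((Ω *ᵥ v + z) i).im : ℂ)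
  (incompleteGauss (c₂ ⬝ᵥ y / (r c₂ / Real.sqrt 2))
      - incompleteGauss (c₁ ⬝ᵥ y / (r c₁ / Real.sqrt 2)))
    * e (1 / 2 * (v ⬝ᵥ (Ω *ᵥ v)) + v ⬝ᵥ z)

/-- The indefinite theta function `Θ^{c₁,c₂}(z; Ω)`. -/
def theta (r : (Fin g → ℂ) → ℂ) (c₁ c₂ : Fin g → ℂ) (z : Fin g → ℂ)
    (Ω : Matrix (Fin g) (Fin g) ℂ) : ℂ :=
  ∑' n : Fin g → ℤ, thetaTerm r c₁ c₂ z Ω n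

/-- The point `p + Ω q` of `ℂ^g`. -/
def charPoint (p q : Fin g → ℝ) (Ω : Matrix (Fin g) (Fin g) ℂ) : Fin g → ℂ :=
  (fun i => (p i : ℂ)) + Ω *ᵥ (fun i => (q i : ℂ))

/-- The indefinite theta null `Θ^{c₁,c₂}_{p,q}(Ω)` with characteristics `p`, `q`. -/
def thetaNull (r : (Fin g → ℂ) → ℂ) (c₁ c₂ : Fin g → ℂ) (p q : Fin g → ℝ)
    (Ω : Matrix (Fin g) (Fin g) ℂ) : ℂ :=
  let p' : Fin g → ℂ := fun i => (p i : ℂ)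
  let q' : Fin g → ℂ := fun i => (q i : ℂ)
  e (1 / 2 * (q' ⬝ᵥ (Ω *ᵥ q')) + p' ⬝ᵥ q') * theta r c₁ c₂ (charPoint p q Ω) Ω

/-- The function `t ↦ Θ^{c₁,c₂}_{p,q}(tΩ)`. -/
def thetaRay (r : (Fin g → ℂ) → ℂ) (c₁ c₂ : Fin g → ℂ) (p q : Fin g → ℝ)
    (Ω : Matrix (Fin g) (Fin g) ℂ) (t : ℝ) : ℂ :=
  thetaNull (scaleBranch r t) c₁ c₂ p q ((t : ℂ) • Ω)

/-- The completed indefinite zeta function `∫_0^∞ Θ^{c₁,c₂}_{p,q}(tΩ) t^s dt/t`. -/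
def zetaHat (r : (Fin g → ℂ) → ℂ) (c₁ c₂ : Fin g → ℂ) (p q : Fin g → ℝ)
    (Ω : Matrix (Fin g) (Fin g) ℂ) (s : ℂ) : ℂ :=
  mellin (thetaRay r c₁ c₂ p q Ω) s

end Indefinite

end

/-! Fix an integral ideal 𝔟 in A⁻¹. An integral ideal 𝔞 lies in A exactly when 𝔞𝔟 has a totally
positive generator α ≡ 1 (mod 𝔠), and then α lies in 𝔟; it lies in RA exactly when 𝔞𝔟 has a totally
negative generator with the same congruence, because negation exchanges 1 and -1. Such an α is
unique up to totally positive units ≡ 1 (mod 𝔠), an infinite cyclic group with a generator ε whose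
first conjugate exceeds 1. The elements of 𝔟 congruent to 1 form a coset of the lattice 𝔟𝔠, that is
ℤ² + q in coordinates, and their conjugates x, y are linear forms on it. M is the matrix with vᵀMv =
2xy, and c₁, c₂ are two points of the curve of vectors on which the forms take the values -e^{-u}
and e^u, at u = 0 and u = ℓ = log ε (in the order that suits the branch of the square root).

With these choices the theta summand is the difference between u = ℓ and u = 0 of E(√t(e^u x -
e^{-u} y)) e^{-2πtxy}, where E is the Gaussian primitive. This is `geodesicTerm`. Multiplication by
ε shifts u by ℓ, so the sum over an orbit telescopes to ½(sgn x + sgn y) e^{-2πtxy}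
(`hasSum_geodesicTerm_orbit`). Mixed signs cancel, and the theta series becomes the sum of ±e^{-2πt
N(𝔞)N(𝔟)} over the ideals of A and RA (`hasSum_unfold`, `hasSum_ideals`). Its Mellin transform,
taken term by term for Re s > 1, is the required multiple of the Dirichlet series
(`mellin_eq_zeta`).

For convergence and entirety, differentiate in u: the indefinite exponential turns into a positive
definite Gaussian times an odd linear form (`geodesicTerm_eq_integral`), so the theta series is an
integral over [0, ℓ] of absolutely convergent Gaussian sums. Poisson summation
(`tsum_cexp_shifted`), differentiated in the shift, gives a dual sum whose zero frequency drops out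
(`abs_tsum_linear_gaussian_le`). Hence the theta series vanishes to infinite order as t → 0; it
decays exponentially as t → ∞, so the Mellin transform is entire (`mellin_entire_of_hasSum_exp`).
Since 1/Γ is entire, this also continues Z_A, and the identity theorem shows that the continuation
does not depend on 𝔟. -/

/-! ### Gaussian sums and Poisson summation on planar lattices -/

open Real in
/-- A summable majorant for Gaussian terms on `ℤ²`. -/
noncomputable def gaussBound (δ S : ℝ) (v : ℤ × ℤ) : ℝ :=
  exp (-π * (δ * v.1 ^ 2 - 2 * S * |v.1|)) * exp (-π * (δ * v.2 ^ 2 - 2 * S * |v.2|))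

open Real in
theorem summable_gaussBound {δ : ℝ} (hδ : 0 < δ) (S : ℝ) : Summable (gaussBound δ S) := by
  have h := summable_pow_mul_jacobiTheta₂_term_bound S hδ 0
  simp only [pow_zero, one_mul, Int.cast_abs] at h
  exact (h.mul_of_nonneg h (fun _ => (exp_pos _).le) (fun _ => (exp_pos _).le)).congr
    fun v => by simp [gaussBound]

theorem abs_int_le_of_ne_zero {k : ℤ × ℤ} (hk : k ≠ 0) :
    (1 : ℝ) ≤ (k.1 : ℝ) ^ 2 + (k.2 : ℝ) ^ 2 := by
  have : 0 < k.1 ^ 2 + k.2 ^ 2 := by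
    by_contra! h
    have h1 : k.1 = 0 := by nlinarith [sq_nonneg k.1, sq_nonneg k.2]
    have h2 : k.2 = 0 := by nlinarith [sq_nonneg k.1, sq_nonneg k.2]
    exact hk (Prod.ext h1 h2)
  exact_mod_cast this

/-- A nondegenerate pair of linear forms is bounded below. -/
theorem mul_sq_add_sq_le {p q r s : ℝ} (m n : ℝ) :
    (p * s - q * r) ^ 2 * (m ^ 2 + n ^ 2) ≤
      (p ^ 2 + q ^ 2 + r ^ 2 + s ^ 2) * ((p * m + q * n) ^ 2 + (r * m + s * n) ^ 2) := by
  -- Cramer's rule expresses m and n through the two forms; the defect in the inequality is then the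
  -- sum of two squares of Lagrange's identity.
  have e1 : (p * s - q * r) * m = s * (p * m + q * n) - q * (r * m + s * n) := by ring
  have e2 : (p * s - q * r) * n = p * (r * m + s * n) - r * (p * m + q * n) := by ring
  rw [mul_add, ← mul_pow, ← mul_pow, e1, e2]
  generalize p * m + q * n = x
  generalize r * m + s * n = y
  nlinarith [sq_nonneg (s * y + q * x), sq_nonneg (p * x + r * y)]

/-- Gaussian terms with complex shifts are dominated by `gaussBound`. -/
theorem exists_gaussBound {p q r s : ℝ} (hΔ : p * s - q * r ≠ 0) (R : ℝ) :
    ∃ δ S K : ℝ, 0 < δ ∧ ∀ (v : ℤ × ℤ) (c d : ℂ), ‖c‖ ≤ R → ‖d‖ ≤ R →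
      ‖Complex.exp (-Real.pi * (((p * v.1 + q * v.2 : ℝ) + c) ^ 2
        + ((r * v.1 + s * v.2 : ℝ) + d) ^ 2))‖ ≤ K * gaussBound δ S v := by
  set T : ℝ := p ^ 2 + q ^ 2 + r ^ 2 + s ^ 2 with hT
  have hT0 : 0 < T := by
    by_contra! h
    have hp : p = 0 := by nlinarith [sq_nonneg p, sq_nonneg q, sq_nonneg r, sq_nonneg s]
    have hq : q = 0 := by nlinarith [sq_nonneg p, sq_nonneg q, sq_nonneg r, sq_nonneg s]
    simp [hp, hq] at hΔ
  have hΔ2 : 0 < (p * s - q * r) ^ 2 := by positivity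
  -- The rate comes from the lower bound for the forms, the linear term from the real parts of the
  -- shifts, and the constant from their imaginary parts, whose squares enter with the opposite
  -- sign.
  refine ⟨(p * s - q * r) ^ 2 / T, R * (|p| + |q| + |r| + |s|), Real.exp (2 * Real.pi * R ^ 2),
    by positivity, fun v c d hc hd => ?_⟩
  have hR : 0 ≤ R := (norm_nonneg c).trans hc
  rw [Complex.norm_exp, gaussBound, ← Real.exp_add, ← Real.exp_add, Real.exp_le_exp]
  have key : ∀ (x : ℝ) (z : ℂ), (((x : ℂ) + z) ^ 2).re = x ^ 2 + 2 * x * z.re + z.re ^ 2 - z.im ^ 2 := by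
    intro x z
    simp [pow_two]
    ring
  have hre : (-(Real.pi : ℂ) * (((p * v.1 + q * v.2 : ℝ) + c) ^ 2
        + ((r * v.1 + s * v.2 : ℝ) + d) ^ 2)).re = -Real.pi * ((((p * v.1 + q * v.2 : ℝ) + c) ^ 2).re
        + (((r * v.1 + s * v.2 : ℝ) + d) ^ 2).re) := by
    rw [← Complex.ofReal_neg, Complex.re_ofReal_mul, Complex.add_re]
  rw [hre, key, key]
  have low : (p * s - q * r) ^ 2 / T * (v.1 ^ 2 + v.2 ^ 2) ≤
      (p * v.1 + q * v.2) ^ 2 + (r * v.1 + s * v.2) ^ 2 := by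
    rw [div_mul_eq_mul_div, div_le_iff₀' hT0]
    exact mul_sq_add_sq_le _ _
  have hlin : ∀ (a b x : ℝ) , |x| ≤ R → -(R * (|a| * |(v.1 : ℝ)| + |b| * |(v.2 : ℝ)|)) ≤ (a * v.1 + b * v.2) * x := by
    intro a b x hx
    have : |(a * v.1 + b * v.2) * x| ≤ (|a| * |(v.1 : ℝ)| + |b| * |(v.2 : ℝ)|) * R := by
      rw [abs_mul]
      gcongr
      refine (abs_add_le _ _).trans ?_
      rw [abs_mul, abs_mul]
    have := neg_le_of_abs_le this
    linarith
  have h1 := hlin p q c.re ((Complex.abs_re_le_norm c).trans hc)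
  have h2 := hlin r s d.re ((Complex.abs_re_le_norm d).trans hd)
  have h3 : c.im ^ 2 ≤ R ^ 2 := sq_le_sq' (neg_le_of_abs_le ((Complex.abs_im_le_norm c).trans hc))
    (le_of_abs_le ((Complex.abs_im_le_norm c).trans hc))
  have h4 : d.im ^ 2 ≤ R ^ 2 := sq_le_sq' (neg_le_of_abs_le ((Complex.abs_im_le_norm d).trans hd))
    (le_of_abs_le ((Complex.abs_im_le_norm d).trans hd))
  have h5 := sq_nonneg c.re
  have h6 := sq_nonneg d.re
  have h7 : R * (|p| * |(v.1 : ℝ)| + |q| * |(v.2 : ℝ)|) + R * (|r| * |(v.1 : ℝ)| + |s| * |(v.2 : ℝ)|) ≤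
      R * (|p| + |q| + |r| + |s|) * |(v.1 : ℝ)| + R * (|p| + |q| + |r| + |s|) * |(v.2 : ℝ)| := by
    have : 0 ≤ R * ((|q| + |s|) * |(v.1 : ℝ)| + (|p| + |r|) * |(v.2 : ℝ)|) := by positivity
    nlinarith
  push_cast
  nlinarith [Real.pi_pos]

open Complex in
theorem summable_cexp_shifted {p q r s : ℝ} (hΔ : p * s - q * r ≠ 0) (c d : ℂ) :
    Summable fun v : ℤ × ℤ => cexp (-Real.pi * (((p * v.1 + q * v.2 : ℝ) + c) ^ 2
        + ((r * v.1 + s * v.2 : ℝ) + d) ^ 2)) := by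
  obtain ⟨δ, S, K, hδ, h⟩ := exists_gaussBound hΔ (max ‖c‖ ‖d‖)
  exact ((summable_gaussBound hδ S).mul_left K).of_norm_bounded
    fun v => h v c d (le_max_left _ _) (le_max_right _ _)

open Complex in
theorem ofReal_cpow_half {x : ℝ} (hx : 0 ≤ x) : (x : ℂ) ^ (1 / 2 : ℂ) = (√x : ℝ) := by
  rw [Real.sqrt_eq_rpow, Complex.ofReal_cpow hx]
  norm_num

open Complex in
/-- Poisson summation for shifted Gaussians on a planar lattice. -/
theorem tsum_cexp_shifted {p q r s : ℝ} (hΔ : p * s - q * r ≠ 0) (c d : ℂ) :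
    ∑' v : ℤ × ℤ, cexp (-Real.pi * (((p * v.1 + q * v.2 : ℝ) + c) ^ 2
        + ((r * v.1 + s * v.2 : ℝ) + d) ^ 2)) =
      ((1 / |p * s - q * r| : ℝ) : ℂ) * ∑' k : ℤ × ℤ,
        cexp (-Real.pi * ((((s * k.1 - r * k.2) / (p * s - q * r) : ℝ) : ℂ) ^ 2
            + (((p * k.2 - q * k.1) / (p * s - q * r) : ℝ) : ℂ) ^ 2)
          + 2 * Real.pi * I * (((s * k.1 - r * k.2) / (p * s - q * r) : ℝ) * c
            + ((p * k.2 - q * k.1) / (p * s - q * r) : ℝ) * d)) := by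
  set Δ := p * s - q * r with hΔdef
  -- C is the coefficient of n² in the quadratic form. One-dimensional Poisson summation in n, after
  -- completing the square, leaves a Gaussian in m with coefficient Δ²/C, to which Poisson summation
  -- applies again.
  set C : ℝ := q ^ 2 + s ^ 2 with hC
  have hC0 : 0 < C := by
    by_contra! h
    have hq : q = 0 := by nlinarith [sq_nonneg q, sq_nonneg s]
    have hs : s = 0 := by nlinarith [sq_nonneg q, sq_nonneg s]
    simp [hΔdef, hq, hs] at hΔ
  have hCc : (C : ℂ) ≠ 0 := by exact_mod_cast hC0.ne'
  have hΔc : (Δ : ℂ) ≠ 0 := by exact_mod_cast hΔ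
  have hCdef : (C : ℂ) = q ^ 2 + s ^ 2 := by simp [hC]
  have hΔd : (Δ : ℂ) = p * s - q * r := by simp [hΔdef]
  have hsC : (√C : ℝ) ≠ 0 := by positivity
  have hconst : ((1 / |Δ| : ℝ) : ℂ) = 1 / (C : ℂ) ^ (1 / 2 : ℂ) * (1 / ((Δ ^ 2 / C : ℝ) : ℂ) ^ (1 / 2 : ℂ)) := by
    rw [ofReal_cpow_half hC0.le, ofReal_cpow_half (by positivity), Real.sqrt_div (by positivity),
      Real.sqrt_sq_eq_abs]
    have : (|Δ| : ℝ) ≠ 0 := by positivity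
    norm_cast
    field_simp
  -- the intermediate double series
  let G : ℤ → ℤ → ℂ := fun m l => cexp (-Real.pi / C * (l ^ 2
    - 2 * I * l * (q * (p * m + c) + s * (r * m + d)) + (Δ * m + (s * c - q * d)) ^ 2))
  have step1 : ∀ m : ℤ, ∑' n : ℤ, cexp (-Real.pi * (((p * m + q * n : ℝ) + c) ^ 2
        + ((r * m + s * n : ℝ) + d) ^ 2)) = 1 / (C : ℂ) ^ (1 / 2 : ℂ) * ∑' l : ℤ, G m l := by
    intro m
    have h := Complex.tsum_exp_neg_quadratic (a := C) (by simpa using hC0)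
      (-(q * (p * m + c) + s * (r * m + d)))
    have h' := congrArg (fun z => cexp (-Real.pi * ((p * m + c) ^ 2 + (r * m + d) ^ 2)) * z) h
    beta_reduce at h'
    rw [mul_left_comm, ← tsum_mul_left, ← tsum_mul_left] at h'
    refine ((tsum_congr fun n => ?_).trans h').trans (congrArg _ (tsum_congr fun l => ?_))
    · rw [← Complex.exp_add]
      congr 1
      push_cast
      rw [hCdef]
      ring
    · simp only [G]
      rw [← Complex.exp_add]
      congr 1
      rw [hΔd]
      field_simp
      rw [hCdef]
      ring_nf
      rw [I_sq]
      ring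
  have step2 : ∀ l : ℤ, ∑' m : ℤ, G m l = 1 / ((Δ ^ 2 / C : ℝ) : ℂ) ^ (1 / 2 : ℂ) * ∑' k : ℤ,
      cexp (-Real.pi * ((((s * k - r * l) / Δ : ℝ) : ℂ) ^ 2
            + (((p * l - q * k) / Δ : ℝ) : ℂ) ^ 2)
          + 2 * Real.pi * I * (((s * k - r * l) / Δ : ℝ) * c
            + ((p * l - q * k) / Δ : ℝ) * d)) := by
    intro l
    have h := Complex.tsum_exp_neg_quadratic (a := (Δ ^ 2 / C : ℝ))
      (by rw [ofReal_re]; positivity) ((-Δ * (s * c - q * d) + I * l * (p * q + r * s)) / C)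
    have h' := congrArg (fun z => cexp (-Real.pi / C * (l ^ 2 - 2 * I * l * (q * c + s * d)
      + (s * c - q * d) ^ 2)) * z) h
    beta_reduce at h'
    rw [mul_left_comm, ← tsum_mul_left, ← tsum_mul_left] at h'
    refine ((tsum_congr fun m => ?_).trans h').trans (congrArg _ (tsum_congr fun k => ?_))
    · simp only [G]
      rw [← Complex.exp_add]
      congr 1
      push_cast
      field_simp
      ring
    · rw [← Complex.exp_add]
      congr 1
      push_cast
      field_simp
      rw [hCdef, hΔd]
      ring_nf
      simp only [I_sq, show I ^ 3 = -I by rw [pow_succ, I_sq]; ring, show I ^ 4 = 1 from I_pow_four]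
      ring
  let H : ℤ → ℤ → ℂ := fun k l => cexp (-Real.pi * ((((s * k - r * l) / Δ : ℝ) : ℂ) ^ 2
            + (((p * l - q * k) / Δ : ℝ) : ℂ) ^ 2)
          + 2 * Real.pi * I * (((s * k - r * l) / Δ : ℝ) * c
            + ((p * l - q * k) / Δ : ℝ) * d))
  -- Needed to exchange the two sums. The cross term in m and l is purely imaginary, so up to a
  -- constant the norm of G is that of a diagonal Gaussian with complex shifts.
  have hG : Summable fun v : ℤ × ℤ => G v.1 v.2 := by
    have hsC2 : ((√C : ℝ) : ℂ) ^ 2 = C := by exact_mod_cast Real.sq_sqrt hC0.le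
    have hsCc : ((√C : ℝ) : ℂ) ≠ 0 := by exact_mod_cast hsC
    have hdet : Δ / √C * (1 / √C) - 0 * 0 ≠ 0 := by
      rw [mul_zero, sub_zero]
      positivity
    have h := (summable_cexp_shifted hdet ((s * c - q * d) / (√C : ℝ))
      (-I * (q * c + s * d) / (√C : ℝ))).norm.mul_left ‖cexp (-Real.pi / C * (q * c + s * d) ^ 2)‖
    refine Summable.of_norm (h.congr fun v => ?_)
    rw [← norm_mul, ← Complex.exp_add]
    have : -(Real.pi : ℂ) / C * (v.2 ^ 2
        - 2 * I * v.2 * (q * (p * v.1 + c) + s * (r * v.1 + d)) + (Δ * v.1 + (s * c - q * d)) ^ 2)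
        = (-(Real.pi : ℂ) / C * (q * c + s * d) ^ 2 + -(Real.pi : ℂ)
          * (((Δ / √C * v.1 + 0 * v.2 : ℝ) + (s * c - q * d) / (√C : ℝ)) ^ 2
          + ((0 * v.1 + 1 / √C * v.2 : ℝ) + -I * (q * c + s * d) / (√C : ℝ)) ^ 2))
          + ((2 * Real.pi / C * v.2 * v.1 * (p * q + r * s) : ℝ) : ℂ) * I := by
      push_cast
      rw [← hsC2]
      field_simp
      ring_nf
      rw [I_sq]
      ring
    simp only [G]
    rw [this, Complex.exp_add _ (_ * I), norm_mul, Complex.norm_exp_ofReal_mul_I, mul_one]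
  have hdual : Summable fun k : ℤ × ℤ => H k.1 k.2 := by
    have hdet : s / Δ * (p / Δ) - (-r / Δ) * (-q / Δ) ≠ 0 := by
      have : s / Δ * (p / Δ) - (-r / Δ) * (-q / Δ) = 1 / Δ := by
        field_simp
        rw [hΔdef]
        ring
      rw [this]
      positivity
    -- Completing the square turns the characters of the dual sum into imaginary shifts.
    refine ((summable_cexp_shifted hdet (-I * c) (-I * d)).mul_left
      (cexp (-Real.pi * (c ^ 2 + d ^ 2)))).congr fun v => ?_
    simp only [H]
    rw [← Complex.exp_add]
    congr 1
    push_cast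
    field_simp
    ring_nf
    rw [I_sq]
    ring
  calc _ = ∑' m : ℤ, 1 / (C : ℂ) ^ (1 / 2 : ℂ) * ∑' l : ℤ, G m l := by
        rw [(summable_cexp_shifted hΔ c d).tsum_prod]
        exact tsum_congr step1
    _ = 1 / (C : ℂ) ^ (1 / 2 : ℂ) * ∑' l : ℤ, 1 / ((Δ ^ 2 / C : ℝ) : ℂ) ^ (1 / 2 : ℂ)
          * ∑' k : ℤ, H k l := by
        rw [tsum_mul_left, ← Summable.tsum_comm (f := G) hG, tsum_congr step2]
    _ = _ := by
        rw [tsum_mul_left, ← mul_assoc, ← hconst, Summable.tsum_comm (f := H) hdual,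
          ← hdual.tsum_prod]

open Complex in
/-- The sum over a planar lattice coset of a Gaussian times the odd linear form `x + y` is bounded
by the corresponding sum over the dual lattice. -/
theorem abs_tsum_linear_gaussian_le {p q r s : ℝ} (hΔ : p * s - q * r ≠ 0) (x₀ y₀ : ℝ) :
    |∑' v : ℤ × ℤ, (p * v.1 + q * v.2 + x₀ + (r * v.1 + s * v.2 + y₀)) *
      Real.exp (-Real.pi * ((p * v.1 + q * v.2 + x₀) ^ 2 + (r * v.1 + s * v.2 + y₀) ^ 2))| ≤
    1 / |p * s - q * r| * ∑' k : ℤ × ℤ,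
      |(s * k.1 - r * k.2) / (p * s - q * r) + (p * k.2 - q * k.1) / (p * s - q * r)| *
      Real.exp (-Real.pi * (((s * k.1 - r * k.2) / (p * s - q * r)) ^ 2
        + ((p * k.2 - q * k.1) / (p * s - q * r)) ^ 2)) := by
  set Δ := p * s - q * r with hΔdef
  let ξ : ℤ × ℤ → ℝ := fun k => (s * k.1 - r * k.2) / Δ
  let η : ℤ × ℤ → ℝ := fun k => (p * k.2 - q * k.1) / Δ
  -- Both coordinates are shifted by the same z. The derivative at 0 brings down the factor x + y on
  -- the lattice side and ξ + η on the dual side; the latter vanishes at frequency zero.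
  let F : ℤ × ℤ → ℂ → ℂ := fun v z => cexp (-Real.pi * (((p * v.1 + q * v.2 : ℝ) + (x₀ - z)) ^ 2
        + ((r * v.1 + s * v.2 : ℝ) + (y₀ - z)) ^ 2))
  let G : ℤ × ℤ → ℂ → ℂ := fun k z => cexp (-Real.pi * ((ξ k : ℂ) ^ 2 + (η k : ℂ) ^ 2)
          + 2 * Real.pi * I * (ξ k * (x₀ - z) + η k * (y₀ - z)))
  set R : ℝ := |x₀| + |y₀| + 1 with hR
  have hx : ∀ z ∈ Metric.ball (0 : ℂ) 1, ‖(x₀ : ℂ) - z‖ ≤ R := fun z hz => by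
    rw [mem_ball_zero_iff] at hz
    have := norm_sub_le (x₀ : ℂ) z
    rw [Complex.norm_real, Real.norm_eq_abs] at this
    linarith [abs_nonneg y₀]
  have hy : ∀ z ∈ Metric.ball (0 : ℂ) 1, ‖(y₀ : ℂ) - z‖ ≤ R := fun z hz => by
    rw [mem_ball_zero_iff] at hz
    have := norm_sub_le (y₀ : ℂ) z
    rw [Complex.norm_real, Real.norm_eq_abs] at this
    linarith [abs_nonneg x₀]
  have h0 : (0 : ℂ) ∈ Metric.ball (0 : ℂ) 1 := by simp
  have dF : ∀ v z, HasDerivAt (F v) (2 * Real.pi * ((p * v.1 + q * v.2 : ℝ) + (x₀ - z)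
      + ((r * v.1 + s * v.2 : ℝ) + (y₀ - z))) * F v z) z := by
    intro v z
    have h1 := ((((hasDerivAt_id z).const_sub (x₀ : ℂ)).const_add ((p * v.1 + q * v.2 : ℝ) : ℂ)).pow 2
      |>.add ((((hasDerivAt_id z).const_sub (y₀ : ℂ)).const_add
        ((r * v.1 + s * v.2 : ℝ) : ℂ)).pow 2)).const_mul (-Real.pi : ℂ) |>.cexp
    refine (h1.congr_deriv ?_)
    simp [F]
    ring
  have dG : ∀ k z, HasDerivAt (G k) (-2 * Real.pi * I * (ξ k + η k) * G k z) z := by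
    intro k z
    have h1 := (((((hasDerivAt_id z).const_sub (x₀ : ℂ)).const_mul (ξ k : ℂ)).add
      (((hasDerivAt_id z).const_sub (y₀ : ℂ)).const_mul (η k : ℂ))).const_mul
        (2 * Real.pi * I)).const_add (-Real.pi * ((ξ k : ℂ) ^ 2 + (η k : ℂ) ^ 2)) |>.cexp
    refine (h1.congr_deriv ?_)
    simp [G]
    ring
  obtain ⟨δ, S, K, hδ, hb⟩ := exists_gaussBound hΔ R
  have sF := hasSum_deriv_of_summable_norm (F := F) ((summable_gaussBound hδ S).mul_left K)
    (fun v z _ => (dF v z).differentiableAt.differentiableWithinAt) Metric.isOpen_ball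
    (fun v z hz => hb v _ _ (hx z hz) (hy z hz)) h0
  have hdet : s / Δ * (p / Δ) - (-r / Δ) * (-q / Δ) ≠ 0 := by
    have : s / Δ * (p / Δ) - (-r / Δ) * (-q / Δ) = 1 / Δ := by
      field_simp
      rw [hΔdef]
      ring
    rw [this]
    positivity
  obtain ⟨δ', S', K', hδ', hb'⟩ := exists_gaussBound hdet R
  have bG : ∀ k z, z ∈ Metric.ball (0 : ℂ) 1 → ‖G k z‖ ≤
      Real.exp (Real.pi * (R ^ 2 + R ^ 2)) * K' * gaussBound δ' S' k := by
    intro k z hz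
    have e : G k z = cexp (-Real.pi * (((x₀ - z) ^ 2 + (y₀ - z) ^ 2))) *
        cexp (-Real.pi * (((s / Δ * k.1 + -r / Δ * k.2 : ℝ) + (-I * (x₀ - z))) ^ 2
        + ((-q / Δ * k.1 + p / Δ * k.2 : ℝ) + (-I * (y₀ - z))) ^ 2)) := by
      simp only [G, ξ, η]
      rw [← Complex.exp_add]
      congr 1
      push_cast
      ring_nf
      rw [I_sq]
      ring
    rw [e, norm_mul, mul_assoc]
    refine mul_le_mul ?_ (hb' k _ _ (by simpa using hx z hz) (by simpa using hy z hz))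
      (norm_nonneg _) (Real.exp_pos _).le
    rw [Complex.norm_exp, Real.exp_le_exp]
    refine (Complex.re_le_norm _).trans ?_
    rw [norm_mul, norm_neg, Complex.norm_real, Real.norm_of_nonneg Real.pi_pos.le]
    refine mul_le_mul_of_nonneg_left ((norm_add_le _ _).trans ?_) Real.pi_pos.le
    rw [norm_pow, norm_pow]
    exact add_le_add (pow_le_pow_left₀ (norm_nonneg _) (hx z hz) 2)
      (pow_le_pow_left₀ (norm_nonneg _) (hy z hz) 2)
  have sG := hasSum_deriv_of_summable_norm (F := G) ((summable_gaussBound hδ' S').mul_left _)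
    (fun v z _ => (dG v z).differentiableAt.differentiableWithinAt) Metric.isOpen_ball bG h0
  have hFG : (fun z => ∑' v, F v z) = fun z => ((1 / |Δ| : ℝ) : ℂ) * ∑' k, G k z :=
    funext fun z => tsum_cexp_shifted hΔ (x₀ - z) (y₀ - z)
  have dtG : deriv (fun z => ∑' v, F v z) 0 =
      ((1 / |Δ| : ℝ) : ℂ) * deriv (fun z => ∑' k, G k z) 0 := by
    rw [hFG, deriv_const_mul_field]
  have hG0 : ∀ k, ‖deriv (G k) 0‖ = 2 * Real.pi * (|ξ k + η k| *
      Real.exp (-Real.pi * (ξ k ^ 2 + η k ^ 2))) := by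
    intro k
    have e : (-(Real.pi : ℂ) * ((ξ k : ℂ) ^ 2 + (η k : ℂ) ^ 2) + 2 * Real.pi * I * (ξ k * (x₀ - 0) + η k * (y₀ - 0))) =
      ((-Real.pi * (ξ k ^ 2 + η k ^ 2) : ℝ) : ℂ) + ((2 * Real.pi * (ξ k * x₀ + η k * y₀) : ℝ) : ℂ) * I := by
      push_cast
      ring
    rw [(dG k 0).deriv]
    simp only [G]
    rw [e, Complex.exp_add, norm_mul, norm_mul _ (cexp (_ * I)), Complex.norm_exp_ofReal_mul_I, mul_one,
      ← Complex.ofReal_exp, Complex.norm_real, Real.norm_of_nonneg (Real.exp_pos _).le,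
      ← Complex.ofReal_add, norm_mul, Complex.norm_real, Real.norm_eq_abs]
    simp [abs_of_pos Real.pi_pos]
    ring
  have hF0 : ∀ v : ℤ × ℤ, deriv (F v) 0 = ((2 * Real.pi * ((p * v.1 + q * v.2 + x₀ + (r * v.1 + s * v.2 + y₀)) *
      Real.exp (-Real.pi * ((p * v.1 + q * v.2 + x₀) ^ 2 + (r * v.1 + s * v.2 + y₀) ^ 2))) : ℝ) : ℂ) := by
    intro v
    rw [(dF v 0).deriv]
    simp only [F]
    push_cast
    simp only [sub_zero]
    ring
  have h2π : (0 : ℝ) < 2 * Real.pi := by positivity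
  have hn := sG.summable.norm
  have main : ‖deriv (fun z => ∑' v, F v z) 0‖ ≤ 1 / |Δ| * ∑' k, ‖deriv (G k) 0‖ := by
    rw [dtG, norm_mul, Complex.norm_real, Real.norm_of_nonneg (by positivity), ← sG.tsum_eq]
    exact mul_le_mul_of_nonneg_left (norm_tsum_le_tsum_norm hn) (by positivity)
  rw [← sF.tsum_eq, tsum_congr hF0, ← Complex.ofReal_tsum, tsum_mul_left, Complex.norm_real,
    norm_mul, Real.norm_of_nonneg h2π.le, Real.norm_eq_abs, tsum_congr hG0, tsum_mul_left,
    mul_left_comm] at main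
  exact le_of_mul_le_mul_left main h2π

/-! ### Theta terms as integrals along a geodesic -/

/-- The Gaussian primitive `∫₀ˣ e^{-πu²} du`. -/
noncomputable def gaussInt (x : ℝ) : ℝ := ∫ u in (0 : ℝ)..x, Real.exp (-Real.pi * u ^ 2)

theorem hasDerivAt_gaussInt (x : ℝ) : HasDerivAt gaussInt (Real.exp (-Real.pi * x ^ 2)) x :=
  intervalIntegral.integral_hasDerivAt_right
    ((by fun_prop : Continuous fun u : ℝ => Real.exp (-Real.pi * u ^ 2)).intervalIntegrable _ _)
    (by fun_prop : Continuous fun u : ℝ => Real.exp (-Real.pi * u ^ 2)).stronglyMeasurable.stronglyMeasurableAtFilter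
    (by fun_prop)

/-- The contribution of a point with conjugates `x`, `y` to the indefinite theta series cut out by
two points at distance `ℓ` on a geodesic. -/
noncomputable def geodesicTerm (ℓ t x y : ℝ) : ℝ :=
  (gaussInt (√t * (Real.exp ℓ * x - Real.exp (-ℓ) * y)) - gaussInt (√t * (x - y))) *
    Real.exp (-2 * Real.pi * t * (x * y))

/-- The integrand whose integral along the geodesic is `geodesicTerm`. -/
noncomputable def geodesicDensity (t x y u : ℝ) : ℝ :=
  √t * (Real.exp u * x + Real.exp (-u) * y) *
    Real.exp (-Real.pi * t * ((Real.exp u * x) ^ 2 + (Real.exp (-u) * y) ^ 2))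

theorem continuous_geodesicDensity (t x y : ℝ) : Continuous (geodesicDensity t x y) := by
  unfold geodesicDensity
  fun_prop

/-- The identity (e^u x - e^{-u} y)² + 2xy = (e^u x)² + (e^{-u} y)² makes the derivative in u of the
product of Gaussian primitive and exponential a positive definite Gaussian times a linear form. -/
theorem geodesicTerm_eq_integral {t : ℝ} (ht : 0 ≤ t) (ℓ x y : ℝ) :
    geodesicTerm ℓ t x y = ∫ u in (0 : ℝ)..ℓ, geodesicDensity t x y u := by
  have h : ∀ u : ℝ, HasDerivAt (fun u => gaussInt (√t * (Real.exp u * x - Real.exp (-u) * y)) *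
      Real.exp (-2 * Real.pi * t * (x * y))) (geodesicDensity t x y u) u := by
    intro u
    have h1 : HasDerivAt (fun u => √t * (Real.exp u * x - Real.exp (-u) * y))
        (√t * (Real.exp u * x + Real.exp (-u) * y)) u := by
      refine ((((Real.hasDerivAt_exp u).mul_const x).sub
        (((hasDerivAt_neg u).exp).mul_const y)).const_mul (√t)).congr_deriv ?_
      ring
    refine (((hasDerivAt_gaussInt _).comp u h1).mul_const _).congr_deriv ?_
    unfold geodesicDensity
    rw [mul_right_comm, ← Real.exp_add, mul_comm]
    congr 2
    rw [mul_pow, Real.sq_sqrt ht]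
    have : Real.exp u * Real.exp (-u) = 1 := by rw [← Real.exp_add]; simp
    linear_combination 2 * Real.pi * t * x * y * this
  rw [intervalIntegral.integral_eq_sub_of_hasDerivAt (fun u _ => h u)
    ((continuous_geodesicDensity t x y).intervalIntegrable _ _)]
  simp [geodesicTerm, sub_mul]

/-- Half of the exponent absorbs the linear factor, and the other half is a Gaussian already known
to be summable. -/
theorem summable_abs_mul_gaussian {a₁ a₂ b₁ b₂ : ℝ} (hD : a₁ * b₂ - a₂ * b₁ ≠ 0) (x₀ y₀ : ℝ)
    {c : ℝ} (hc : 0 < c) :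
    Summable fun v : ℤ × ℤ => (|a₁ * v.1 + a₂ * v.2 + x₀| + |b₁ * v.1 + b₂ * v.2 + y₀|) *
      Real.exp (-c * ((a₁ * v.1 + a₂ * v.2 + x₀) ^ 2 + (b₁ * v.1 + b₂ * v.2 + y₀) ^ 2)) := by
  set k : ℝ := √(c / 2 / Real.pi) with hk
  have hk0 : 0 < k := by positivity
  have hk2 : Real.pi * k ^ 2 = c / 2 := by
    rw [hk, Real.sq_sqrt (by positivity)]
    field_simp
  have hdet : k * a₁ * (k * b₂) - k * a₂ * (k * b₁) ≠ 0 := by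
    have : k * a₁ * (k * b₂) - k * a₂ * (k * b₁) = k ^ 2 * (a₁ * b₂ - a₂ * b₁) := by ring
    rw [this]
    exact mul_ne_zero (by positivity) hD
  have h := (summable_cexp_shifted hdet ((k * x₀ : ℝ) : ℂ) ((k * y₀ : ℝ) : ℂ)).norm.mul_left
    (Real.exp (1 / c))
  refine h.of_nonneg_of_le (fun v => by positivity) fun v => ?_
  have e : ∀ X Y : ℝ, ‖Complex.exp (-Real.pi * (((X : ℂ) + ((k * x₀ : ℝ) : ℂ)) ^ 2
      + ((Y : ℂ) + ((k * y₀ : ℝ) : ℂ)) ^ 2))‖ =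
      Real.exp (-Real.pi * ((X + k * x₀) ^ 2 + (Y + k * y₀) ^ 2)) := fun X Y => by
    rw [Complex.norm_exp]
    congr 1
    norm_cast
  rw [e, show k * a₁ * (v.1 : ℝ) + k * a₂ * v.2 + k * x₀ = k * (a₁ * v.1 + a₂ * v.2 + x₀) by ring,
    show k * b₁ * (v.1 : ℝ) + k * b₂ * v.2 + k * y₀ = k * (b₁ * v.1 + b₂ * v.2 + y₀) by ring]
  generalize a₁ * (v.1 : ℝ) + a₂ * v.2 + x₀ = x
  generalize b₁ * (v.1 : ℝ) + b₂ * v.2 + y₀ = y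
  -- This is (c|z| - 1)² ≥ 0 divided by 2c.
  have hz : ∀ z : ℝ, |z| ≤ c / 2 * z ^ 2 + 1 / (2 * c) := fun z => by
    have h1 : 0 ≤ (c * |z| - 1) ^ 2 / (2 * c) := by positivity
    have h2 : (c * |z| - 1) ^ 2 / (2 * c) = c / 2 * z ^ 2 + 1 / (2 * c) - |z| := by
      rw [← sq_abs z]
      field_simp
      ring
    linarith
  calc (|x| + |y|) * Real.exp (-c * (x ^ 2 + y ^ 2))
      ≤ Real.exp (|x| + |y|) * Real.exp (-c * (x ^ 2 + y ^ 2)) := by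
        gcongr
        linarith [Real.add_one_le_exp (|x| + |y|)]
    _ ≤ Real.exp (1 / c) * Real.exp (-Real.pi * ((k * x) ^ 2 + (k * y) ^ 2)) := by
        rw [← Real.exp_add, ← Real.exp_add, Real.exp_le_exp, mul_pow, mul_pow]
        have e2 : -Real.pi * (k ^ 2 * x ^ 2 + k ^ 2 * y ^ 2) = -(c / 2) * (x ^ 2 + y ^ 2) := by
          rw [← hk2]; ring
        have e3 : 1 / c = 1 / (2 * c) + 1 / (2 * c) := by field_simp; norm_num
        rw [e2, e3]
        linarith [hz x, hz y]

/-- Uniform bounds for the hyperbolic rotation of a pair of reals. -/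
theorem abs_exp_mul_add_le {L u : ℝ} (hu : |u| ≤ L) (x y : ℝ) :
    |Real.exp u * x + Real.exp (-u) * y| ≤ Real.exp L * (|x| + |y|) := by
  have h1 : Real.exp u ≤ Real.exp L := Real.exp_le_exp.2 ((le_abs_self u).trans hu)
  have h2 : Real.exp (-u) ≤ Real.exp L := Real.exp_le_exp.2 ((neg_le_abs u).trans hu)
  refine (abs_add_le _ _).trans ?_
  rw [abs_mul, abs_mul, Real.abs_exp, Real.abs_exp, mul_add]
  gcongr

theorem le_exp_mul_sq_add {L u : ℝ} (hu : |u| ≤ L) (x y : ℝ) :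
    Real.exp (-2 * L) * (x ^ 2 + y ^ 2) ≤ (Real.exp u * x) ^ 2 + (Real.exp (-u) * y) ^ 2 := by
  rw [mul_pow, mul_pow, ← Real.exp_nat_mul, ← Real.exp_nat_mul, mul_add]
  have := neg_le_of_abs_le hu
  have := le_of_abs_le hu
  refine add_le_add (mul_le_mul_of_nonneg_right (Real.exp_le_exp.2 ?_) (sq_nonneg _))
    (mul_le_mul_of_nonneg_right (Real.exp_le_exp.2 ?_) (sq_nonneg _)) <;> push_cast <;> linarith

section lattice

variable {a₁ a₂ b₁ b₂ : ℝ}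

theorem abs_geodesicDensity_le {t L u : ℝ} (ht : 0 ≤ t) (hu : |u| ≤ L) (x y : ℝ) :
    |geodesicDensity t x y u| ≤ √t * Real.exp L * ((|x| + |y|) *
      Real.exp (-(Real.pi * t * Real.exp (-2 * L)) * (x ^ 2 + y ^ 2))) := by
  unfold geodesicDensity
  rw [abs_mul, abs_mul, abs_of_nonneg (Real.sqrt_nonneg t), Real.abs_exp, ← mul_assoc,
    mul_assoc (√t) (Real.exp L)]
  refine mul_le_mul (mul_le_mul_of_nonneg_left (abs_exp_mul_add_le hu x y) (Real.sqrt_nonneg t))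
    (Real.exp_le_exp.2 ?_) (Real.exp_pos _).le (by positivity)
  have := mul_le_mul_of_nonneg_left (le_exp_mul_sq_add hu x y)
    (mul_nonneg Real.pi_pos.le ht)
  linarith

/-- Dominated convergence: on the compact range of u the densities have a common summable majorant,
so sum and integral may be exchanged. This also yields absolute convergence of the indefinite
series. -/
theorem hasSum_geodesicTerm (hD : a₁ * b₂ - a₂ * b₁ ≠ 0) (x₀ y₀ ℓ : ℝ) {t : ℝ} (ht : 0 < t) :
    HasSum (fun v : ℤ × ℤ =>
        geodesicTerm ℓ t (a₁ * v.1 + a₂ * v.2 + x₀) (b₁ * v.1 + b₂ * v.2 + y₀))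
      (∫ u in (0 : ℝ)..ℓ, ∑' v : ℤ × ℤ,
        geodesicDensity t (a₁ * v.1 + a₂ * v.2 + x₀) (b₁ * v.1 + b₂ * v.2 + y₀) u) := by
  simp_rw [geodesicTerm_eq_integral ht.le]
  have hs := (summable_abs_mul_gaussian hD x₀ y₀
    (c := Real.pi * t * Real.exp (-2 * |ℓ|)) (by positivity)).mul_left (√t * Real.exp |ℓ|)
  have hu : ∀ u ∈ Set.uIoc 0 ℓ, |u| ≤ |ℓ| := fun u hu => by
    have := Set.uIoc_subset_uIcc hu
    simpa using Set.abs_sub_left_of_mem_uIcc this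
  refine intervalIntegral.hasSum_integral_of_dominated_convergence (fun v _ => _)
    (fun v => (continuous_geodesicDensity _ _ _).aestronglyMeasurable)
    (fun v => Filter.Eventually.of_forall fun u h => abs_geodesicDensity_le ht.le (hu u h) _ _)
    (Filter.Eventually.of_forall fun u _ => hs) intervalIntegrable_const
    (Filter.Eventually.of_forall fun u h => (Summable.of_norm_bounded hs
      fun v => abs_geodesicDensity_le ht.le (hu u h) _ _).hasSum)

/-- The dual lattice sum decays exponentially as the scale tends to zero. -/
theorem exists_abs_tsum_geodesicDensity_le (hD : a₁ * b₂ - a₂ * b₁ ≠ 0) (x₀ y₀ L : ℝ) :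
    ∃ C c : ℝ, 0 < c ∧ 0 ≤ C ∧ ∀ t u : ℝ, 0 < t → t ≤ 1 → |u| ≤ L →
      |∑' v : ℤ × ℤ, geodesicDensity t (a₁ * v.1 + a₂ * v.2 + x₀) (b₁ * v.1 + b₂ * v.2 + y₀) u| ≤
        C * (1 / t) ^ 2 * Real.exp (-c * (1 / t)) := by
  set D := a₁ * b₂ - a₂ * b₁ with hDdef
  set κ := Real.exp (-2 * L) with hκ
  have hdual : b₂ / D * (a₁ / D) - (-b₁ / D) * (-a₂ / D) ≠ 0 := by
    have : b₂ / D * (a₁ / D) - (-b₁ / D) * (-a₂ / D) = 1 / D := by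
      field_simp
      rw [hDdef]
      ring
    rw [this]
    positivity
  -- m is a positive lower bound for the dual form off the origin; it sets the rate of decay. The
  -- denominator T + 1 spares a proof that T is nonzero.
  obtain ⟨m, hm, hmk⟩ : ∃ m : ℝ, 0 < m ∧ ∀ k : ℤ × ℤ, k ≠ 0 →
      m ≤ (b₂ / D * k.1 + -b₁ / D * k.2) ^ 2 + (-a₂ / D * k.1 + a₁ / D * k.2) ^ 2 := by
    set T := (b₂ / D) ^ 2 + (-b₁ / D) ^ 2 + (-a₂ / D) ^ 2 + (a₁ / D) ^ 2 with hT
    have hT0 : 0 ≤ T := by positivity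
    refine ⟨(b₂ / D * (a₁ / D) - (-b₁ / D) * (-a₂ / D)) ^ 2 / (T + 1), by positivity, fun k hk => ?_⟩
    rw [div_le_iff₀' (by positivity)]
    have h1 := mul_sq_add_sq_le (p := b₂ / D) (q := -b₁ / D) (r := -a₂ / D) (s := a₁ / D) k.1 k.2
    have h2 := abs_int_le_of_ne_zero hk
    have h3 : 0 < (b₂ / D * (a₁ / D) - (-b₁ / D) * (-a₂ / D)) ^ 2 := by positivity
    have h4 : 0 ≤ (b₂ / D * k.1 + -b₁ / D * k.2) ^ 2 + (-a₂ / D * k.1 + a₁ / D * k.2) ^ 2 := by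
      positivity
    rw [← hT] at h1
    nlinarith
  have hsum := summable_abs_mul_gaussian hdual 0 0 (c := Real.pi * κ) (by positivity)
  simp only [add_zero] at hsum
  set W := ∑' k : ℤ × ℤ, (|b₂ / D * (k.1 : ℝ) + -b₁ / D * k.2| + |-a₂ / D * k.1 + a₁ / D * k.2|) *
    Real.exp (-(Real.pi * κ) * ((b₂ / D * k.1 + -b₁ / D * k.2) ^ 2
      + (-a₂ / D * k.1 + a₁ / D * k.2) ^ 2)) with hW
  have hW0 : 0 ≤ W := tsum_nonneg fun k => by positivity
  refine ⟨1 / |D| * (Real.exp L * Real.exp (Real.pi * κ * m)) * W, Real.pi * κ * m, by positivity,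
    by positivity, fun t u ht ht1 hu => ?_⟩
  have hst : 0 < √t := Real.sqrt_pos.2 ht
  have hst2 : √t ^ 2 = t := Real.sq_sqrt ht.le
  have hee : Real.exp u * Real.exp (-u) = 1 := by rw [← Real.exp_add]; simp
  have hΔ : √t * Real.exp u * a₁ * (√t * Real.exp (-u) * b₂)
      - √t * Real.exp u * a₂ * (√t * Real.exp (-u) * b₁) = t * D := by
    rw [hDdef]
    linear_combination √t ^ 2 * (a₁ * b₂ - a₂ * b₁) * hee + (a₁ * b₂ - a₂ * b₁) * hst2
  have hmain := abs_tsum_linear_gaussian_le (p := √t * Real.exp u * a₁) (q := √t * Real.exp u * a₂)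
    (r := √t * Real.exp (-u) * b₁) (s := √t * Real.exp (-u) * b₂)
    (by rw [hΔ]; exact mul_ne_zero ht.ne' hD) (√t * Real.exp u * x₀) (√t * Real.exp (-u) * y₀)
  rw [hΔ] at hmain
  -- The factors √t e^{±u} are moved into the lattice, whose determinant becomes tD because e^u and
  -- e^{-u} cancel.
  have hl : ∀ v : ℤ × ℤ, geodesicDensity t (a₁ * v.1 + a₂ * v.2 + x₀) (b₁ * v.1 + b₂ * v.2 + y₀) u =
    (√t * Real.exp u * a₁ * v.1 + √t * Real.exp u * a₂ * v.2 + √t * Real.exp u * x₀ +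
      (√t * Real.exp (-u) * b₁ * v.1 + √t * Real.exp (-u) * b₂ * v.2 + √t * Real.exp (-u) * y₀)) *
      Real.exp (-Real.pi * ((√t * Real.exp u * a₁ * v.1 + √t * Real.exp u * a₂ * v.2
        + √t * Real.exp u * x₀) ^ 2 +
        (√t * Real.exp (-u) * b₁ * v.1 + √t * Real.exp (-u) * b₂ * v.2
          + √t * Real.exp (-u) * y₀) ^ 2)) := by
    intro v
    unfold geodesicDensity
    congr 1
    · ring
    · congr 1
      linear_combination Real.pi * ((Real.exp u * (a₁ * v.1 + a₂ * v.2 + x₀)) ^ 2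
        + (Real.exp (-u) * (b₁ * v.1 + b₂ * v.2 + y₀)) ^ 2) * hst2
  rw [tsum_congr hl]
  refine hmain.trans ?_
  have hT1 : 1 ≤ 1 / t := by rw [le_div_iff₀ ht]; linarith
  set T := 1 / t with hT
  have hξ : ∀ k : ℤ × ℤ, (√t * Real.exp (-u) * b₂ * k.1 - √t * Real.exp (-u) * b₁ * k.2) / (t * D)
      = √T * (Real.exp (-u) * (b₂ / D * k.1 + -b₁ / D * k.2)) := by
    intro k
    rw [hT, Real.sqrt_div zero_le_one, Real.sqrt_one]
    nth_rewrite 3 [← hst2]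
    field_simp
    ring
  have hη : ∀ k : ℤ × ℤ, (√t * Real.exp u * a₁ * k.2 - √t * Real.exp u * a₂ * k.1) / (t * D)
      = √T * (Real.exp (- -u) * (-a₂ / D * k.1 + a₁ / D * k.2)) := by
    intro k
    rw [hT, Real.sqrt_div zero_le_one, Real.sqrt_one, neg_neg]
    nth_rewrite 3 [← hst2]
    field_simp
    ring
  simp_rw [hξ, hη]
  have hu' : |-u| ≤ L := by rwa [abs_neg]
  have hTpos : 0 < T := by positivity
  have hterm : ∀ k : ℤ × ℤ, |√T * (Real.exp (-u) * (b₂ / D * k.1 + -b₁ / D * k.2))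
        + √T * (Real.exp (- -u) * (-a₂ / D * k.1 + a₁ / D * k.2))| *
      Real.exp (-Real.pi * ((√T * (Real.exp (-u) * (b₂ / D * k.1 + -b₁ / D * k.2))) ^ 2
        + (√T * (Real.exp (- -u) * (-a₂ / D * k.1 + a₁ / D * k.2))) ^ 2)) ≤
      T * (Real.exp L * Real.exp (Real.pi * κ * m)) * Real.exp (-(Real.pi * κ * m) * T) *
      ((|b₂ / D * (k.1 : ℝ) + -b₁ / D * k.2| + |-a₂ / D * k.1 + a₁ / D * k.2|) *
      Real.exp (-(Real.pi * κ) * ((b₂ / D * k.1 + -b₁ / D * k.2) ^ 2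
      + (-a₂ / D * k.1 + a₁ / D * k.2) ^ 2))) := by
    intro k
    -- The zero frequency contributes nothing because of the linear factor; without this there would
    -- be no decay.
    rcases eq_or_ne k 0 with rfl | hk
    · simp
    have h1 := hmk k hk
    generalize b₂ / D * (k.1 : ℝ) + -b₁ / D * k.2 = x at *
    generalize -a₂ / D * (k.1 : ℝ) + a₁ / D * k.2 = y at *
    have h2 := abs_exp_mul_add_le hu' x y
    have h3 := le_exp_mul_sq_add hu' x y
    rw [← hκ] at h3
    have hsT : √T ≤ T := by
      rw [Real.sqrt_le_left hTpos.le]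
      nlinarith
    calc _ ≤ T * (Real.exp L * (|x| + |y|)) * Real.exp (-Real.pi * (T * (κ * (x ^ 2 + y ^ 2)))) := by
          rw [← mul_add, abs_mul, abs_of_nonneg (Real.sqrt_nonneg T), mul_pow (√T),
            mul_pow (√T), ← mul_add, Real.sq_sqrt hTpos.le]
          refine mul_le_mul (mul_le_mul hsT h2 (abs_nonneg _) hTpos.le) (Real.exp_le_exp.2 ?_)
            (Real.exp_pos _).le (by positivity)
          have := mul_le_mul_of_nonneg_left h3 (mul_nonneg Real.pi_pos.le hTpos.le)
          linarith
      _ ≤ T * (Real.exp L * (|x| + |y|)) * (Real.exp (Real.pi * κ * m) *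
            Real.exp (-(Real.pi * κ * m) * T) * Real.exp (-(Real.pi * κ) * (x ^ 2 + y ^ 2))) := by
          refine mul_le_mul_of_nonneg_left ?_ (by positivity)
          rw [← Real.exp_add, ← Real.exp_add, Real.exp_le_exp]
          -- Since T ≥ 1 and the form is at least m, the exponential splits into a factor decaying
          -- in T and a summable factor free of T.
          have : 0 ≤ Real.pi * κ * ((T - 1) * (x ^ 2 + y ^ 2 - m)) :=
            mul_nonneg (by positivity) (mul_nonneg (by linarith) (by linarith))
          linarith
      _ = _ := by ring
  have hS := hsum.mul_left (T * (Real.exp L * Real.exp (Real.pi * κ * m))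
    * Real.exp (-(Real.pi * κ * m) * T))
  have := (hS.of_nonneg_of_le (fun k => by positivity) hterm).tsum_le_tsum hterm hS
  rw [tsum_mul_left] at this
  calc _ ≤ 1 / |t * D| * (T * (Real.exp L * Real.exp (Real.pi * κ * m))
        * Real.exp (-(Real.pi * κ * m) * T) * W) :=
        mul_le_mul_of_nonneg_left this (by positivity)
    _ = _ := by
        rw [abs_mul, abs_of_pos ht, ← one_div_mul_one_div, ← hT]
        ring

/-- The theta series decays faster than any power at zero. -/
theorem exists_abs_tsum_geodesicTerm_le (hD : a₁ * b₂ - a₂ * b₁ ≠ 0) (x₀ y₀ ℓ : ℝ) (N : ℕ) :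
    ∃ C : ℝ, ∀ t : ℝ, 0 < t → t ≤ 1 → |∑' v : ℤ × ℤ,
      geodesicTerm ℓ t (a₁ * v.1 + a₂ * v.2 + x₀) (b₁ * v.1 + b₂ * v.2 + y₀)| ≤ C * t ^ N := by
  obtain ⟨C, c, hc, hC, h⟩ := exists_abs_tsum_geodesicDensity_le hD x₀ y₀ |ℓ|
  refine ⟨C * ((N + 2).factorial / c ^ (N + 2)) * |ℓ|, fun t ht ht1 => ?_⟩
  rw [(hasSum_geodesicTerm hD x₀ y₀ ℓ ht).tsum_eq]
  have hu : ∀ u ∈ Set.uIoc 0 ℓ, |u| ≤ |ℓ| := fun u hu => by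
    have := Set.uIoc_subset_uIcc hu
    simpa using Set.abs_sub_left_of_mem_uIcc this
  have hb := intervalIntegral.norm_integral_le_of_norm_le_const
    (fun u hu' => (Real.norm_eq_abs _).trans_le (h t u ht ht1 (hu u hu')))
  rw [sub_zero] at hb
  refine hb.trans ?_
  rw [mul_right_comm (_ * _) |ℓ|]
  refine mul_le_mul_of_nonneg_right ?_ (abs_nonneg ℓ)
  rw [mul_assoc, mul_assoc]
  refine mul_le_mul_of_nonneg_left ?_ hC
  -- The exponent N + 2 leaves t^N after the factor (1/t)² is absorbed.
  have hp := Real.pow_div_factorial_le_exp (c * (1 / t)) (by positivity) (N + 2)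
  rw [neg_mul, Real.exp_neg, ← div_eq_mul_inv, div_le_iff₀ (Real.exp_pos _)]
  calc (1 / t) ^ 2 = (N + 2).factorial / c ^ (N + 2) * t ^ N *
        ((c * (1 / t)) ^ (N + 2) / (N + 2).factorial) := by
        have : ((N + 2).factorial : ℝ) ≠ 0 := by positivity
        have h1 : t ^ N * (1 / t) ^ (N + 2) = (1 / t) ^ 2 := by
          rw [pow_add, ← mul_assoc, ← mul_pow, mul_one_div_cancel ht.ne', one_pow, one_mul]
        rw [← h1, mul_pow]
        generalize (1 / t) ^ (N + 2) = w
        field_simp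
    _ ≤ _ := mul_le_mul_of_nonneg_left hp (by positivity)

end lattice

/-! ### Telescoping over orbits and unfolding -/

open Filter Topology in
theorem tendsto_gaussInt_atTop : Tendsto gaussInt atTop (𝓝 (1 / 2)) := by
  have h := MeasureTheory.intervalIntegral_tendsto_integral_Ioi (f := fun u : ℝ =>
    Real.exp (-Real.pi * u ^ 2)) 0 (integrable_exp_neg_mul_sq Real.pi_pos).integrableOn tendsto_id
  rw [integral_gaussian_Ioi, div_self Real.pi_ne_zero, Real.sqrt_one] at h
  exact h

theorem gaussInt_neg (x : ℝ) : gaussInt (-x) = -gaussInt x := by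
  unfold gaussInt
  have h := intervalIntegral.integral_comp_neg (a := 0) (b := x)
    (fun u : ℝ => Real.exp (-Real.pi * u ^ 2))
  simp only [neg_sq, neg_zero] at h
  rw [h, intervalIntegral.integral_symm]

open Filter Topology in
theorem tendsto_gaussInt_atBot : Tendsto gaussInt atBot (𝓝 (-(1 / 2))) := by
  have h := (tendsto_gaussInt_atTop.comp tendsto_neg_atBot_atTop).neg
  refine h.congr fun x => ?_
  simp [gaussInt_neg]

open Filter Topology in
/-- A summable telescoping series over `ℤ`. -/
theorem HasSum.int_telescope {F : ℤ → ℝ} {a b : ℝ} (hs : Summable fun k => F (k + 1) - F k)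
    (ha : Tendsto (fun n : ℕ => F n) atTop (𝓝 a))
    (hb : Tendsto (fun n : ℕ => F (-n)) atTop (𝓝 b)) :
    HasSum (fun k => F (k + 1) - F k) (a - b) := by
  have h1 : HasSum (fun n : ℕ => F ((n : ℤ) + 1) - F n) (a - F 0) := by
    have hs1 : Summable fun n : ℕ => F ((n : ℤ) + 1) - F n :=
      hs.comp_injective Nat.cast_injective
    rw [hs1.hasSum_iff_tendsto_nat]
    refine (ha.sub_const (F 0)).congr fun n => ?_
    have := Finset.sum_range_sub (fun n : ℕ => F n) n
    push_cast at this
    rw [this]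
  have h2 : HasSum (fun n : ℕ => F (-((n : ℤ) + 1) + 1) - F (-((n : ℤ) + 1))) (F 0 - b) := by
    have hs2 : Summable fun n : ℕ => F (-((n : ℤ) + 1) + 1) - F (-((n : ℤ) + 1)) :=
      hs.comp_injective (i := fun n : ℕ => -((n : ℤ) + 1)) fun m n h => by simpa using h
    rw [hs2.hasSum_iff_tendsto_nat]
    refine (hb.const_sub (F 0)).congr fun n => ?_
    have := Finset.sum_range_sub' (fun n : ℕ => F (-n)) n
    push_cast at this
    rw [neg_zero] at this
    rw [← this]
    exact Finset.sum_congr rfl fun k _ => by rw [show -((k : ℤ) + 1) + 1 = -k by ring]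
  have := HasSum.of_nat_of_neg_add_one (f := fun k => F (k + 1) - F k) h1 h2
  rwa [sub_add_sub_cancel] at this

/-- The signed contribution of an orbit: `±1` for totally positive or totally negative points. -/
noncomputable def orbitSign (x y : ℝ) : ℝ :=
  if 0 < x ∧ 0 < y then 1 else if x < 0 ∧ y < 0 then -1 else 0

-- The product xy is constant along the orbit, so the k-th term is F(k + 1) - F(k), where F is
-- evaluated at the parameter kℓ. The Gaussian primitive tends to ±1/2, and the two limits of F
-- differ by (sgn x + sgn y)/2 times the exponential.
open Filter Topology in
theorem hasSum_geodesicTerm_orbit {ℓ t x y : ℝ} (hℓ : 0 < ℓ) (ht : 0 < t) (hx : x ≠ 0) (hy : y ≠ 0)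
    (hs : Summable fun k : ℤ => geodesicTerm ℓ t (Real.exp (k * ℓ) * x) (Real.exp (-(k * ℓ)) * y)) :
    HasSum (fun k : ℤ => geodesicTerm ℓ t (Real.exp (k * ℓ) * x) (Real.exp (-(k * ℓ)) * y))
      (orbitSign x y * Real.exp (-2 * Real.pi * t * (x * y))) := by
  have hst : 0 < √t := Real.sqrt_pos.2 ht
  let W : ℝ → ℝ := fun u => √t * (Real.exp u * x - Real.exp (-u) * y)
  let F : ℤ → ℝ := fun k => gaussInt (W (k * ℓ)) * Real.exp (-2 * Real.pi * t * (x * y))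
  have hF : (fun k : ℤ => geodesicTerm ℓ t (Real.exp (k * ℓ) * x) (Real.exp (-(k * ℓ)) * y)) =
      fun k => F (k + 1) - F k := by
    funext k
    simp only [geodesicTerm, F, W]
    rw [← sub_mul]
    have h1 : Real.exp ((k + 1 : ℤ) * ℓ) = Real.exp ℓ * Real.exp (k * ℓ) := by
      rw [← Real.exp_add]; push_cast; ring_nf
    have h2 : Real.exp (-((k + 1 : ℤ) * ℓ)) = Real.exp (-ℓ) * Real.exp (-(k * ℓ)) := by
      rw [← Real.exp_add]; push_cast; ring_nf
    have h3 : Real.exp (k * ℓ) * x * (Real.exp (-(k * ℓ)) * y) = x * y := by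
      have : Real.exp (k * ℓ) * Real.exp (-(k * ℓ)) = 1 := by rw [← Real.exp_add]; simp
      linear_combination x * y * this
    rw [h1, h2, h3]
    ring_nf
  have hnat : Tendsto (fun n : ℕ => (n : ℝ) * ℓ) atTop atTop :=
    tendsto_natCast_atTop_atTop.atTop_mul_const hℓ
  have hexp0 : Tendsto (fun u : ℝ => Real.exp (-u)) atTop (𝓝 0) := Real.tendsto_exp_neg_atTop_nhds_zero
  -- limits of the arguments
  have limW : ∀ x y : ℝ, 0 < x →
      Tendsto (fun u : ℝ => √t * (Real.exp u * x - Real.exp (-u) * y)) atTop atTop := by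
    intro x y hx
    refine Tendsto.const_mul_atTop hst ?_
    have h1 : Tendsto (fun u : ℝ => Real.exp u * x) atTop atTop :=
      Real.tendsto_exp_atTop.atTop_mul_const hx
    have h2 : Tendsto (fun u : ℝ => -(Real.exp (-u) * y)) atTop (𝓝 (-(0 * y))) :=
      (hexp0.mul_const y).neg
    exact (h1.atTop_add h2).congr fun u => by ring
  have limW' : ∀ x y : ℝ, x < 0 →
      Tendsto (fun u : ℝ => √t * (Real.exp u * x - Real.exp (-u) * y)) atTop atBot := by
    intro x y hx
    have := tendsto_neg_atTop_atBot.comp (limW (-x) (-y) (by linarith))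
    exact this.congr fun u => by simp only [Function.comp]; ring
  have limG : ∀ x y : ℝ, x ≠ 0 →
      Tendsto (fun u : ℝ => gaussInt (√t * (Real.exp u * x - Real.exp (-u) * y))) atTop
        (𝓝 (if 0 < x then 1 / 2 else -(1 / 2))) := by
    intro x y hx
    split_ifs with h
    · exact tendsto_gaussInt_atTop.comp (limW x y h)
    · exact tendsto_gaussInt_atBot.comp (limW' x y (lt_of_le_of_ne (not_lt.1 h) hx))
  have ha : Tendsto (fun n : ℕ => F n) atTop
      (𝓝 ((if 0 < x then 1 / 2 else -(1 / 2)) * Real.exp (-2 * Real.pi * t * (x * y)))) :=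
    (((limG x y hx).comp hnat).mul_const _).congr fun n => by simp [F, W]
  have hb : Tendsto (fun n : ℕ => F (-n)) atTop
      (𝓝 (-(if 0 < y then 1 / 2 else -(1 / 2)) * Real.exp (-2 * Real.pi * t * (x * y)))) := by
    -- Replacing u by -u amounts to exchanging x with y and changing the sign, so the limit at -∞
    -- follows from the one at +∞.
    refine (((limG y x hy).comp hnat).neg.mul_const _).congr fun n => ?_
    simp only [F, W, Function.comp]
    rw [← gaussInt_neg]
    push_cast
    ring_nf
  rw [hF] at hs ⊢
  convert! HasSum.int_telescope hs ha hb using 1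
  rw [← sub_mul, orbitSign]
  congr 1
  rcases hx.lt_or_gt with h1 | h1 <;> rcases hy.lt_or_gt with h2 | h2 <;>
    simp [h1, h2, h1.not_gt, h2.not_gt] <;> norm_num

/-- A fundamental domain for the action of a permutation that shifts a real-valued function by
one. -/
noncomputable def fundamentalDomainEquiv {Y : Type*} (σ : Y ≃ Y) (h : Y → ℝ)
    (hσ : ∀ y, h (σ y) = h y + 1) :
    {y : Y // 0 ≤ h y ∧ h y < 1} × ℤ ≃ Y :=
  have hk : ∀ (k : ℤ) (y : Y), h ((σ ^ k : Equiv.Perm Y) y) = h y + k := by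
    intro k
    induction k with
    | zero => simp
    | succ n ih => intro y; rw [zpow_add_one, Equiv.Perm.mul_apply, ih, hσ]; push_cast; ring
    | pred n ih =>
      intro y
      rw [zpow_sub_one, Equiv.Perm.mul_apply, ih]
      have := hσ (σ⁻¹ y)
      rw [show σ (σ⁻¹ y) = y from σ.apply_symm_apply y] at this
      rw [this]
      push_cast
      ring
  { toFun := fun p => (σ ^ p.2 : Equiv.Perm Y) p.1.1
    invFun := fun y => (⟨(σ ^ (-⌊h y⌋) : Equiv.Perm Y) y, by
      rw [hk]
      push_cast
      constructor
      · linarith [Int.floor_le (h y)]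
      · linarith [Int.lt_floor_add_one (h y)]⟩, ⌊h y⌋)
    left_inv := by
      rintro ⟨⟨y, h0, h1⟩, k⟩
      have hf : ⌊h ((σ ^ k : Equiv.Perm Y) y)⌋ = k := by
        rw [hk, Int.floor_add_intCast, Int.floor_eq_zero_iff.2 ⟨h0, h1⟩, zero_add]
      refine Prod.ext (Subtype.ext ?_) hf
      simp only
      rw [hf, ← Equiv.Perm.mul_apply, ← zpow_add, neg_add_cancel, zpow_zero, Equiv.Perm.one_apply]
    right_inv := by
      intro y
      simp only
      rw [← Equiv.Perm.mul_apply, ← zpow_add, add_neg_cancel, zpow_zero, Equiv.Perm.one_apply] }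

theorem fundamentalDomainEquiv_apply {Y : Type*} (σ : Y ≃ Y) (h : Y → ℝ)
    (hσ : ∀ y, h (σ y) = h y + 1) (p : {y : Y // 0 ≤ h y ∧ h y < 1} × ℤ) :
    fundamentalDomainEquiv σ h hσ p = (σ ^ p.2 : Equiv.Perm Y) p.1.1 := rfl

/-- Unfolding the indefinite theta series along the orbits of a hyperbolic automorphism. -/
theorem hasSum_unfold {Y : Type*} (σ : Y ≃ Y) (x y : Y → ℝ) {ℓ t Θ : ℝ} (hℓ : 0 < ℓ) (ht : 0 < t)
    (hx : ∀ v, x v ≠ 0) (hy : ∀ v, y v ≠ 0) (hxσ : ∀ v, x (σ v) = Real.exp ℓ * x v)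
    (hyσ : ∀ v, y (σ v) = Real.exp (-ℓ) * y v)
    (hΘ : HasSum (fun v => geodesicTerm ℓ t (x v) (y v)) Θ) :
    HasSum (fun v : {v : Y // 0 ≤ Real.log |x v / y v| / (2 * ℓ) ∧
        Real.log |x v / y v| / (2 * ℓ) < 1} =>
      orbitSign (x v) (y v) * Real.exp (-2 * Real.pi * t * (x v * y v))) Θ := by
  -- One step of σ multiplies x/y by e^{2ℓ}; dividing the logarithm by 2ℓ gives a height that rises
  -- by exactly one, as the fundamental domain requires.
  have hσ : ∀ v, Real.log |x (σ v) / y (σ v)| / (2 * ℓ) = Real.log |x v / y v| / (2 * ℓ) + 1 := by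
    intro v
    have h1 : x (σ v) / y (σ v) = Real.exp (2 * ℓ) * (x v / y v) := by
      rw [hxσ, hyσ, Real.exp_neg, two_mul, Real.exp_add]
      have := hy v
      field_simp
    rw [h1, abs_mul, Real.abs_exp, Real.log_mul (Real.exp_pos _).ne'
      (abs_ne_zero.2 (div_ne_zero (hx v) (hy v))), Real.log_exp]
    field_simp
    ring
  have hxk : ∀ (k : ℤ) v, x ((σ ^ k : Equiv.Perm Y) v) = Real.exp (k * ℓ) * x v := by
    intro k
    induction k with
    | zero => simp
    | succ n ih =>
      intro v
      rw [zpow_add_one, Equiv.Perm.mul_apply, ih, hxσ, ← mul_assoc, ← Real.exp_add]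
      push_cast
      ring_nf
    | pred n ih =>
      intro v
      rw [zpow_sub_one, Equiv.Perm.mul_apply, ih]
      have := hxσ (σ⁻¹ v)
      rw [show σ (σ⁻¹ v) = v from σ.apply_symm_apply v] at this
      rw [this, ← mul_assoc, ← Real.exp_add]
      push_cast
      ring_nf
  have hyk : ∀ (k : ℤ) v, y ((σ ^ k : Equiv.Perm Y) v) = Real.exp (-(k * ℓ)) * y v := by
    intro k
    induction k with
    | zero => simp
    | succ n ih =>
      intro v
      rw [zpow_add_one, Equiv.Perm.mul_apply, ih, hyσ, ← mul_assoc, ← Real.exp_add]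
      push_cast
      ring_nf
    | pred n ih =>
      intro v
      rw [zpow_sub_one, Equiv.Perm.mul_apply, ih]
      have := hyσ (σ⁻¹ v)
      rw [show σ (σ⁻¹ v) = v from σ.apply_symm_apply v] at this
      rw [this, ← mul_assoc, ← Real.exp_add]
      push_cast
      ring_nf
  rw [← (fundamentalDomainEquiv σ (fun v => Real.log |x v / y v| / (2 * ℓ)) hσ).hasSum_iff] at hΘ
  refine hΘ.prod_fiberwise fun v => ?_
  have hs := hΘ.summable.prod_factor v
  simp only [Function.comp_def, fundamentalDomainEquiv_apply, hxk, hyk] at hs ⊢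
  exact hasSum_geodesicTerm_orbit hℓ ht (hx _) (hy _) hs

/-! ### Embeddings, ray units and lattices of a real quadratic field -/

/-- The two real embeddings of a real quadratic field. -/
structure RealQuadratic (K : Type*) [Field K] [NumberField K] where
  σ : K →+* ℝ
  τ : K →+* ℝ
  ne : σ ≠ τ
  cover : ∀ ρ : K →+* ℝ, ρ = σ ∨ ρ = τ
  norm_eq : ∀ x : K, ((Algebra.norm ℚ x : ℚ) : ℝ) = σ x * τ x

/-- All complex embeddings are real, and in degree two there are exactly two of them, so the norm is
a product of two real conjugates. -/
theorem exists_realQuadratic (K : Type*) [Field K] [NumberField K] [NumberField.IsTotallyReal K]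
    (hK : Module.finrank ℚ K = 2) : Nonempty (RealQuadratic K) := by
  classical
  have hreal : ∀ φ : K →+* ℂ, NumberField.ComplexEmbedding.IsReal φ :=
    NumberField.IsTotallyReal.complexEmbedding_isReal
  let f : (K →+* ℂ) → (K →+* ℝ) := fun φ => (hreal φ).embedding
  have hf : ∀ φ x, ((f φ x : ℝ) : ℂ) = φ x := fun φ x => (hreal φ).coe_embedding_apply x
  have hcard : (Finset.univ : Finset (K →+* ℂ)).card = 2 := by
    rw [Finset.card_univ, NumberField.Embeddings.card, hK]
  obtain ⟨φ, ψ, hne, huniv⟩ := Finset.card_eq_two.1 hcard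
  refine ⟨⟨f φ, f ψ, ?_, ?_, ?_⟩⟩
  · intro h
    apply hne
    ext x
    rw [← hf, ← hf, h]
  · intro ρ
    have h := Finset.mem_univ ((Complex.ofRealHom : ℝ →+* ℂ).comp ρ)
    rw [huniv, Finset.mem_insert, Finset.mem_singleton] at h
    refine h.imp (fun h => ?_) (fun h => ?_) <;>
    · ext x
      apply Complex.ofReal_injective
      rw [hf, ← h]
      rfl
  · intro x
    have h := Algebra.norm_eq_prod_embeddings ℚ ℂ x
    rw [← Fintype.prod_equiv (RingHom.equivRatAlgHom K ℂ) (fun g : K →+* ℂ => g x) (fun g => g x)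
      (fun _ => rfl), huniv, Finset.prod_pair hne, ← hf, ← hf] at h
    apply Complex.ofReal_injective
    rw [Complex.ofReal_mul, ← h]
    simp

namespace RealQuadratic

variable {K : Type*} [Field K] [NumberField K] (E : RealQuadratic K)

theorem norm_int_eq (α : 𝓞 K) : ((Algebra.norm ℤ α : ℤ) : ℝ) = E.σ α * E.τ α := by
  rw [← E.norm_eq, ← Algebra.coe_norm_int]
  simp

theorem absNorm_span (α : 𝓞 K) (h : 0 < E.σ α * E.τ α) :
    (Ideal.absNorm (Ideal.span {α}) : ℝ) = E.σ α * E.τ α := by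
  rw [Ideal.absNorm_span_singleton, ← E.norm_int_eq, Nat.cast_natAbs, Int.cast_abs, abs_of_pos]
  rwa [E.norm_int_eq]

theorem pos_iff (S : K) : (∀ ρ ∈ (Set.univ : Set (K →+* ℝ)), 0 < ρ S) ↔ 0 < E.σ S ∧ 0 < E.τ S := by
  refine ⟨fun h => ⟨h _ trivial, h _ trivial⟩, fun h ρ _ => ?_⟩
  rcases E.cover ρ with rfl | rfl
  exacts [h.1, h.2]

/-- The totally positive units congruent to one modulo `𝔠`. -/
def rayUnitGroup (𝔠 : Ideal (𝓞 K)) : Subgroup (𝓞 K)ˣ where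
  carrier := {u | (u : 𝓞 K) - 1 ∈ 𝔠 ∧ 0 < E.σ (u : 𝓞 K) ∧ 0 < E.τ (u : 𝓞 K)}
  one_mem' := by simp
  mul_mem' := by
    rintro u v ⟨h1, h2, h3⟩ ⟨h1', h2', h3'⟩
    refine ⟨?_, ?_, ?_⟩
    · have : ((u * v : (𝓞 K)ˣ) : 𝓞 K) - 1 = v * ((u : 𝓞 K) - 1) + ((v : 𝓞 K) - 1) := by
        push_cast; ring
      rw [this]
      exact Ideal.add_mem _ (Ideal.mul_mem_left _ _ h1) h1'
    · push_cast
      rw [map_mul]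
      exact mul_pos h2 h2'
    · push_cast
      rw [map_mul]
      exact mul_pos h3 h3'
  inv_mem' := by
    rintro u ⟨h1, h2, h3⟩
    have hu : ((u⁻¹ : (𝓞 K)ˣ) : 𝓞 K) * u = 1 := u.inv_mul
    have huK : ((u⁻¹ : (𝓞 K)ˣ) : K) * (u : K) = 1 := by exact_mod_cast congrArg (algebraMap (𝓞 K) K) hu
    refine ⟨?_, ?_, ?_⟩
    · have : ((u⁻¹ : (𝓞 K)ˣ) : 𝓞 K) - 1 = -(((u⁻¹ : (𝓞 K)ˣ) : 𝓞 K) * ((u : 𝓞 K) - 1)) := by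
        linear_combination hu
      rw [this]
      exact neg_mem (Ideal.mul_mem_left _ _ h1)
    · have h := congrArg E.σ huK
      rw [map_mul, map_one] at h
      exact pos_of_mul_pos_left (h ▸ one_pos) h2.le
    · have h := congrArg E.τ huK
      rw [map_mul, map_one] at h
      exact pos_of_mul_pos_left (h ▸ one_pos) h3.le

theorem σ_mul_τ_of_mem {𝔠 : Ideal (𝓞 K)} {u : (𝓞 K)ˣ} (hu : u ∈ E.rayUnitGroup 𝔠) :
    E.σ (u : 𝓞 K) * E.τ (u : 𝓞 K) = 1 := by
  have h1 := E.absNorm_span (u : 𝓞 K) (mul_pos hu.2.1 hu.2.2)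
  rw [← h1, Ideal.span_singleton_eq_top.2 u.isUnit]
  simp

/-- The logarithm of the first embedding on the ray units. -/
noncomputable def logHom (𝔠 : Ideal (𝓞 K)) : Additive (E.rayUnitGroup 𝔠) →+ ℝ where
  toFun u := Real.log (E.σ ((u.toMul : (𝓞 K)ˣ) : 𝓞 K))
  map_zero' := by simp
  map_add' u v := by
    simp only [toMul_add, Subgroup.coe_mul, Units.val_mul]
    push_cast
    rw [map_mul, Real.log_mul u.toMul.2.2.1.ne' v.toMul.2.2.1.ne']

/-- Ray units do not accumulate at one. -/
theorem not_mem_Ioo_of_mem {𝔠 : Ideal (𝓞 K)} {u : (𝓞 K)ˣ} (hu : u ∈ E.rayUnitGroup 𝔠) :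
    E.σ (u : 𝓞 K) ∉ Set.Ioo (1 : ℝ) 2 := by
  rintro ⟨h1, h2⟩
  -- The other conjugate is the inverse, hence in (1/2, 1), and the integer norm of u - 1 would lie
  -- strictly between -1 and 0.
  have hN := E.norm_int_eq ((u : 𝓞 K) - 1)
  have hm := E.σ_mul_τ_of_mem hu
  push_cast at hN
  rw [map_sub E.σ, map_sub E.τ, map_one, map_one] at hN
  set s := E.σ (u : 𝓞 K)
  set t := E.τ (u : 𝓞 K)
  have ht : t < 1 := by nlinarith
  have ht2 : 1 / 2 < t := by nlinarith
  have h3 : (s - 1) * (t - 1) < 0 := by nlinarith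
  have h4 : -1 < (s - 1) * (t - 1) := by nlinarith
  rw [← hN] at h3 h4
  have h5 : Algebra.norm ℤ ((u : 𝓞 K) - 1) < 0 := by exact_mod_cast h3
  have h6 : -1 < Algebra.norm ℤ ((u : 𝓞 K) - 1) := by exact_mod_cast h4
  omega

/-- Dirichlet's unit theorem supplies a unit that is small at the first place. Raising it to twice
the order of the unit group of 𝓞/𝔠 makes it ≡ 1 (mod 𝔠) and, the exponent being even, totally
positive. -/
theorem exists_rayUnit_ne_one (𝔠 : Ideal (𝓞 K)) (h𝔠 : 𝔠 ≠ ⊥) :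
    ∃ u ∈ E.rayUnitGroup 𝔠, E.σ (u : 𝓞 K) < 1 := by
  classical
  let wσ := NumberField.InfinitePlace.mk ((Complex.ofRealHom : ℝ →+* ℂ).comp E.σ)
  let wτ := NumberField.InfinitePlace.mk ((Complex.ofRealHom : ℝ →+* ℂ).comp E.τ)
  have hw : wσ ≠ wτ := by
    intro h
    have key : ∀ x, E.σ x = E.τ x := by
      intro x
      rcases NumberField.InfinitePlace.mk_eq_iff.1 h with h | h
      · exact Complex.ofReal_injective (RingHom.congr_fun h x)
      · have := RingHom.congr_fun h x
        simp at this
        exact this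
    exact E.ne (RingHom.ext key)
  obtain ⟨u, hu⟩ := NumberField.Units.dirichletUnitTheorem.exists_unit K wτ
  have h1 : |E.σ (u : 𝓞 K)| < 1 := by
    have h := hu wσ hw
    have hval : wσ (u : K) = |E.σ (u : 𝓞 K)| := by
      simp [wσ, NumberField.InfinitePlace.apply]
    rw [hval] at h
    by_contra! hc
    exact absurd h (not_lt.2 (Real.log_nonneg hc))
  have hfin : Finite (𝓞 K ⧸ 𝔠) := Ideal.finiteQuotientOfFreeOfNeBot 𝔠 h𝔠
  have hfu : Finite (𝓞 K ⧸ 𝔠)ˣ := inferInstance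
  set m := Nat.card (𝓞 K ⧸ 𝔠)ˣ with hm
  have hm0 : 0 < m := Nat.card_pos
  have hne : ∀ ρ : K →+* ℝ, ρ (u : 𝓞 K) ≠ 0 := fun ρ => by
    rw [map_ne_zero]
    exact_mod_cast u.ne_zero
  have hev : Even (2 * m) := even_two_mul m
  refine ⟨u ^ (2 * m), ⟨?_, ?_, ?_⟩, ?_⟩
  · rw [← Ideal.Quotient.eq_zero_iff_mem, map_sub, sub_eq_zero, map_one]
    have h := pow_card_eq_one' (x := Units.map (Ideal.Quotient.mk 𝔠 : 𝓞 K →* 𝓞 K ⧸ 𝔠) u)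
    have h2 := congrArg Units.val h
    simp only [Units.val_pow_eq_pow_val, Units.coe_map, Units.val_one] at h2
    push_cast
    rw [map_pow, mul_comm, pow_mul]
    erw [h2]
    exact one_pow _
  · push_cast
    rw [map_pow]
    exact hev.pow_pos (hne _)
  · push_cast
    rw [map_pow]
    exact hev.pow_pos (hne _)
  · push_cast
    rw [map_pow, ← hev.pow_abs]
    exact pow_lt_one₀ (abs_nonneg _) h1 (by omega)

/-- A generator of the group of ray units. -/
theorem exists_generator (𝔠 : Ideal (𝓞 K)) (h𝔠 : 𝔠 ≠ ⊥) :
    ∃ ε ∈ E.rayUnitGroup 𝔠, 1 < E.σ (ε : 𝓞 K) ∧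
      ∀ u ∈ E.rayUnitGroup 𝔠, ∃ k : ℤ, u = ε ^ k := by
  set f := E.logHom 𝔠 with hf
  have hinj : Function.Injective f := by
    rw [injective_iff_map_eq_zero]
    intro u hu
    have hpos := u.toMul.2.2.1
    have hσ : E.σ ((u.toMul : (𝓞 K)ˣ) : 𝓞 K) = 1 := Real.eq_one_of_pos_of_log_eq_zero hpos hu
    have h1 : ((u.toMul : (𝓞 K)ˣ) : K) = 1 := E.σ.injective (by rw [map_one]; exact hσ)
    have h2 : (u.toMul : (𝓞 K)ˣ) = 1 := by
      apply Units.ext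
      apply FaithfulSMul.algebraMap_injective (𝓞 K) K
      rw [h1]
      simp
    exact Additive.toMul.injective (Subtype.ext h2)
  -- A subgroup of ℝ is dense or cyclic; density is impossible because no logarithm of a ray unit
  -- falls in (0, log 2).
  rcases f.range.dense_or_cyclic with hd | ⟨a, ha⟩
  · exfalso
    obtain ⟨x, hx, hxm⟩ := hd.exists_mem_open (isOpen_Ioo (a := (0 : ℝ)) (b := Real.log 2))
      ⟨Real.log 2 / 2, by constructor <;> linarith [Real.log_pos one_lt_two]⟩
    obtain ⟨u, rfl⟩ := hx
    have hpos := u.toMul.2.2.1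
    refine E.not_mem_Ioo_of_mem u.toMul.2 ⟨?_, ?_⟩
    · exact (Real.log_pos_iff hpos.le).1 hxm.1
    · exact (Real.log_lt_log_iff hpos two_pos).1 hxm.2
  · obtain ⟨v, hv⟩ : a ∈ f.range := ha ▸ AddSubgroup.subset_closure rfl
    have hgen : ∀ u, ∃ k : ℤ, u = k • v := by
      intro u
      have : f u ∈ AddSubgroup.closure {a} := ha ▸ ⟨u, rfl⟩
      obtain ⟨k, hk⟩ := AddSubgroup.mem_closure_singleton.1 this
      exact ⟨k, hinj (by rw [map_zsmul, hv, hk])⟩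
    obtain ⟨w, hw, hw1⟩ := E.exists_rayUnit_ne_one 𝔠 h𝔠
    have hlw : f (Additive.ofMul ⟨w, hw⟩) < 0 := Real.log_neg hw.2.1 hw1
    have hv0 : f v ≠ 0 := by
      intro h
      obtain ⟨k, hk⟩ := hgen (Additive.ofMul ⟨w, hw⟩)
      rw [hk, map_zsmul, h, smul_zero] at hlw
      exact lt_irrefl _ hlw
    obtain ⟨v', hv', hgen'⟩ : ∃ v', 0 < f v' ∧ ∀ u, ∃ k : ℤ, u = k • v' := by
      rcases hv0.lt_or_gt with h | h
      · refine ⟨-v, by rw [map_neg]; linarith, fun u => ?_⟩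
        obtain ⟨k, hk⟩ := hgen u
        exact ⟨-k, by rw [hk, neg_zsmul, zsmul_neg, neg_neg]⟩
      · exact ⟨v, h, hgen⟩
    refine ⟨v'.toMul, v'.toMul.2, (Real.log_pos_iff v'.toMul.2.2.1.le).1 hv', fun u hu => ?_⟩
    obtain ⟨k, hk⟩ := hgen' (Additive.ofMul ⟨u, hu⟩)
    refine ⟨k, ?_⟩
    have := congrArg (fun x => ((Additive.toMul x : E.rayUnitGroup 𝔠) : (𝓞 K)ˣ)) hk
    simpa using this

/-- A lattice basis of a nonzero ideal. -/
theorem exists_basis (hK : Module.finrank ℚ K = 2) (I : Ideal (𝓞 K)) (hI : I ≠ ⊥) :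
    ∃ e₁ e₂ : 𝓞 K, (∀ x, x ∈ I ↔ ∃ m n : ℤ, x = m * e₁ + n * e₂) ∧
      E.σ e₁ * E.τ e₂ - E.σ e₂ * E.τ e₁ ≠ 0 := by
  have hr : Module.finrank ℤ (𝓞 K) = 2 := by rw [NumberField.RingOfIntegers.rank, hK]
  let b₀ := Module.finBasisOfFinrankEq ℤ (𝓞 K) hr
  let b := Ideal.selfBasis b₀ I hI
  have hmem : ∀ x, x ∈ I ↔ ∃ m n : ℤ, x = m * (b 0 : 𝓞 K) + n * (b 1 : 𝓞 K) := by
    intro x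
    constructor
    · intro hx
      have h := b.sum_repr ⟨x, hx⟩
      rw [Fin.sum_univ_two] at h
      refine ⟨b.repr ⟨x, hx⟩ 0, b.repr ⟨x, hx⟩ 1, ?_⟩
      have h' := congrArg (Subtype.val) h
      simpa using h'.symm
    · rintro ⟨m, n, rfl⟩
      exact Ideal.add_mem _ (Ideal.mul_mem_left _ _ (b 0).2) (Ideal.mul_mem_left _ _ (b 1).2)
  refine ⟨b 0, b 1, hmem, fun h => ?_⟩
  have hb0 : ((b 0 : 𝓞 K) : K) ≠ 0 := by
    have : (b 0 : I) ≠ 0 := b.ne_zero 0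
    simpa using this
  have hN0 : 0 < Ideal.absNorm I :=
    Nat.pos_of_ne_zero fun h => hI (Ideal.absNorm_eq_zero_iff.1 h)
  -- the ratio of the two embeddings is constant on the field
  have key : ∀ x : 𝓞 K, E.σ (b 0 : 𝓞 K) * E.τ x = E.σ x * E.τ (b 0 : 𝓞 K) := by
    intro x
    obtain ⟨m, n, hmn⟩ := (hmem (x * Ideal.absNorm I)).1
      (Ideal.mul_mem_left _ _ (Ideal.absNorm_mem I))
    have h1 := congrArg (fun y : 𝓞 K => E.σ y) hmn
    have h2 := congrArg (fun y : 𝓞 K => E.τ y) hmn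
    push_cast at h1 h2
    simp only [map_add, map_mul, map_natCast, map_intCast] at h1 h2
    have hN : (Ideal.absNorm I : ℝ) ≠ 0 := by positivity
    apply mul_right_cancel₀ hN
    linear_combination E.σ (b 0 : 𝓞 K) * h2 - E.τ (b 0 : 𝓞 K) * h1 + n * h
  -- At x = 1 the constant ratio is seen to be 1, so a vanishing determinant would force the two
  -- embeddings to coincide.
  have h1 := key 1
  simp only [map_one, mul_one, one_mul] at h1
  have hs0 : E.σ (b 0 : 𝓞 K) ≠ 0 := (map_ne_zero E.σ).2 hb0
  apply E.ne
  ext x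
  obtain ⟨y, z, hz, rfl⟩ := IsFractionRing.div_surjective (A := 𝓞 K) x
  have hk : ∀ y : 𝓞 K, E.σ y = E.τ y := fun y => by
    have := key y
    rw [← h1, mul_comm] at this
    exact (mul_right_cancel₀ hs0 this).symm
  rw [map_div₀, map_div₀]
  exact congrArg₂ _ (hk y) (hk z)

end RealQuadratic

/-! ### Ideals in a ray class and generators in a coset -/

namespace RayClass

/-- An element coprime to 𝔠 is invertible modulo 𝔠 and can be cancelled. -/
theorem mem_of_mul_mem {K : Type*} [Field K] {𝔠 : Ideal (𝓞 K)} {a b e : 𝓞 K}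
    (hb : IsCoprime (Ideal.span {b}) 𝔠) (h : a * b - e * b ∈ 𝔠) :
    a - e ∈ 𝔠 := by
  rw [Ideal.isCoprime_iff_exists] at hb
  obtain ⟨i, hi, j, hj, hij⟩ := hb
  obtain ⟨x, rfl⟩ := Ideal.mem_span_singleton'.1 hi
  have : a - e = x * (a * b - e * b) + (a - e) * j := by linear_combination -(a - e) * hij
  rw [this]
  exact Ideal.add_mem _ (Ideal.mul_mem_left _ _ h) (Ideal.mul_mem_left _ _ hj)

variable {K : Type*} [Field K] [NumberField K] {𝔠 : Ideal (𝓞 K)}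

/-- `C` is the class of the principal ideals with totally positive generator `≡ e (mod 𝔠)`. -/
def IsPrincipalClass (C : ClassGroup 𝔠 (Set.univ : Set (K →+* ℝ))) (e : 𝓞 K) : Prop :=
  ∀ I : coprimeIdeals 𝔠, (I : ClassGroup 𝔠 (Set.univ : Set (K →+* ℝ))) = C ↔
    ∃ a : Kˣ, Cong 𝔠 (a : K) e ∧ (∀ σ ∈ (Set.univ : Set (K →+* ℝ)), 0 < σ a) ∧
      (I : (FractionalIdeal (𝓞 K)⁰ K)ˣ) = toPrincipalIdeal (𝓞 K) K a

theorem isPrincipalClass_one :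
    IsPrincipalClass (1 : ClassGroup 𝔠 (Set.univ : Set (K →+* ℝ))) 1 := by
  intro I
  rw [QuotientGroup.eq_one_iff]
  constructor
  · rintro ⟨a, ha, h⟩
    exact ⟨a, ha.1, ha.2, h.symm⟩
  · rintro ⟨a, h1, h2, h3⟩
    exact ⟨a, ⟨h1, h2⟩, h3.symm⟩

theorem isPrincipalClass_negClass (h𝔠 : 𝔠 ≠ ⊥) :
    IsPrincipalClass (negClass 𝔠 h𝔠 (Set.univ : Set (K →+* ℝ))) (-1) :=
  mk_eq_negClass_iff 𝔠 h𝔠 Set.univ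

theorem InClass.ne_bot {S : Set (K →+* ℝ)} {A : ClassGroup 𝔠 S} {𝔞 : Ideal (𝓞 K)}
    (h : InClass 𝔞 A) : 𝔞 ≠ ⊥ := by
  obtain ⟨I, hI, -⟩ := h
  rintro rfl
  rw [FractionalIdeal.coeIdeal_bot] at hI
  exact I.1.ne_zero hI

theorem InClass.isCoprime {S : Set (K →+* ℝ)} {A : ClassGroup 𝔠 S} {𝔞 : Ideal (𝓞 K)}
    (h : InClass 𝔞 A) : IsCoprime 𝔞 𝔠 := by
  obtain ⟨I, hI, -⟩ := h
  obtain ⟨n, d, -, hn, -, h⟩ := I.2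
  rw [hI, ← FractionalIdeal.coeIdeal_mul] at h
  have h' : 𝔞 * d = n := FractionalIdeal.coeIdeal_injective h
  rw [← h'] at hn
  exact hn.of_mul_left_left

/-- The class of 𝔞𝔟 is C A A⁻¹ = C, which provides a generator in K with the right signs and
residue. It is integral because 𝔞𝔟 is, and the denominator in the congruence can be cancelled modulo
𝔠. -/
theorem InClass.exists_generator {C A : ClassGroup 𝔠 (Set.univ : Set (K →+* ℝ))} {e : 𝓞 K}
    (hC : IsPrincipalClass C e) {𝔞 𝔟 : Ideal (𝓞 K)} (h𝔞 : InClass 𝔞 (C * A))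
    (h𝔟 : InClass 𝔟 A⁻¹) :
    ∃ α : 𝓞 K, α - e ∈ 𝔠 ∧ (∀ σ ∈ (Set.univ : Set (K →+* ℝ)), 0 < σ α) ∧
      Ideal.span {α} = 𝔞 * 𝔟 := by
  obtain ⟨I, hI, hIA⟩ := h𝔞
  obtain ⟨J, hJ, hJA⟩ := h𝔟
  obtain ⟨a, ha, hpos, hIJ⟩ := (hC (I * J)).1 (by
    rw [QuotientGroup.mk_mul, hIA, hJA, mul_inv_cancel_right])
  have h1 : ((𝔞 * 𝔟 : Ideal (𝓞 K)) : FractionalIdeal (𝓞 K)⁰ K) =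
      FractionalIdeal.spanSingleton (𝓞 K)⁰ (a : K) := by
    rw [FractionalIdeal.coeIdeal_mul, ← hI, ← hJ, ← coe_toPrincipalIdeal, ← hIJ]
    rfl
  have h2 : (a : K) ∈ ((𝔞 * 𝔟 : Ideal (𝓞 K)) : FractionalIdeal (𝓞 K)⁰ K) := by
    rw [h1]
    exact FractionalIdeal.mem_spanSingleton_self _ _
  obtain ⟨α, -, hα⟩ := (FractionalIdeal.mem_coeIdeal _).1 h2
  refine ⟨α, ?_, ?_, ?_⟩
  · obtain ⟨x, b, -, hb, hxb, hab⟩ := ha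
    refine mem_of_mul_mem hb ?_
    have : α * b = x := by
      apply FaithfulSMul.algebraMap_injective (𝓞 K) K
      rw [map_mul, hα, hab]
    rwa [this]
  · intro σ hσ
    exact (congrArg σ hα).symm ▸ hpos σ hσ
  · apply FractionalIdeal.coeIdeal_injective (R := 𝓞 K) (K := K)
    simp only
    rw [h1, FractionalIdeal.coeIdeal_span_singleton, hα]

/-- The converse direction: 𝔟 divides (α), and the cofactor has class C (A⁻¹)⁻¹ = C A. -/
theorem InClass.exists_of_generator {C A : ClassGroup 𝔠 (Set.univ : Set (K →+* ℝ))} {e : 𝓞 K}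
    (hC : IsPrincipalClass C e) (he : e * e = 1) {𝔟 : Ideal (𝓞 K)} (h𝔟 : InClass 𝔟 A⁻¹) {α : 𝓞 K}
    (hα : α - e ∈ 𝔠) (hα0 : α ≠ 0) (hpos : ∀ σ ∈ (Set.univ : Set (K →+* ℝ)), 0 < σ α)
    (hα𝔟 : α ∈ 𝔟) : ∃ 𝔞, InClass 𝔞 (C * A) ∧ Ideal.span {α} = 𝔞 * 𝔟 := by
  obtain ⟨J, hJ, hJA⟩ := h𝔟
  obtain ⟨𝔞, h𝔞⟩ : 𝔟 ∣ Ideal.span {α} :=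
    Ideal.dvd_iff_le.2 ((Ideal.span_singleton_le_iff_mem _).2 hα𝔟)
  have hαK : (α : K) ≠ 0 := by exact_mod_cast hα0
  have hcong : Cong 𝔠 ((Units.mk0 (α : K) hαK : Kˣ) : K) e :=
    ⟨α, 1, one_ne_zero, by simp [isCoprime_one_left, ← Ideal.one_eq_top], by simpa using hα, by simp⟩
  let P : coprimeIdeals 𝔠 := ⟨_, toPrincipalIdeal_mem hcong he⟩
  have hP : (P : ClassGroup 𝔠 (Set.univ : Set (K →+* ℝ))) = C := (hC P).2 ⟨_, hcong, hpos, rfl⟩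
  refine ⟨𝔞, ⟨P * J⁻¹, ?_, ?_⟩, by rw [h𝔞, mul_comm]⟩
  · have h1 : ((P : (FractionalIdeal (𝓞 K)⁰ K)ˣ) : FractionalIdeal (𝓞 K)⁰ K) =
        (J : (FractionalIdeal (𝓞 K)⁰ K)ˣ) * (𝔞 : FractionalIdeal (𝓞 K)⁰ K) := by
      rw [hJ, ← FractionalIdeal.coeIdeal_mul, ← h𝔞, FractionalIdeal.coeIdeal_span_singleton]
      exact coe_toPrincipalIdeal _
    rw [Subgroup.coe_mul, Units.val_mul, h1, Subgroup.coe_inv, mul_comm, Units.inv_mul_cancel_left]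
  · rw [QuotientGroup.mk_mul, QuotientGroup.mk_inv, hP, hJA]
    exact congrArg (C * ·) (inv_inv A)

/-- Every ray class contains an integral ideal. -/
theorem exists_inClass (E : RealQuadratic K) (h𝔠 : 𝔠 ≠ ⊥)
    (A : ClassGroup 𝔠 (Set.univ : Set (K →+* ℝ))) :
    ∃ 𝔟 : Ideal (𝓞 K), InClass 𝔟 A := by
  obtain ⟨I, rfl⟩ := QuotientGroup.mk_surjective A
  obtain ⟨n, d, hd0, hn, hd, h⟩ := I.2
  obtain ⟨x, hx, y, hy, hxy⟩ := Ideal.isCoprime_iff_exists.1 hd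
  obtain ⟨N, hN⟩ : ∃ N, N = Ideal.absNorm (d * 𝔠) := ⟨_, rfl⟩
  have hN0 : 0 < N := Nat.pos_of_ne_zero fun h =>
    mul_ne_zero (M₀ := Ideal (𝓞 K)) hd0 h𝔠 (Ideal.absNorm_eq_zero_iff.1 (hN.symm.trans h))
  obtain ⟨k, hk⟩ := exists_nat_gt (|E.σ x| + |E.τ x|)
  have hNmem := Ideal.absNorm_mem (d * 𝔠)
  rw [← hN] at hNmem
  -- Here x lies in d and is ≡ 1 (mod 𝔠). A large multiple of N, which lies in d𝔠, preserves both
  -- and makes the element totally positive; multiplying I by (α) then clears the denominator d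
  -- without changing the class.
  obtain ⟨α, hα⟩ : ∃ α : 𝓞 K, α = x + k * N := ⟨_, rfl⟩
  have hNd : (N : 𝓞 K) ∈ d := (Ideal.mul_le_left : d * 𝔠 ≤ d) hNmem
  have hNc : (N : 𝓞 K) ∈ 𝔠 := (Ideal.mul_le_right : d * 𝔠 ≤ 𝔠) hNmem
  have hαd : α ∈ d := by
    rw [hα]
    exact Ideal.add_mem _ hx (Ideal.mul_mem_left _ _ hNd)
  have hα1 : α - 1 ∈ 𝔠 := by
    have : α - 1 = k * N - y := by rw [hα]; linear_combination hxy
    rw [this]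
    exact Ideal.sub_mem _ (Ideal.mul_mem_left _ _ hNc) hy
  have hkN : (k : ℝ) ≤ k * N := le_mul_of_one_le_right (Nat.cast_nonneg _) (by exact_mod_cast hN0)
  have hpos : ∀ σ ∈ (Set.univ : Set (K →+* ℝ)), 0 < σ α := by
    rw [E.pos_iff, hα]
    push_cast
    simp only [map_add, map_mul, map_natCast]
    have h1 := neg_abs_le (E.σ x)
    have h2 := neg_abs_le (E.τ x)
    have h3 := abs_nonneg (E.σ x)
    have h4 := abs_nonneg (E.τ x)
    constructor <;> linarith
  have hα0 : α ≠ 0 := by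
    intro h0
    have := hpos E.σ trivial
    rw [h0] at this
    simp at this
  have hαK : (α : K) ≠ 0 := by exact_mod_cast hα0
  have hcong : Cong 𝔠 ((Units.mk0 (α : K) hαK : Kˣ) : K) 1 :=
    ⟨α, 1, one_ne_zero, by simp [isCoprime_one_left, ← Ideal.one_eq_top], by simpa using hα1, by simp⟩
  let P : coprimeIdeals 𝔠 := ⟨_, toPrincipalIdeal_mem hcong (one_mul 1)⟩
  have hP : (P : ClassGroup 𝔠 (Set.univ : Set (K →+* ℝ))) = 1 :=
    (isPrincipalClass_one P).2 ⟨_, hcong, hpos, rfl⟩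
  obtain ⟨m, hm⟩ : d ∣ Ideal.span {α} :=
    Ideal.dvd_iff_le.2 ((Ideal.span_singleton_le_iff_mem _).2 hαd)
  refine ⟨n * m, I * P, ?_, by
    rw [QuotientGroup.mk_mul, hP]
    exact mul_one (I : ClassGroup 𝔠 (Set.univ : Set (K →+* ℝ)))⟩
  have hPd : ((P : (FractionalIdeal (𝓞 K)⁰ K)ˣ) : FractionalIdeal (𝓞 K)⁰ K) = d * m := by
    rw [← FractionalIdeal.coeIdeal_mul, ← hm, FractionalIdeal.coeIdeal_span_singleton]
    exact coe_toPrincipalIdeal _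
  rw [Subgroup.coe_mul, Units.val_mul, hPd, ← mul_assoc, h, FractionalIdeal.coeIdeal_mul]

end RayClass

namespace RayClass

theorem embedding_ne_zero {K : Type*} [Field K] (ρ : K →+* ℝ) {α : 𝓞 K} (h : α ≠ 0) : ρ α ≠ 0 := by
  rw [map_ne_zero]
  exact_mod_cast h

variable {K : Type*} [Field K] [NumberField K]

/-- The nonzero elements of `𝔟` that are congruent to one modulo `𝔠`. -/
abbrev CosetPoint (𝔟 𝔠 : Ideal (𝓞 K)) : Type _ :=
  {α : 𝓞 K // α ∈ 𝔟 ∧ α - 1 ∈ 𝔠 ∧ α ≠ 0}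

theorem isCoprime_span_of_sub_one_mem {𝔠 : Ideal (𝓞 K)} {α : 𝓞 K} (h : α - 1 ∈ 𝔠) :
    IsCoprime (Ideal.span {α}) 𝔠 :=
  isCoprime_of_sub_mem (e := 1) (β := 1) (by simp [isCoprime_one_left, ← Ideal.one_eq_top])
    (one_mul 1) (by simpa using h)

theorem unit_mul_mem {E : RealQuadratic K} {𝔟 𝔠 : Ideal (𝓞 K)} {u : (𝓞 K)ˣ}
    (hu : u ∈ E.rayUnitGroup 𝔠) (α : CosetPoint 𝔟 𝔠) :
    (u : 𝓞 K) * α.1 ∈ 𝔟 ∧ (u : 𝓞 K) * α.1 - 1 ∈ 𝔠 ∧ (u : 𝓞 K) * α.1 ≠ 0 := by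
  refine ⟨Ideal.mul_mem_left _ _ α.2.1, ?_, mul_ne_zero u.ne_zero α.2.2.2⟩
  have : (u : 𝓞 K) * α.1 - 1 = u * (α.1 - 1) + (u - 1) := by ring
  rw [this]
  exact Ideal.add_mem _ (Ideal.mul_mem_left _ _ α.2.2.1) hu.1

/-- The ray units act on the coset points. -/
def unitPerm (E : RealQuadratic K) (𝔟 𝔠 : Ideal (𝓞 K)) :
    E.rayUnitGroup 𝔠 →* Equiv.Perm (CosetPoint 𝔟 𝔠) where
  toFun u :=
    { toFun := fun α => ⟨_, unit_mul_mem u.2 α⟩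
      invFun := fun α => ⟨_, unit_mul_mem (u⁻¹).2 α⟩
      left_inv := fun α => Subtype.ext (by simp)
      right_inv := fun α => Subtype.ext (by simp) }
  map_one' := by
    ext α
    simp
  map_mul' u v := by
    ext α
    simp [mul_assoc]

theorem unitPerm_apply (E : RealQuadratic K) (𝔟 𝔠 : Ideal (𝓞 K)) (u : E.rayUnitGroup 𝔠)
    (α : CosetPoint 𝔟 𝔠) : (unitPerm E 𝔟 𝔠 u α).1 = ((u : (𝓞 K)ˣ) : 𝓞 K) * α.1 := rfl

/-- Totally positive generators of the same ideal, congruent modulo `𝔠`, differ by a ray unit. -/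
theorem exists_rayUnit_of_span_eq (E : RealQuadratic K) {𝔟 𝔠 : Ideal (𝓞 K)}
    (α β : CosetPoint 𝔟 𝔠) (h : Ideal.span {α.1} = Ideal.span {β.1})
    (hσ : 0 < E.σ α.1 * E.σ β.1) (hτ : 0 < E.τ α.1 * E.τ β.1) :
    ∃ u : E.rayUnitGroup 𝔠, unitPerm E 𝔟 𝔠 u α = β := by
  obtain ⟨u, hu⟩ := Ideal.span_singleton_eq_span_singleton.1 h
  have hpos : ∀ ρ : K →+* ℝ, 0 < ρ α.1 * ρ β.1 → 0 < ρ (u : 𝓞 K) := by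
    intro ρ h
    rw [← hu] at h
    push_cast at h
    rw [map_mul, ← mul_assoc] at h
    exact pos_of_mul_pos_right h (mul_self_nonneg _)
  refine ⟨⟨u, ?_, hpos _ hσ, hpos _ hτ⟩, Subtype.ext ?_⟩
  · refine mem_of_mul_mem (isCoprime_span_of_sub_one_mem α.2.2.1) ?_
    rw [mul_comm, hu, one_mul]
    have : β.1 - α.1 = (β.1 - 1) - (α.1 - 1) := by ring
    rw [this]
    exact Ideal.sub_mem _ β.2.2.1 α.2.2.1
  · rw [unitPerm_apply, mul_comm]
    exact hu

/-- The signed exponentials attached to the ideals in the classes `A` and `R A`. -/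
noncomputable def idealSign {𝔠 : Ideal (𝓞 K)} {A A' : ClassGroup 𝔠 (Set.univ : Set (K →+* ℝ))} :
    {𝔞 : Ideal (𝓞 K) // InClass 𝔞 A} ⊕ {𝔞 : Ideal (𝓞 K) // InClass 𝔞 A'} → ℝ :=
  Sum.elim (fun _ => 1) (fun _ => -1)

/-- The norm of an ideal in one of two classes. -/
noncomputable def idealNorm {𝔠 : Ideal (𝓞 K)} {A A' : ClassGroup 𝔠 (Set.univ : Set (K →+* ℝ))} :
    {𝔞 : Ideal (𝓞 K) // InClass 𝔞 A} ⊕ {𝔞 : Ideal (𝓞 K) // InClass 𝔞 A'} → ℕ :=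
  Sum.elim (fun 𝔞 => Ideal.absNorm 𝔞.1) (fun 𝔞 => Ideal.absNorm 𝔞.1)

/-- After unfolding, the nonzero summands are the fundamental domain points with conjugates of equal
sign. Dividing (α) by 𝔟 matches the totally positive ones with the ideals of A and the totally
negative ones with those of RA, and the product of the conjugates is N(𝔞)N(𝔟). -/
theorem hasSum_ideals (E : RealQuadratic K) {𝔟 𝔠 : Ideal (𝓞 K)} (h𝔠 : 𝔠 ≠ ⊥)
    {A : ClassGroup 𝔠 (Set.univ : Set (K →+* ℝ))} (h𝔟 : InClass 𝔟 A⁻¹)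
    {ε : (𝓞 K)ˣ} (hε : ε ∈ E.rayUnitGroup 𝔠) (hε1 : 1 < E.σ (ε : 𝓞 K))
    (hgen : ∀ u ∈ E.rayUnitGroup 𝔠, ∃ k : ℤ, u = ε ^ k) {t Θ : ℝ} (ht : 0 < t)
    (hΘ : HasSum (fun α : CosetPoint 𝔟 𝔠 =>
      geodesicTerm (Real.log (E.σ (ε : 𝓞 K))) t (E.σ α.1) (E.τ α.1)) Θ) :
    HasSum (fun i : {𝔞 : Ideal (𝓞 K) // InClass 𝔞 A} ⊕
        {𝔞 : Ideal (𝓞 K) // InClass 𝔞 (negClass 𝔠 h𝔠 Set.univ * A)} =>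
      idealSign i * Real.exp (-(2 * Real.pi * Ideal.absNorm 𝔟 * idealNorm i) * t)) Θ := by
  have h𝔟0 : 𝔟 ≠ ⊥ := h𝔟.ne_bot
  set ℓ := Real.log (E.σ (ε : 𝓞 K)) with hℓ
  have hexp : Real.exp ℓ = E.σ (ε : 𝓞 K) := Real.exp_log (by linarith)
  have hexp' : Real.exp (-ℓ) = E.τ (ε : 𝓞 K) := by
    rw [Real.exp_neg, hexp, inv_eq_of_mul_eq_one_right (E.σ_mul_τ_of_mem hε)]
  have hℓ0 : 0 < ℓ := Real.log_pos hε1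
  let s := unitPerm E 𝔟 𝔠 ⟨ε, hε⟩
  have hσs : ∀ α, E.σ (s α).1 = Real.exp ℓ * E.σ α.1 := fun α => by
    rw [unitPerm_apply, hexp]; push_cast; exact map_mul _ _ _
  have hτs : ∀ α, E.τ (s α).1 = Real.exp (-ℓ) * E.τ α.1 := fun α => by
    rw [unitPerm_apply, hexp']; push_cast; exact map_mul _ _ _
  have hun := hasSum_unfold s (fun α => E.σ α.1) (fun α => E.τ α.1) hℓ0 ht
    (fun α => embedding_ne_zero _ α.2.2.2) (fun α => embedding_ne_zero _ α.2.2.2) hσs hτs hΘ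
  let h : CosetPoint 𝔟 𝔠 → ℝ := fun α => Real.log |E.σ α.1 / E.τ α.1| / (2 * ℓ)
  have hs : ∀ α, h (s α) = h α + 1 := by
    intro α
    simp only [h]
    have hx := embedding_ne_zero E.σ α.2.2.2
    have hy := embedding_ne_zero E.τ α.2.2.2
    rw [hσs, hτs, Real.exp_neg, show Real.exp ℓ * E.σ α.1 / ((Real.exp ℓ)⁻¹ * E.τ α.1) =
      Real.exp (2 * ℓ) * (E.σ α.1 / E.τ α.1) by
        rw [two_mul, Real.exp_add]; field_simp, abs_mul, Real.abs_exp,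
      Real.log_mul (Real.exp_pos _).ne' (abs_ne_zero.2 (div_ne_zero hx hy)), Real.log_exp]
    field_simp
    ring
  let F := fundamentalDomainEquiv s h hs
  have hF : ∀ p, (F p).1 = (((ε ^ p.2 : (𝓞 K)ˣ)) : 𝓞 K) * p.1.1.1 := by
    intro p
    have : (s ^ p.2 : Equiv.Perm _) = unitPerm E 𝔟 𝔠 (⟨ε, hε⟩ ^ p.2) := (map_zpow _ _ _).symm
    simp only [F, fundamentalDomainEquiv_apply]
    rw [this, unitPerm_apply]
    simp
  -- every coset point can be moved into the fundamental domain
  have hmove : ∀ α : CosetPoint 𝔟 𝔠, ∃ d : {α // 0 ≤ h α ∧ h α < 1},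
      Ideal.span {d.1.1} = Ideal.span {α.1} ∧ 0 < E.σ d.1.1 * E.σ α.1 ∧
        0 < E.τ d.1.1 * E.τ α.1 := by
    intro α
    obtain ⟨p, rfl⟩ := F.surjective α
    have hp := (E.rayUnitGroup 𝔠).zpow_mem hε p.2
    refine ⟨p.1, ?_, ?_, ?_⟩
    · rw [hF, Ideal.span_singleton_mul_left_unit (Units.isUnit _)]
    · rw [hF]
      push_cast
      rw [map_mul, mul_left_comm]
      exact mul_pos hp.2.1 (mul_self_pos.2 (embedding_ne_zero _ p.1.1.2.2.2))
    · rw [hF]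
      push_cast
      rw [map_mul, mul_left_comm]
      exact mul_pos hp.2.2 (mul_self_pos.2 (embedding_ne_zero _ p.1.1.2.2.2))
  -- Two such points with the same ideal and the same signs differ by a power of ε, and a
  -- fundamental domain meets each orbit once.
  have huniq : ∀ d d' : {α // 0 ≤ h α ∧ h α < 1}, Ideal.span {d.1.1} = Ideal.span {d'.1.1} →
      0 < E.σ d.1.1 * E.σ d'.1.1 → 0 < E.τ d.1.1 * E.τ d'.1.1 → d = d' := by
    intro d d' h1 h2 h3
    obtain ⟨u, hu⟩ := exists_rayUnit_of_span_eq E d.1 d'.1 h1 h2 h3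
    obtain ⟨k, hk⟩ := hgen u u.2
    have : F (d, k) = F (d', 0) := by
      apply Subtype.ext
      rw [hF, hF, ← hu, unitPerm_apply, hk]
      simp
    exact congrArg Prod.fst (F.injective this)
  have hpos : ∀ 𝔞 : {𝔞 : Ideal (𝓞 K) // InClass 𝔞 A}, ∃ d : {α // 0 ≤ h α ∧ h α < 1},
      Ideal.span {d.1.1} = 𝔞.1 * 𝔟 ∧ 0 < E.σ d.1.1 ∧ 0 < E.τ d.1.1 := by
    intro 𝔞
    obtain ⟨α, hα1, hα2, hα3⟩ := InClass.exists_generator (A := A) isPrincipalClass_one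
      (𝔞 := 𝔞.1) (by rw [one_mul A]; exact 𝔞.2) h𝔟
    rw [E.pos_iff] at hα2
    have hα0 : α ≠ 0 := by
      rintro rfl
      simp at hα2
    have hα𝔟 : α ∈ 𝔟 := by
      have : α ∈ 𝔞.1 * 𝔟 := hα3 ▸ Ideal.mem_span_singleton_self α
      exact (Ideal.mul_le_right : 𝔞.1 * 𝔟 ≤ 𝔟) this
    obtain ⟨d, h1, h2, h3⟩ := hmove ⟨α, hα𝔟, hα1, hα0⟩
    exact ⟨d, h1.trans hα3, pos_of_mul_pos_left h2 hα2.1.le, pos_of_mul_pos_left h3 hα2.2.le⟩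
  have hneg : ∀ 𝔞 : {𝔞 : Ideal (𝓞 K) // InClass 𝔞 (negClass 𝔠 h𝔠 Set.univ * A)},
      ∃ d : {α // 0 ≤ h α ∧ h α < 1},
      Ideal.span {d.1.1} = 𝔞.1 * 𝔟 ∧ E.σ d.1.1 < 0 ∧ E.τ d.1.1 < 0 := by
    intro 𝔞
    obtain ⟨α, hα1, hα2, hα3⟩ := InClass.exists_generator (A := A)
      (isPrincipalClass_negClass h𝔠) (𝔞 := 𝔞.1) 𝔞.2 h𝔟
    rw [E.pos_iff] at hα2
    have hα0 : α ≠ 0 := by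
      rintro rfl
      simp at hα2
    have hα𝔟 : α ∈ 𝔟 := by
      have : α ∈ 𝔞.1 * 𝔟 := hα3 ▸ Ideal.mem_span_singleton_self α
      exact (Ideal.mul_le_right : 𝔞.1 * 𝔟 ≤ 𝔟) this
    -- A totally positive generator ≡ -1 becomes, after negation, a totally negative point of the
    -- coset of 1.
    have hα1' : -α - 1 ∈ 𝔠 := by
      have : -α - 1 = -(α - -1) := by ring
      rw [this]
      exact neg_mem hα1
    obtain ⟨d, h1, h2, h3⟩ := hmove ⟨-α, neg_mem hα𝔟, hα1', neg_ne_zero.2 hα0⟩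
    push_cast at h2 h3
    rw [map_neg] at h2 h3
    refine ⟨d, ?_, by nlinarith [hα2.1], by nlinarith [hα2.2]⟩
    rw [h1, Ideal.span_singleton_neg, hα3]
  choose jp hjp using hpos
  choose jn hjn using hneg
  let j := Sum.elim jp jn
  have hcancel : ∀ 𝔞 𝔞' : Ideal (𝓞 K), 𝔞 * 𝔟 = 𝔞' * 𝔟 → 𝔞 = 𝔞' := fun 𝔞 𝔞' h =>
    mul_right_cancel₀ (M₀ := Ideal (𝓞 K)) h𝔟0 h
  have hj : Function.Injective j := by
    rintro (𝔞 | 𝔞) (𝔞' | 𝔞') hjj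
    · have hjj' : jp 𝔞 = jp 𝔞' := hjj
      exact congrArg Sum.inl (Subtype.ext (hcancel _ _
        ((hjp 𝔞).1.symm.trans (hjj' ▸ (hjp 𝔞').1))))
    · have hjj' : jp 𝔞 = jn 𝔞' := hjj
      have h1 := (hjp 𝔞).2.1
      rw [hjj'] at h1
      exact absurd (hjn 𝔞').2.1 h1.not_gt
    · have hjj' : jn 𝔞 = jp 𝔞' := hjj
      have h1 := (hjn 𝔞).2.1
      rw [hjj'] at h1
      exact absurd (hjp 𝔞').2.1 h1.not_gt
    · have hjj' : jn 𝔞 = jn 𝔞' := hjj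
      exact congrArg Sum.inr (Subtype.ext (hcancel _ _
        ((hjn 𝔞).1.symm.trans (hjj' ▸ (hjn 𝔞').1))))
  -- Points missed by j can only have conjugates of opposite sign, and their orbits cancel.
  have hrange : ∀ d ∉ Set.range j, orbitSign (E.σ d.1.1) (E.τ d.1.1) *
      Real.exp (-2 * Real.pi * t * (E.σ d.1.1 * E.τ d.1.1)) = 0 := by
    intro d hd
    rw [orbitSign]
    split_ifs with hp hn
    · refine absurd ?_ hd
      obtain ⟨𝔞, h1, h2⟩ := InClass.exists_of_generator (A := A) isPrincipalClass_one (one_mul 1) h𝔟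
        d.1.2.2.1 d.1.2.2.2 ((E.pos_iff _).2 hp) d.1.2.1
      rw [one_mul A] at h1
      refine ⟨Sum.inl ⟨𝔞, h1⟩, huniq _ _ ((hjp ⟨𝔞, h1⟩).1.trans h2.symm) ?_ ?_⟩
      · exact mul_pos (hjp ⟨𝔞, h1⟩).2.1 hp.1
      · exact mul_pos (hjp ⟨𝔞, h1⟩).2.2 hp.2
    · refine absurd ?_ hd
      have hα1' : -d.1.1 - -1 ∈ 𝔠 := by
        have : -d.1.1 - -1 = -(d.1.1 - 1) := by ring
        rw [this]
        exact neg_mem d.1.2.2.1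
      obtain ⟨𝔞, h1, h2⟩ := InClass.exists_of_generator (A := A) (isPrincipalClass_negClass h𝔠)
        (by ring) h𝔟 hα1' (neg_ne_zero.2 d.1.2.2.2) ((E.pos_iff _).2 (by
          push_cast
          rw [map_neg, map_neg]
          exact ⟨neg_pos.2 hn.1, neg_pos.2 hn.2⟩)) (neg_mem d.1.2.1)
      rw [Ideal.span_singleton_neg] at h2
      refine ⟨Sum.inr ⟨𝔞, h1⟩, huniq _ _ ((hjn ⟨𝔞, h1⟩).1.trans h2.symm) ?_ ?_⟩
      · exact mul_pos_of_neg_of_neg (hjn ⟨𝔞, h1⟩).2.1 hn.1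
      · exact mul_pos_of_neg_of_neg (hjn ⟨𝔞, h1⟩).2.2 hn.2
    · simp
  have hfin := (hj.hasSum_iff hrange).2 hun
  have hnorm : ∀ (d : {α // 0 ≤ h α ∧ h α < 1}) (𝔞 : Ideal (𝓞 K)), Ideal.span {d.1.1} = 𝔞 * 𝔟 →
      0 < E.σ d.1.1 * E.τ d.1.1 →
      E.σ d.1.1 * E.τ d.1.1 = Ideal.absNorm 𝔞 * Ideal.absNorm 𝔟 := by
    intro d 𝔞 h1 h2
    rw [← E.absNorm_span _ h2, h1, map_mul, Nat.cast_mul]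
  convert! hfin using 1
  funext i
  rcases i with 𝔞 | 𝔞
  · have h1 := (hjp 𝔞).2
    simp only [Function.comp, j, Sum.elim_inl, idealSign, idealNorm]
    rw [orbitSign, if_pos h1, hnorm _ _ (hjp 𝔞).1 (mul_pos h1.1 h1.2)]
    ring_nf
  · have h1 := (hjn 𝔞).2
    simp only [Function.comp, j, Sum.elim_inr, idealSign, idealNorm]
    rw [orbitSign, if_neg (fun h => h1.1.not_gt h.1), if_pos h1,
      hnorm _ _ (hjn 𝔞).1 (mul_pos_of_neg_of_neg h1.1 h1.2)]
    ring_nf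

end RayClass

/-! ### Lattice coordinates on the coset -/

namespace RayClass

variable {K : Type*} [Field K] [NumberField K]

/-- Lattice coordinates on the coset points. -/
theorem exists_coordinates (E : RealQuadratic K) (hK : Module.finrank ℚ K = 2)
    {𝔟 𝔠 : Ideal (𝓞 K)} (h𝔟 : 𝔟 ≠ ⊥) (h𝔠 : 𝔠 ≠ ⊥) (hcop : IsCoprime 𝔟 𝔠) :
    ∃ (a₁ a₂ b₁ b₂ : ℝ) (q : Fin 2 → ℚ) (i : CosetPoint 𝔟 𝔠 → ℤ × ℤ),
      a₁ * b₂ - a₂ * b₁ ≠ 0 ∧ Function.Injective i ∧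
      (∀ α, a₁ * (i α).1 + a₂ * (i α).2 + (a₁ * q 0 + a₂ * q 1) = E.σ α.1 ∧
        b₁ * (i α).1 + b₂ * (i α).2 + (b₁ * q 0 + b₂ * q 1) = E.τ α.1) ∧
      ∀ v ∉ Set.range i, a₁ * (v.1 : ℝ) + a₂ * v.2 + (a₁ * q 0 + a₂ * q 1) = 0 ∧
        b₁ * (v.1 : ℝ) + b₂ * v.2 + (b₁ * q 0 + b₂ * q 1) = 0 := by
  have hI0 : 𝔟 * 𝔠 ≠ ⊥ := mul_ne_zero (M₀ := Ideal (𝓞 K)) h𝔟 h𝔠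
  obtain ⟨e₁, e₂, hmem, hD⟩ := E.exists_basis hK (𝔟 * 𝔠) hI0
  -- By coprimality some α₀ in 𝔟 is ≡ 1 (mod 𝔠), and the coset is α₀ + 𝔟𝔠.
  obtain ⟨α₀, hα₀, y, hy, hαy⟩ := Ideal.isCoprime_iff_exists.1 hcop
  have hα₁ : α₀ - 1 ∈ 𝔠 := by
    have : α₀ - 1 = -y := by linear_combination hαy
    rw [this]
    exact neg_mem hy
  obtain ⟨N, hN⟩ : ∃ N, N = Ideal.absNorm (𝔟 * 𝔠) := ⟨_, rfl⟩
  have hN0 : (N : ℝ) ≠ 0 := by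
    rw [Nat.cast_ne_zero]
    exact fun h => hI0 (Ideal.absNorm_eq_zero_iff.1 (hN.symm.trans h))
  have hNmem := Ideal.absNorm_mem (𝔟 * 𝔠)
  rw [← hN] at hNmem
  obtain ⟨m₀, n₀, hmn⟩ := (hmem (α₀ * N)).1 (Ideal.mul_mem_left _ _ hNmem)
  -- These are the rational coordinates of α₀ in the basis of 𝔟𝔠: multiplication by N moves it into
  -- that lattice.
  let q : Fin 2 → ℚ := ![m₀ / N, n₀ / N]
  have hq : ∀ ρ : K →+* ℝ, ρ e₁ * q 0 + ρ e₂ * q 1 = ρ α₀ := by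
    intro ρ
    have h := congrArg (fun x : 𝓞 K => ρ x) hmn
    push_cast at h
    simp only [map_add, map_mul, map_natCast, map_intCast] at h
    simp only [q, Matrix.cons_val_zero, Matrix.cons_val_one]
    push_cast
    field_simp
    linear_combination -h
  have hrep : ∀ ρ : K →+* ℝ, ∀ (α : 𝓞 K) (m n : ℤ), α - α₀ = m * e₁ + n * e₂ →
      ρ e₁ * m + ρ e₂ * n + (ρ e₁ * q 0 + ρ e₂ * q 1) = ρ α := by
    intro ρ α m n h
    have h := congrArg (fun x : 𝓞 K => ρ x) h
    push_cast at h
    simp only [map_add, map_sub, map_mul, map_intCast] at h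
    rw [hq]
    linear_combination -h
  have hsub : ∀ α : CosetPoint 𝔟 𝔠, ∃ v : ℤ × ℤ, α.1 - α₀ = v.1 * e₁ + v.2 * e₂ := by
    intro α
    have h1 : α.1 - α₀ ∈ 𝔟 * 𝔠 := by
      rw [Ideal.mul_eq_inf_of_isCoprime hcop]
      refine ⟨Ideal.sub_mem _ α.2.1 hα₀, ?_⟩
      have : α.1 - α₀ = (α.1 - 1) - (α₀ - 1) := by ring
      rw [this]
      exact Ideal.sub_mem _ α.2.2.1 hα₁
    obtain ⟨m, n, h⟩ := (hmem _).1 h1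
    exact ⟨(m, n), h⟩
  choose i hi using hsub
  refine ⟨E.σ e₁, E.σ e₂, E.τ e₁, E.τ e₂, q, i, hD, ?_, fun α =>
    ⟨hrep E.σ _ _ _ (hi α), hrep E.τ _ _ _ (hi α)⟩, fun v hv => ?_⟩
  · intro α β h
    have h1 := hi α
    rw [h, ← hi β] at h1
    exact Subtype.ext (sub_left_injective h1)
  · set α : 𝓞 K := α₀ + (v.1 * e₁ + v.2 * e₂) with hα
    have hv' : α - α₀ = v.1 * e₁ + v.2 * e₂ := by rw [hα]; ring
    have hvI : (v.1 : 𝓞 K) * e₁ + v.2 * e₂ ∈ 𝔟 * 𝔠 := (hmem _).2 ⟨_, _, rfl⟩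
    have hαb : α ∈ 𝔟 := Ideal.add_mem _ hα₀ ((Ideal.mul_le_left : 𝔟 * 𝔠 ≤ 𝔟) hvI)
    have hαc : α - 1 ∈ 𝔠 := by
      have : α - 1 = (α₀ - 1) + (v.1 * e₁ + v.2 * e₂) := by rw [hα]; ring
      rw [this]
      exact Ideal.add_mem _ hα₁ ((Ideal.mul_le_right : 𝔟 * 𝔠 ≤ 𝔠) hvI)
    -- The only lattice point that fails to come from a nonzero coset element is α = 0, where both
    -- forms vanish.
    have h0 : α = 0 := by
      by_contra h0
      refine hv ⟨⟨α, hαb, hαc, h0⟩, ?_⟩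
      have h1 := hi ⟨α, hαb, hαc, h0⟩
      generalize i ⟨α, hαb, hαc, h0⟩ = w at h1
      have h2 := h1.symm.trans hv'
      have h3 : ∀ ρ : K →+* ℝ, (w.1 : ℝ) * ρ e₁ + w.2 * ρ e₂ = v.1 * ρ e₁ + v.2 * ρ e₂ := by
        intro ρ
        have h := congrArg (fun x : 𝓞 K => ρ x) h2
        push_cast at h
        simpa only [map_add, map_mul, map_intCast] using h
      have h4 := h3 E.σ
      have h5 := h3 E.τ
      have h6 : (w.1 : ℝ) = v.1 := mul_right_cancel₀ hD (by linear_combination E.τ e₂ * h4 - E.σ e₂ * h5)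
      have h7 : (w.2 : ℝ) = v.2 := mul_right_cancel₀ hD (by linear_combination E.σ e₁ * h5 - E.τ e₁ * h4)
      exact Prod.ext (by exact_mod_cast h6) (by exact_mod_cast h7)
    have h1 := hrep E.σ _ _ _ hv'
    have h2 := hrep E.τ _ _ _ hv'
    rw [h0] at h1 h2
    have hz : ∀ ρ : K →+* ℝ, ρ ((0 : 𝓞 K) : K) = 0 := fun ρ => by simp
    exact ⟨h1.trans (hz _), h2.trans (hz _)⟩

/-! ### Convergence of the Dirichlet series and Mellin transforms -/

-- The number of nonzero ideals of norm at most n is asymptotic to a constant times n, and summation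
-- by parts then gives convergence for exponents beyond 1.
open Filter Topology in
theorem summable_card_mul_rpow {x : ℝ} (hx : 1 < x) :
    Summable fun n : ℕ => (Nat.card {I : Ideal (𝓞 K) // Ideal.absNorm I = n} : ℝ) *
      (n : ℝ) ^ (-x) := by
  have hlim : Tendsto (fun n : ℕ => (∑ k ∈ Finset.Icc 1 n,
      (Nat.card {I : Ideal (𝓞 K) // Ideal.absNorm I = k} : ℝ)) / n) atTop
      (𝓝 (NumberField.dedekindZeta_residue K)) := by
    refine ((NumberField.Ideal.tendsto_norm_le_div_atTop₀ K).comp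
      tendsto_natCast_atTop_atTop).congr fun n => ?_
    simp only [Function.comp_apply, Nat.cast_le, ← Nat.cast_sum]
    congr
    -- One is added to both counts so that the zero ideal, the only ideal of norm 0, is included and
    -- the sum can start at 0.
    rw [← add_left_inj 1, ← Ideal.card_norm_le_eq_card_norm_le_add_one,
      show Finset.Icc 1 n = Finset.Ioc 0 n from Finset.Icc_succ_left_eq_Ioc _ _,
      show 1 = Nat.card {I : Ideal (𝓞 K) // Ideal.absNorm I = 0} by
        simp [Ideal.absNorm_eq_zero_iff],
      Finset.sum_Ioc_add_eq_sum_Icc (n.zero_le),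
      ← Finset.card_preimage_eq_sum_card_image_eq (fun k _ => Ideal.finite_setOfPred_absNorm_eq k)]
    simp [Set.coe_eq_subtype]
  have hO : (fun n : ℕ => ∑ k ∈ Finset.Icc 1 n,
      (Nat.card {I : Ideal (𝓞 K) // Ideal.absNorm I = k} : ℝ)) =O[atTop]
      fun n : ℕ => (n : ℝ) ^ (1 : ℝ) := by
    simp only [Real.rpow_one]
    refine Asymptotics.isBigO_of_div_tendsto_nhds ?_ _ hlim
    filter_upwards [eventually_ne_atTop 0] with n hn h
    exact absurd h (Nat.cast_ne_zero.2 hn)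
  have hL := LSeriesSummable_of_sum_norm_bigO_and_nonneg (s := (x : ℂ)) hO
    (fun n => Nat.cast_nonneg _) zero_le_one (by simpa using hx)
  refine hL.norm.congr fun n => ?_
  rw [LSeries.norm_term_eq]
  split_ifs with h
  · rw [h, Nat.cast_zero, Real.zero_rpow (by linarith), mul_zero]
  · rw [Complex.ofReal_re, Real.rpow_neg (Nat.cast_nonneg _), div_eq_mul_inv]
    simp

/-- Absolute convergence of the Dirichlet series over all ideals. -/
theorem summable_absNorm_rpow {x : ℝ} (hx : 1 < x) :
    Summable fun I : Ideal (𝓞 K) => (Ideal.absNorm I : ℝ) ^ (-x) := by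
  rw [← (Equiv.sigmaFiberEquiv (fun I : Ideal (𝓞 K) => Ideal.absNorm I)).summable_iff,
    summable_sigma_of_nonneg fun _ => by simp only [Function.comp]; positivity]
  have hfin : ∀ n, Finite {I : Ideal (𝓞 K) // Ideal.absNorm I = n} := fun n =>
    (Ideal.finite_setOfPred_absNorm_eq n).to_subtype
  constructor
  · intro n
    have := hfin n
    exact Summable.of_finite
  · refine (summable_card_mul_rpow (K := K) hx).congr fun n => ?_
    have := hfin n
    have hc : ∀ I : {I : Ideal (𝓞 K) // Ideal.absNorm I = n},
        ((fun I : Ideal (𝓞 K) => (Ideal.absNorm I : ℝ) ^ (-x)) ∘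
          (Equiv.sigmaFiberEquiv fun I : Ideal (𝓞 K) => Ideal.absNorm I)) ⟨n, I⟩ =
          (n : ℝ) ^ (-x) := by
      rintro ⟨I, rfl⟩
      rfl
    rw [tsum_congr hc, tsum_const, nsmul_eq_mul]

end RayClass

open Filter Topology in
/-- The Mellin transform of an exponential series that decays rapidly at zero is entire. -/
theorem mellin_entire_of_hasSum_exp {J : Type*} {a p : J → ℝ} {F : ℝ → ℂ} {κ : ℝ} (hκ : 0 < κ)
    (ha : ∀ i, |a i| = 1) (hp : ∀ i, κ ≤ p i)
    (hF : ∀ t ∈ Set.Ioi (0 : ℝ), HasSum (fun i => (a i : ℂ) * (Real.exp (-p i * t) : ℝ)) (F t))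
    (hbot : ∀ N : ℕ, ∃ C : ℝ, ∀ t : ℝ, 0 < t → t ≤ 1 → ‖F t‖ ≤ C * t ^ N) :
    (∀ s, MellinConvergent F s) ∧ Differentiable ℂ (mellin F) := by
  have hnorm : ∀ i t, ‖(a i : ℂ) * (Real.exp (-p i * t) : ℝ)‖ = Real.exp (-p i * t) := fun i t => by
    rw [norm_mul, Complex.norm_real, Real.norm_eq_abs, ha, one_mul, Complex.norm_real,
      Real.norm_of_nonneg (Real.exp_pos _).le]
  have hs : ∀ t, 0 < t → Summable fun i => Real.exp (-p i * t) := fun t ht =>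
    (hF t ht).summable.norm.congr fun i => hnorm i t
  have hcont : ContinuousOn F (Set.Ioi 0) := by
    intro t₀ ht₀
    have ht₀' : (0 : ℝ) < t₀ := ht₀
    have h1 : ContinuousOn (fun t => ∑' i, (a i : ℂ) * (Real.exp (-p i * t) : ℝ))
        (Set.Ioi (t₀ / 2)) := by
      -- On (t₀/2, ∞) the series is dominated by its value at t₀/2 with the signs removed.
      refine continuousOn_tsum (fun i => by fun_prop) (hs (t₀ / 2) (by linarith)) fun i t ht => ?_
      rw [hnorm, Real.exp_le_exp]
      have ht' : t₀ / 2 < t := ht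
      nlinarith [hp i]
    have h2 : ContinuousOn F (Set.Ioi (t₀ / 2)) := h1.congr fun t ht => by
      have ht' : t₀ / 2 < t := ht
      exact (hF t (show (0 : ℝ) < t by linarith)).tsum_eq.symm
    exact (h2.continuousAt (Ioi_mem_nhds (by linarith))).continuousWithinAt
  have hloc : MeasureTheory.LocallyIntegrableOn F (Set.Ioi 0) :=
    hcont.locallyIntegrableOn measurableSet_Ioi
  have htop : F =O[atTop] fun t => Real.exp (-κ * t) := by
    -- For t ≥ 1, (p - κ)(t - 1) ≥ 0 bounds e^{-pt} by e^{κ} e^{-κt} e^{-p}, and the last factor is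
    -- summable.
    refine Asymptotics.IsBigO.of_bound (Real.exp κ * ∑' i, Real.exp (-p i * 1)) ?_
    filter_upwards [eventually_ge_atTop 1] with t ht
    have ht0 : (0 : ℝ) < t := by linarith
    rw [← (hF t ht0).tsum_eq, Real.norm_of_nonneg (Real.exp_pos _).le, mul_right_comm,
      ← Real.exp_add]
    refine (norm_tsum_le_tsum_norm (hF t ht0).summable.norm).trans ?_
    rw [← tsum_mul_left]
    refine (hF t ht0).summable.norm.tsum_le_tsum (fun i => ?_) ((hs 1 one_pos).mul_left _)
    rw [hnorm, ← Real.exp_add, Real.exp_le_exp]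
    nlinarith [hp i]
  have hzero : ∀ b : ℝ, F =O[𝓝[>] 0] (· ^ (-b)) := by
    intro b
    obtain ⟨N, hN⟩ := exists_nat_ge (-b)
    obtain ⟨C, hC⟩ := hbot N
    refine Asymptotics.IsBigO.of_bound |C| ?_
    filter_upwards [Ioo_mem_nhdsGT one_pos] with t ht
    refine (hC t ht.1 ht.2.le).trans (mul_le_mul (le_abs_self C) ?_ (pow_nonneg ht.1.le _)
      (abs_nonneg C))
    rw [Real.norm_of_nonneg (Real.rpow_nonneg ht.1.le _), ← Real.rpow_natCast]
    exact Real.rpow_le_rpow_of_exponent_ge ht.1 ht.2.le hN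
  exact ⟨fun s => mellinConvergent_of_isBigO_rpow_exp hκ hloc htop (hzero (s.re - 1)) (by linarith),
    fun s => mellin_differentiableAt_of_isBigO_rpow_exp hκ hloc htop (hzero (s.re - 1))
      (by linarith)⟩

namespace RayClass

variable {K : Type*} [Field K] [NumberField K]

theorem InClass.absNorm_pos {𝔠 : Ideal (𝓞 K)} {S : Set (K →+* ℝ)} {A : ClassGroup 𝔠 S}
    {𝔞 : Ideal (𝓞 K)} (h : InClass 𝔞 A) : 0 < Ideal.absNorm 𝔞 :=
  Nat.pos_of_ne_zero fun h0 => h.ne_bot (Ideal.absNorm_eq_zero_iff.1 h0)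

theorem summable_zetaTerm {𝔠 : Ideal (𝓞 K)} {S : Set (K →+* ℝ)} (A : ClassGroup 𝔠 S) {s : ℂ}
    (hs : 1 < s.re) : Summable (zetaTerm A s) := by
  refine Summable.of_norm (((summable_absNorm_rpow (K := K) hs).comp_injective
    (Subtype.val_injective (p := fun 𝔞 => InClass 𝔞 A))).congr fun 𝔞 => ?_)
  rw [zetaTerm, Complex.norm_natCast_cpow_of_pos 𝔞.2.absNorm_pos, Complex.neg_re]
  rfl

/-- The exchange of sum and Mellin integral needs a countable index set. -/
instance countable_ideal : Countable (Ideal (𝓞 K)) := by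
  have hfin : ∀ n, Finite {I : Ideal (𝓞 K) // Ideal.absNorm I = n} := fun n =>
    (Ideal.finite_setOfPred_absNorm_eq n).to_subtype
  exact (Equiv.sigmaFiberEquiv (fun I : Ideal (𝓞 K) => Ideal.absNorm I)).symm.injective.countable

section idealSum

variable {𝔠 : Ideal (𝓞 K)} {A A' : ClassGroup 𝔠 (Set.univ : Set (K →+* ℝ))}

theorem idealNorm_pos (i : {𝔞 : Ideal (𝓞 K) // InClass 𝔞 A} ⊕ {𝔞 : Ideal (𝓞 K) // InClass 𝔞 A'}) :
    0 < idealNorm i := by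
  rcases i with 𝔞 | 𝔞
  exacts [𝔞.2.absNorm_pos, 𝔞.2.absNorm_pos]

theorem abs_idealSign (i : {𝔞 : Ideal (𝓞 K) // InClass 𝔞 A} ⊕ {𝔞 : Ideal (𝓞 K) // InClass 𝔞 A'}) :
    |idealSign i| = 1 := by
  rcases i with 𝔞 | 𝔞 <;> simp [idealSign]

theorem hasSum_idealSign_mul {s : ℂ} (hs : 1 < s.re) :
    HasSum (fun i : {𝔞 : Ideal (𝓞 K) // InClass 𝔞 A} ⊕ {𝔞 : Ideal (𝓞 K) // InClass 𝔞 A'} =>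
      (idealSign i : ℂ) * (idealNorm i : ℂ) ^ (-s)) (zeta A s - zeta A' s) := by
  rw [sub_eq_add_neg]
  refine HasSum.sum ?_ ?_
  · convert! (summable_zetaTerm A hs).hasSum using 1
    funext 𝔞
    simp [idealSign, idealNorm, zetaTerm]
  · convert! (summable_zetaTerm A' hs).hasSum.neg using 1
    funext 𝔞
    simp [idealSign, idealNorm, zetaTerm]

/-- Each exponential e^{-λt} has Mellin transform Γ(s) λ^{-s}, and λ = 2π N N(𝔞) factors off the
constant. The exchange with the sum rests on absolute convergence for Re s > 1. -/
theorem mellin_eq_zeta {N : ℕ} (hN : 0 < N) {F : ℝ → ℂ}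
    (hF : ∀ t ∈ Set.Ioi (0 : ℝ), HasSum (fun i : {𝔞 : Ideal (𝓞 K) // InClass 𝔞 A} ⊕
      {𝔞 : Ideal (𝓞 K) // InClass 𝔞 A'} => (idealSign i : ℂ) *
        (Real.exp (-(2 * Real.pi * N * idealNorm i) * t) : ℝ)) (F t)) {s : ℂ} (hs : 1 < s.re) :
    mellin F s = (2 * Real.pi * N : ℂ) ^ (-s) * Complex.Gamma s * (zeta A s - zeta A' s) := by
  have hp : ∀ i : {𝔞 : Ideal (𝓞 K) // InClass 𝔞 A} ⊕ {𝔞 : Ideal (𝓞 K) // InClass 𝔞 A'},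
      0 < 2 * Real.pi * N * (idealNorm i : ℝ) := fun i => by
    have := idealNorm_pos i
    positivity
  have h1 : ∀ i : {𝔞 : Ideal (𝓞 K) // InClass 𝔞 A} ⊕ {𝔞 : Ideal (𝓞 K) // InClass 𝔞 A'},
      1 / ((2 * Real.pi * N * idealNorm i : ℝ) : ℂ) ^ s =
        (2 * Real.pi * N : ℂ) ^ (-s) * (idealNorm i : ℂ) ^ (-s) := fun i => by
    rw [one_div, ← Complex.cpow_neg, Complex.ofReal_mul, Complex.mul_cpow_ofReal_nonneg
      (by positivity) (by positivity)]
    push_cast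
    rfl
  have hsum := hasSum_idealSign_mul (A := A) (A' := A') hs
  have h := hasSum_mellin (a := fun i => (idealSign i : ℂ)) (fun i => Or.inr (hp i))
    (by linarith) hF (by
      refine (hsum.summable.norm.mul_left ‖(2 * Real.pi * N : ℂ) ^ (-s)‖).congr fun i => ?_
      rw [norm_mul, mul_left_comm, ← norm_mul, ← h1, norm_div, norm_one,
        Complex.norm_cpow_eq_rpow_re_of_pos (hp i), mul_one_div])
  rw [← h.tsum_eq, ← hsum.tsum_eq, ← tsum_mul_left]
  refine tsum_congr fun i => ?_
  rw [div_eq_mul_one_div, h1]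
  ring

end idealSum

end RayClass

/-! ### The form 2xy, its square root branches and its theta terms -/

namespace Indefinite

variable {a₁ a₂ b₁ b₂ : ℝ}

/-- The matrix of the quadratic form `2 (a₁ x + a₂ y) (b₁ x + b₂ y)`. -/
def productForm (a₁ a₂ b₁ b₂ : ℝ) : Matrix (Fin 2) (Fin 2) ℝ :=
  !![2 * a₁ * b₁, a₁ * b₂ + a₂ * b₁; a₁ * b₂ + a₂ * b₁, 2 * a₂ * b₂]

theorem productForm_isSymm : (productForm a₁ a₂ b₁ b₂).IsSymm := by
  ext i j
  fin_cases i <;> fin_cases j <;> simp [productForm]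

/-- The determinant is minus the square of a nonzero number, so the two eigenvalues have opposite
signs. -/
theorem hasSignature_productForm (hD : a₁ * b₂ - a₂ * b₁ ≠ 0) :
    HasSignature (productForm a₁ a₂ b₁ b₂) 1 1 := by
  have h : (productForm a₁ a₂ b₁ b₂).IsHermitian := by
    rw [Matrix.IsHermitian, Matrix.conjTranspose_eq_transpose_of_trivial]
    exact productForm_isSymm
  refine ⟨rfl, h, ?_⟩
  have hdet := h.det_eq_prod_eigenvalues
  have hval : (productForm a₁ a₂ b₁ b₂).det = -(a₁ * b₂ - a₂ * b₁) ^ 2 := by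
    rw [productForm, Matrix.det_fin_two_of]
    ring
  rw [Fin.prod_univ_two, hval] at hdet
  have hneg : h.eigenvalues 0 * h.eigenvalues 1 < 0 := by
    have h1 : h.eigenvalues 0 * h.eigenvalues 1 = -(a₁ * b₂ - a₂ * b₁) ^ 2 := hdet.symm
    rw [h1]
    have := sq_pos_of_ne_zero hD
    linarith
  rw [Finset.card_filter, Finset.card_filter, Fin.sum_univ_two, Fin.sum_univ_two]
  rcases mul_neg_iff.1 hneg with ⟨h0, h1⟩ | ⟨h0, h1⟩
  · simp [h0, h1, h0.not_gt, h1.not_gt]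
  · simp [h0, h1, h0.not_gt, h1.not_gt]

theorem dotProduct_productForm_mulVec (w z : Fin 2 → ℂ) :
    w ⬝ᵥ (toC (productForm a₁ a₂ b₁ b₂) *ᵥ z) =
      (a₁ * w 0 + a₂ * w 1) * (b₁ * z 0 + b₂ * z 1) +
        (b₁ * w 0 + b₂ * w 1) * (a₁ * z 0 + a₂ * z 1) := by
  simp [toC, productForm, Matrix.mulVec, dotProduct, Fin.sum_univ_two]
  ring

/-- With X, Y the values of the two forms, the Hermitian value is 2 Re(X̄Y) = ½(|X + Y|² - |X -
Y|²). -/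
theorem mem_negRegion_productForm {z : Fin 2 → ℂ} :
    z ∈ negRegion (productForm a₁ a₂ b₁ b₂) ↔
      ‖(a₁ * z 0 + a₂ * z 1) + (b₁ * z 0 + b₂ * z 1)‖ <
        ‖(a₁ * z 0 + a₂ * z 1) - (b₁ * z 0 + b₂ * z 1)‖ := by
  rw [← sq_lt_sq₀ (norm_nonneg _) (norm_nonneg _), ← Complex.normSq_eq_norm_sq,
    ← Complex.normSq_eq_norm_sq, negRegion, Set.mem_ofPred_eq, dotProduct_productForm_mulVec]
  simp only [Complex.normSq_apply, Pi.star_apply, Complex.star_def, Complex.add_re, Complex.add_im,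
    Complex.sub_re, Complex.sub_im, Complex.mul_re, Complex.mul_im, Complex.conj_re,
    Complex.conj_im, Complex.ofReal_re, Complex.ofReal_im]
  constructor <;> intro h <;> linarith

/-- With p and m the sum and difference of the forms, -zᵀMz = (m²/2)(1 - (p/m)²). On the region
|p/m| < 1, so the second factor has positive real part and a holomorphic principal root. -/
theorem exists_isNegSqrt_productForm : ∃ r, IsNegSqrt (productForm a₁ a₂ b₁ b₂) r := by
  let p : (Fin 2 → ℂ) → ℂ := fun z => (a₁ * z 0 + a₂ * z 1) + (b₁ * z 0 + b₂ * z 1)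
  let m : (Fin 2 → ℂ) → ℂ := fun z => (a₁ * z 0 + a₂ * z 1) - (b₁ * z 0 + b₂ * z 1)
  have hp : Differentiable ℂ p := by fun_prop
  have hm : Differentiable ℂ m := by fun_prop
  have hlt : ∀ z ∈ negRegion (productForm a₁ a₂ b₁ b₂), ‖p z‖ < ‖m z‖ := fun z hz =>
    mem_negRegion_productForm.1 hz
  have hm0 : ∀ z ∈ negRegion (productForm a₁ a₂ b₁ b₂), m z ≠ 0 := fun z hz =>
    norm_pos_iff.1 ((norm_nonneg _).trans_lt (hlt z hz))
  have hslit : ∀ z ∈ negRegion (productForm a₁ a₂ b₁ b₂),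
      1 - (p z / m z) ^ 2 ∈ Complex.slitPlane := by
    intro z hz
    left
    have h1 : ‖(p z / m z) ^ 2‖ < 1 := by
      rw [norm_pow, norm_div]
      refine pow_lt_one₀ (by positivity) ?_ two_ne_zero
      rw [div_lt_one (norm_pos_iff.2 (hm0 z hz))]
      exact hlt z hz
    have h2 := (Complex.re_le_norm ((p z / m z) ^ 2)).trans_lt h1
    rw [Complex.sub_re, Complex.one_re]
    linarith
  refine ⟨fun z => m z / (Real.sqrt 2 : ℝ) * (1 - (p z / m z) ^ 2) ^ (1 / 2 : ℂ), ?_, fun z hz => ?_⟩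
  · intro z hz
    refine DifferentiableAt.differentiableWithinAt ?_
    have h1 : DifferentiableAt ℂ (fun z => 1 - (p z / m z) ^ 2) z :=
      (((hp z).fun_mul ((hm z).fun_inv (hm0 z hz))).fun_pow 2).const_sub 1
    have h2 : DifferentiableAt ℂ (fun z => (1 - (p z / m z) ^ 2) ^ (1 / 2 : ℂ)) z :=
      h1.cpow_const (hslit z hz)
    have h3 : DifferentiableAt ℂ (fun z => m z / (Real.sqrt 2 : ℝ)) z := by fun_prop
    exact h3.fun_mul h2
  · have h2 : ((Real.sqrt 2 : ℝ) : ℂ) ^ 2 = 2 := by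
      exact_mod_cast Real.sq_sqrt (zero_le_two (α := ℝ))
    have h3 : ((1 - (p z / m z) ^ 2) ^ (1 / 2 : ℂ)) ^ 2 = 1 - (p z / m z) ^ 2 := by
      rw [← Complex.cpow_nat_mul]
      simp
    have h4 := hm0 z hz
    rw [mul_pow, h3, div_pow, h2, dotProduct_productForm_mulVec]
    have h5 : m z ^ 2 / 2 * (1 - (p z / m z) ^ 2) = (m z ^ 2 - p z ^ 2) / 2 := by
      field_simp
    rw [h5]
    simp only [p, m]
    ring

/-- The point of the geodesic at parameter `u`: its two linear forms are `-e^{-u}` and `e^u`. -/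
noncomputable def geodesicPoint (a₁ a₂ b₁ b₂ u : ℝ) : Fin 2 → ℝ :=
  ![-(Real.exp (-u) * b₂ + a₂ * Real.exp u) / (a₁ * b₂ - a₂ * b₁),
    (a₁ * Real.exp u + b₁ * Real.exp (-u)) / (a₁ * b₂ - a₂ * b₁)]

theorem geodesicPoint_left (hD : a₁ * b₂ - a₂ * b₁ ≠ 0) (u : ℝ) :
    a₁ * geodesicPoint a₁ a₂ b₁ b₂ u 0 + a₂ * geodesicPoint a₁ a₂ b₁ b₂ u 1 = -Real.exp (-u) := by
  simp only [geodesicPoint, Matrix.cons_val_zero, Matrix.cons_val_one]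
  rw [mul_div_assoc', mul_div_assoc', ← add_div, div_eq_iff hD]
  ring

theorem geodesicPoint_right (hD : a₁ * b₂ - a₂ * b₁ ≠ 0) (u : ℝ) :
    b₁ * geodesicPoint a₁ a₂ b₁ b₂ u 0 + b₂ * geodesicPoint a₁ a₂ b₁ b₂ u 1 = Real.exp u := by
  simp only [geodesicPoint, Matrix.cons_val_zero, Matrix.cons_val_one]
  rw [mul_div_assoc', mul_div_assoc', ← add_div, div_eq_iff hD]
  ring

theorem geodesicPoint_left_complex (hD : a₁ * b₂ - a₂ * b₁ ≠ 0) (u : ℝ) :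
    (a₁ * (geodesicPoint a₁ a₂ b₁ b₂ u 0 : ℝ) + a₂ * (geodesicPoint a₁ a₂ b₁ b₂ u 1 : ℝ) : ℂ) =
      ((-Real.exp (-u) : ℝ) : ℂ) := by
  rw [← geodesicPoint_left hD]
  push_cast
  rfl

theorem geodesicPoint_right_complex (hD : a₁ * b₂ - a₂ * b₁ ≠ 0) (u : ℝ) :
    (b₁ * (geodesicPoint a₁ a₂ b₁ b₂ u 0 : ℝ) + b₂ * (geodesicPoint a₁ a₂ b₁ b₂ u 1 : ℝ) : ℂ) =
      ((Real.exp u : ℝ) : ℂ) := by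
  rw [← geodesicPoint_right hD]
  push_cast
  rfl

theorem geodesicPoint_mem_negRegion (hD : a₁ * b₂ - a₂ * b₁ ≠ 0) (u : ℝ) :
    (fun i => (geodesicPoint a₁ a₂ b₁ b₂ u i : ℂ)) ∈ negRegion (productForm a₁ a₂ b₁ b₂) := by
  rw [mem_negRegion_productForm, geodesicPoint_left_complex hD, geodesicPoint_right_complex hD,
    ← Complex.ofReal_add, ← Complex.ofReal_sub, Complex.norm_real, Complex.norm_real,
    Real.norm_eq_abs, Real.norm_eq_abs, ← sq_lt_sq]
  nlinarith [mul_pos (Real.exp_pos u) (Real.exp_pos (-u))]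

/-- Along the curve -cᵀMc is constantly 2, so a continuous branch takes the values ±√2 only, and
connectedness of the line fixes the sign. -/
theorem isNegSqrt_geodesicPoint (hD : a₁ * b₂ - a₂ * b₁ ≠ 0) {r : (Fin 2 → ℂ) → ℂ}
    (hr : IsNegSqrt (productForm a₁ a₂ b₁ b₂) r) :
    (∀ u, r (fun i => (geodesicPoint a₁ a₂ b₁ b₂ u i : ℂ)) = (√2 : ℝ)) ∨
      ∀ u, r (fun i => (geodesicPoint a₁ a₂ b₁ b₂ u i : ℂ)) = -(√2 : ℝ) := by
  have h2 : ((√2 : ℝ) : ℂ) ^ 2 = 2 := by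
    exact_mod_cast Real.sq_sqrt (zero_le_two (α := ℝ))
  have hc : Continuous fun u i => (geodesicPoint a₁ a₂ b₁ b₂ u i : ℂ) := by
    refine continuous_pi fun i => Complex.continuous_ofReal.comp ?_
    fin_cases i <;> simp only [geodesicPoint] <;> fun_prop
  have hcont : Continuous fun u => r (fun i => (geodesicPoint a₁ a₂ b₁ b₂ u i : ℂ)) :=
    hr.1.continuousOn.comp_continuous hc (geodesicPoint_mem_negRegion hD)
  have h := isPreconnected_univ.eq_or_eq_neg_of_sq_eq (g := fun _ : ℝ => ((√2 : ℝ) : ℂ))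
    hcont.continuousOn continuousOn_const (fun u _ => by
      simp only [Pi.pow_apply]
      rw [hr.2 _ (geodesicPoint_mem_negRegion hD u), h2, dotProduct_productForm_mulVec,
        geodesicPoint_left_complex hD, geodesicPoint_right_complex hD]
      norm_cast
      have : Real.exp (-u) * Real.exp u = 1 := by rw [← Real.exp_add]; simp
      linear_combination 2 * this)
    (fun {u} _ => by simp)
  exact h.imp (fun h u => h (Set.mem_univ u)) fun h u => h (Set.mem_univ u)

theorem incompleteGauss_ofReal (x : ℝ) : incompleteGauss x = gaussInt x := by
  have h : ∀ u : ℝ, (x : ℂ) * Complex.exp (-Real.pi * (u * x) ^ 2) =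
      ((x * Real.exp (-Real.pi * (u * x) ^ 2) : ℝ) : ℂ) := fun u => by push_cast; rfl
  simp only [incompleteGauss, h]
  rw [intervalIntegral.integral_ofReal, intervalIntegral.integral_const_mul, gaussInt]
  congr 1
  have := intervalIntegral.smul_integral_comp_mul_right (a := 0) (b := 1)
    (fun v => Real.exp (-Real.pi * v ^ 2)) x
  rwa [zero_mul, one_mul, smul_eq_mul] at this

end Indefinite

namespace Indefinite

theorem incompleteGauss_neg (α : ℂ) : incompleteGauss (-α) = -incompleteGauss α := by
  simp [incompleteGauss]

/-- The Gaussian primitive is odd, so changing the branch has the same effect as exchanging c₁ and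
c₂. This reduces the second branch to the first. -/
theorem thetaTerm_neg {g : ℕ} (r : (Fin g → ℂ) → ℂ) (c₁ c₂ z : Fin g → ℂ)
    (Ω : Matrix (Fin g) (Fin g) ℂ) : thetaTerm (-r) c₁ c₂ z Ω = thetaTerm r c₂ c₁ z Ω := by
  funext n
  simp only [thetaTerm, Pi.neg_apply, neg_div, div_neg, incompleteGauss_neg]
  ring

theorem scaleBranch_neg {g : ℕ} (r : (Fin g → ℂ) → ℂ) (t : ℝ) :
    scaleBranch (-r) t = -scaleBranch r t := by
  funext z
  simp [scaleBranch]

theorem thetaRay_neg {g : ℕ} (r : (Fin g → ℂ) → ℂ) (c₁ c₂ : Fin g → ℂ) (p q : Fin g → ℝ)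
    (Ω : Matrix (Fin g) (Fin g) ℂ) : thetaRay (-r) c₁ c₂ p q Ω = thetaRay r c₂ c₁ p q Ω := by
  funext t
  simp only [thetaRay, thetaNull, theta, scaleBranch_neg, thetaTerm_neg]

variable {a₁ a₂ b₁ b₂ : ℝ}

theorem toC_mulVec_ofReal {g : ℕ} (M : Matrix (Fin g) (Fin g) ℝ) (w : Fin g → ℝ) :
    toC M *ᵥ (fun i => (w i : ℂ)) = fun i => (((M *ᵥ w) i : ℝ) : ℂ) := by
  funext i
  simp [toC, Matrix.mulVec, dotProduct]

theorem smul_mulVec_im {g : ℕ} (M : Matrix (Fin g) (Fin g) ℝ) (w : Fin g → ℝ) (t : ℝ) (i : Fin g) :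
    (((((t : ℂ) • (Complex.I • toC M)) *ᵥ (fun i => (w i : ℂ))) i).im : ℂ) =
      ((t : ℂ) • (toC M *ᵥ (fun i => (w i : ℂ)))) i := by
  rw [Matrix.smul_mulVec, Matrix.smul_mulVec, toC_mulVec_ofReal]
  simp

theorem geodesicPoint_dotProduct (hD : a₁ * b₂ - a₂ * b₁ ≠ 0) (u : ℝ) (w : Fin 2 → ℝ) :
    (fun i => (geodesicPoint a₁ a₂ b₁ b₂ u i : ℂ)) ⬝ᵥ
        (toC (productForm a₁ a₂ b₁ b₂) *ᵥ (fun i => (w i : ℂ))) =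
      ((Real.exp u * (a₁ * w 0 + a₂ * w 1) - Real.exp (-u) * (b₁ * w 0 + b₂ * w 1) : ℝ) : ℂ) := by
  rw [dotProduct_productForm_mulVec, geodesicPoint_left_complex hD, geodesicPoint_right_complex hD]
  push_cast
  ring

/-- The prefactor completes the square: the exponent becomes ½(n + q)ᵀΩ(n + q), hence -2πtxy. In the
argument of the Gaussian primitive the factor t from Im Ω over √t from the scaled branch leaves √t,
and the two √2 cancel. -/
theorem thetaTerm_geodesicPoint (hD : a₁ * b₂ - a₂ * b₁ ≠ 0) {r : (Fin 2 → ℂ) → ℂ}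
    (hr : ∀ u, r (fun i => (geodesicPoint a₁ a₂ b₁ b₂ u i : ℂ)) = (√2 : ℝ)) (q : Fin 2 → ℝ)
    (ℓ : ℝ) {t : ℝ} (ht : 0 < t) (n : Fin 2 → ℤ) {Ω : Matrix (Fin 2) (Fin 2) ℂ}
    (hΩ : Ω = (t : ℂ) • (Complex.I • toC (productForm a₁ a₂ b₁ b₂))) :
    e (1 / 2 * ((fun i => (q i : ℂ)) ⬝ᵥ (Ω *ᵥ (fun i => (q i : ℂ)))) +
          (fun i => ((0 : Fin 2 → ℝ) i : ℂ)) ⬝ᵥ (fun i => (q i : ℂ))) *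
        thetaTerm (scaleBranch r t) (fun i => (geodesicPoint a₁ a₂ b₁ b₂ 0 i : ℂ))
          (fun i => (geodesicPoint a₁ a₂ b₁ b₂ ℓ i : ℂ)) (charPoint 0 q Ω) Ω n =
      (geodesicTerm ℓ t (a₁ * n 0 + a₂ * n 1 + (a₁ * q 0 + a₂ * q 1))
        (b₁ * n 0 + b₂ * n 1 + (b₁ * q 0 + b₂ * q 1)) : ℝ) := by
  set M := productForm a₁ a₂ b₁ b₂ with hM
  have hchar : charPoint 0 q Ω = Ω *ᵥ (fun i => (q i : ℂ)) := by
    simp only [charPoint, Pi.zero_apply, Complex.ofReal_zero]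
    exact zero_add _
  have hy : (fun i => (((Ω *ᵥ (fun i => (n i : ℂ)) + charPoint 0 q Ω) i).im : ℂ)) =
      (t : ℂ) • (toC M *ᵥ (fun i => ((n i + q i : ℝ) : ℂ))) := by
    funext i
    rw [← smul_mulVec_im, ← hΩ, hchar, ← Matrix.mulVec_add]
    congr 4
    funext j
    simp
  have hst : (√t : ℂ) * √t = t := by exact_mod_cast Real.mul_self_sqrt ht.le
  have hst0 : (√t : ℂ) ≠ 0 := by exact_mod_cast (Real.sqrt_pos.2 ht).ne'
  have h20 : ((√2 : ℝ) : ℂ) ≠ 0 := by simp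
  have harg : ∀ u, (fun i => (geodesicPoint a₁ a₂ b₁ b₂ u i : ℂ)) ⬝ᵥ
      ((t : ℂ) • (toC M *ᵥ (fun i => ((n i + q i : ℝ) : ℂ)))) /
        (scaleBranch r t (fun i => (geodesicPoint a₁ a₂ b₁ b₂ u i : ℂ)) / (√2 : ℝ)) =
      ((√t * (Real.exp u * (a₁ * n 0 + a₂ * n 1 + (a₁ * q 0 + a₂ * q 1)) -
        Real.exp (-u) * (b₁ * n 0 + b₂ * n 1 + (b₁ * q 0 + b₂ * q 1))) : ℝ) : ℂ) := by
    intro u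
    rw [dotProduct_smul, geodesicPoint_dotProduct hD, scaleBranch, hr, mul_div_cancel_right₀ _ h20,
      smul_eq_mul, ← hst]
    rw [div_eq_iff hst0]
    push_cast
    ring
  have hexp : e (1 / 2 * ((fun i => (q i : ℂ)) ⬝ᵥ (Ω *ᵥ (fun i => (q i : ℂ)))) +
          (fun i => ((0 : Fin 2 → ℝ) i : ℂ)) ⬝ᵥ (fun i => (q i : ℂ))) *
      e (1 / 2 * ((fun i => (n i : ℂ)) ⬝ᵥ (Ω *ᵥ (fun i => (n i : ℂ)))) +
          (fun i => (n i : ℂ)) ⬝ᵥ charPoint 0 q Ω) =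
      ((Real.exp (-2 * Real.pi * t * ((a₁ * n 0 + a₂ * n 1 + (a₁ * q 0 + a₂ * q 1)) *
        (b₁ * n 0 + b₂ * n 1 + (b₁ * q 0 + b₂ * q 1)))) : ℝ) : ℂ) := by
    have h0 : (fun i => ((0 : Fin 2 → ℝ) i : ℂ)) ⬝ᵥ (fun i => (q i : ℂ)) = 0 := by
      simp [dotProduct]
    rw [e, e, ← Complex.exp_add, hchar, hΩ, h0]
    simp only [Matrix.smul_mulVec, dotProduct_smul, smul_eq_mul]
    rw [hM, dotProduct_productForm_mulVec, dotProduct_productForm_mulVec,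
      dotProduct_productForm_mulVec, Complex.ofReal_exp]
    congr 1
    push_cast
    linear_combination (2 * Real.pi * t * ((a₁ * n 0 + a₂ * n 1 + (a₁ * q 0 + a₂ * q 1)) *
        (b₁ * n 0 + b₂ * n 1 + (b₁ * q 0 + b₂ * q 1))) : ℂ) * Complex.I_mul_I
  simp only [thetaTerm]
  rw [mul_left_comm, hexp, hy, harg, harg, incompleteGauss_ofReal, incompleteGauss_ofReal,
    geodesicTerm]
  simp

theorem thetaRay_geodesicPoint (hD : a₁ * b₂ - a₂ * b₁ ≠ 0) {r : (Fin 2 → ℂ) → ℂ}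
    (hr : ∀ u, r (fun i => (geodesicPoint a₁ a₂ b₁ b₂ u i : ℂ)) = (√2 : ℝ)) (q : Fin 2 → ℝ)
    (ℓ : ℝ) {t : ℝ} (ht : 0 < t) :
    Summable (thetaTerm (scaleBranch r t) (fun i => (geodesicPoint a₁ a₂ b₁ b₂ 0 i : ℂ))
        (fun i => (geodesicPoint a₁ a₂ b₁ b₂ ℓ i : ℂ))
        (charPoint 0 q ((t : ℂ) • (Complex.I • toC (productForm a₁ a₂ b₁ b₂))))
        ((t : ℂ) • (Complex.I • toC (productForm a₁ a₂ b₁ b₂)))) ∧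
      thetaRay r (fun i => (geodesicPoint a₁ a₂ b₁ b₂ 0 i : ℂ))
        (fun i => (geodesicPoint a₁ a₂ b₁ b₂ ℓ i : ℂ)) 0 q
        (Complex.I • toC (productForm a₁ a₂ b₁ b₂)) t =
      ((∑' v : ℤ × ℤ, geodesicTerm ℓ t (a₁ * v.1 + a₂ * v.2 + (a₁ * q 0 + a₂ * q 1))
        (b₁ * v.1 + b₂ * v.2 + (b₁ * q 0 + b₂ * q 1)) : ℝ) : ℂ) := by
  have h1 := fun n => thetaTerm_geodesicPoint hD hr q ℓ ht n rfl
  have h2 := (hasSum_geodesicTerm hD (a₁ * q 0 + a₂ * q 1) (b₁ * q 0 + b₂ * q 1) ℓ ht).summable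
  have h3 := (Complex.hasSum_ofReal.2 h2.hasSum)
  rw [← (finTwoArrowEquiv ℤ).hasSum_iff] at h3
  have h4 := h3.congr_fun (g := _) (fun n => (h1 n))
  have he : ∀ z, e z ≠ 0 := fun z => Complex.exp_ne_zero _
  refine ⟨(summable_mul_left_iff (he _)).1 h4.summable, ?_⟩
  rw [thetaRay, thetaNull, theta, ← tsum_mul_left]
  exact h4.tsum_eq

end Indefinite

/-! ### Assembly and analytic continuation -/

open RayClass Indefinite in
/-- The differenced ray class zeta function is an indefinite zeta function where its Dirichlet
series converges. -/
theorem exists_zetaHat_eq {K : Type*} [Field K] [NumberField K] (E : RealQuadratic K)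
    (hK : Module.finrank ℚ K = 2) {𝔠 : Ideal (𝓞 K)} (h𝔠 : 𝔠 ≠ ⊥)
    {A : RayClass.ClassGroup 𝔠 (Set.univ : Set (K →+* ℝ))} {𝔟 : Ideal (𝓞 K)}
    (h𝔟 : InClass 𝔟 A⁻¹) :
    ∃ (M : Matrix (Fin 2) (Fin 2) ℝ) (q : Fin 2 → ℚ),
      M.IsSymm ∧ HasSignature M 1 1 ∧ (∃ r, IsNegSqrt M r) ∧
      ∀ r, IsNegSqrt M r →
        ∃ c₁ c₂ : Fin 2 → ℝ,
          (fun i => (c₁ i : ℂ)) ∈ negRegion M ∧ (fun i => (c₂ i : ℂ)) ∈ negRegion M ∧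
          (∀ t : ℝ, 0 < t → Summable (thetaTerm (scaleBranch r t)
            (fun i => (c₁ i : ℂ)) (fun i => (c₂ i : ℂ))
            (charPoint 0 (fun i => (q i : ℝ)) ((t : ℂ) • (Complex.I • toC M)))
            ((t : ℂ) • (Complex.I • toC M)))) ∧
          (∀ s : ℂ, MellinConvergent (thetaRay r (fun i => (c₁ i : ℂ)) (fun i => (c₂ i : ℂ))
            0 (fun i => (q i : ℝ)) (Complex.I • toC M)) s) ∧
          Differentiable ℂ (zetaHat r (fun i => (c₁ i : ℂ)) (fun i => (c₂ i : ℂ))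
            0 (fun i => (q i : ℝ)) (Complex.I • toC M)) ∧
          ∀ s : ℂ, 1 < s.re →
            zetaHat r (fun i => (c₁ i : ℂ)) (fun i => (c₂ i : ℂ))
              0 (fun i => (q i : ℝ)) (Complex.I • toC M) s =
            (2 * Real.pi * (Ideal.absNorm 𝔟 : ℂ)) ^ (-s) * Complex.Gamma s *
              (zeta A s - zeta (negClass 𝔠 h𝔠 Set.univ * A) s) := by
  obtain ⟨ε, hε, hε1, hgen⟩ := E.exists_generator 𝔠 h𝔠
  obtain ⟨a₁, a₂, b₁, b₂, q, i, hD, hi, hiα, hi0⟩ :=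
    exists_coordinates E hK h𝔟.ne_bot h𝔠 h𝔟.isCoprime
  set ℓ := Real.log (E.σ (ε : 𝓞 K)) with hℓ
  set x₀ : ℝ := a₁ * q 0 + a₂ * q 1 with hx₀
  set y₀ : ℝ := b₁ * q 0 + b₂ * q 1 with hy₀
  have hN : 0 < Ideal.absNorm 𝔟 := h𝔟.absNorm_pos
  -- The analysis depends on F only through its values for t > 0, so it is done once and serves both
  -- branches.
  have key : ∀ F : ℝ → ℂ, (∀ t, 0 < t → F t = ((∑' v : ℤ × ℤ, geodesicTerm ℓ t
      (a₁ * v.1 + a₂ * v.2 + x₀) (b₁ * v.1 + b₂ * v.2 + y₀) : ℝ) : ℂ)) →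
      (∀ s, MellinConvergent F s) ∧ Differentiable ℂ (mellin F) ∧ ∀ s : ℂ, 1 < s.re →
        mellin F s = (2 * Real.pi * (Ideal.absNorm 𝔟 : ℂ)) ^ (-s) * Complex.Gamma s *
          (zeta A s - zeta (negClass 𝔠 h𝔠 Set.univ * A) s) := by
    intro F hF
    have hsum : ∀ t ∈ Set.Ioi (0 : ℝ), HasSum (fun i : {𝔞 : Ideal (𝓞 K) // InClass 𝔞 A} ⊕
        {𝔞 : Ideal (𝓞 K) // InClass 𝔞 (negClass 𝔠 h𝔠 Set.univ * A)} => (idealSign i : ℂ) *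
          (Real.exp (-(2 * Real.pi * Ideal.absNorm 𝔟 * idealNorm i) * t) : ℝ)) (F t) := by
      intro t ht
      have h1 := (hasSum_geodesicTerm hD x₀ y₀ ℓ ht).summable.hasSum
      -- Lattice points that are not coset points have x = y = 0, and their terms vanish.
      rw [← hi.hasSum_iff fun v hv => by
        rw [(hi0 v hv).1, (hi0 v hv).2]
        simp [geodesicTerm]] at h1
      have h2 : HasSum (fun α : CosetPoint 𝔟 𝔠 => geodesicTerm ℓ t (E.σ α.1) (E.τ α.1)) _ :=
        h1.congr_fun fun α => by rw [← (hiα α).1, ← (hiα α).2]; rfl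
      have h3 := Complex.hasSum_ofReal.2 (hasSum_ideals E h𝔠 h𝔟 hε hε1 hgen ht h2)
      rw [hF t ht]
      simpa only [Complex.ofReal_mul] using h3
    -- All ideal norms involved are at least 1, so every exponent is at least 2π.
    have h := mellin_entire_of_hasSum_exp (κ := 2 * Real.pi) (by positivity) abs_idealSign
      (fun i => ?_) hsum fun N => ?_
    · exact ⟨h.1, h.2, fun s hs => mellin_eq_zeta hN hsum hs⟩
    · have h1 : (1 : ℝ) ≤ Ideal.absNorm 𝔟 := by exact_mod_cast hN
      have h2 : (1 : ℝ) ≤ idealNorm i := by exact_mod_cast idealNorm_pos i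
      rw [mul_assoc (2 * Real.pi)]
      exact le_mul_of_one_le_right (by positivity) (one_le_mul_of_one_le_of_one_le h1 h2)
    · obtain ⟨C, hC⟩ := exists_abs_tsum_geodesicTerm_le hD x₀ y₀ ℓ N
      refine ⟨C, fun t ht ht1 => ?_⟩
      rw [hF t ht, Complex.norm_real, Real.norm_eq_abs]
      exact hC t ht ht1
  have hq : ∀ r : (Fin 2 → ℂ) → ℂ,
      (∀ u, r (fun i => (geodesicPoint a₁ a₂ b₁ b₂ u i : ℂ)) = (√2 : ℝ)) → _ := fun r hr =>
    key _ fun t ht => (thetaRay_geodesicPoint hD hr (fun i => (q i : ℝ)) ℓ ht).2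
  refine ⟨productForm a₁ a₂ b₁ b₂, q, productForm_isSymm, hasSignature_productForm hD,
    exists_isNegSqrt_productForm, fun r hr => ?_⟩
  rcases isNegSqrt_geodesicPoint hD hr with h | h
  · exact ⟨geodesicPoint a₁ a₂ b₁ b₂ 0, geodesicPoint a₁ a₂ b₁ b₂ ℓ,
      geodesicPoint_mem_negRegion hD 0, geodesicPoint_mem_negRegion hD ℓ,
      fun t ht => (thetaRay_geodesicPoint hD h (fun i => (q i : ℝ)) ℓ ht).1,
      (hq r h).1, (hq r h).2.1, (hq r h).2.2⟩
  -- For the branch with value -√2 the argument is applied to -r, and c₁, c₂ change places.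
  · have h' : ∀ u, (-r) (fun i => (geodesicPoint a₁ a₂ b₁ b₂ u i : ℂ)) = (√2 : ℝ) := fun u => by
      rw [Pi.neg_apply, h, neg_neg]
    have h1 := hq (-r) h'
    rw [thetaRay_neg] at h1
    refine ⟨geodesicPoint a₁ a₂ b₁ b₂ ℓ, geodesicPoint a₁ a₂ b₁ b₂ 0,
      geodesicPoint_mem_negRegion hD ℓ, geodesicPoint_mem_negRegion hD 0,
      fun t ht => ?_, h1.1, h1.2.1, h1.2.2⟩
    have h2 := (thetaRay_geodesicPoint hD h' (fun i => (q i : ℝ)) ℓ ht).1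
    rwa [scaleBranch_neg, thetaTerm_neg] at h2

/-- Two entire functions that agree on a half-plane are equal. -/
theorem eq_of_eq_of_one_lt_re {f g : ℂ → ℂ} (hf : Differentiable ℂ f) (hg : Differentiable ℂ g)
    (h : ∀ s : ℂ, 1 < s.re → f s = g s) : f = g := by
  refine (Complex.analyticOnNhd_univ_iff_differentiable.2 hf).eq_of_eventuallyEq
    (Complex.analyticOnNhd_univ_iff_differentiable.2 hg) (z₀ := 2) ?_
  filter_upwards [(isOpen_lt continuous_const Complex.continuous_re).mem_nhds
    (show (1 : ℝ) < (2 : ℂ).re by norm_num)] with s hs using h s hs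

open RayClass Indefinite in
theorem theorem1p3 (K : Type*) [Field K] [NumberField K] [NumberField.IsTotallyReal K]
    (hK : Module.finrank ℚ K = 2) (𝔠 : Ideal (𝓞 K)) (h𝔠 : 𝔠 ≠ ⊥)
    (A : RayClass.ClassGroup 𝔠 (Set.univ : Set (K →+* ℝ))) :
    ∃ Z : ℂ → ℂ, IsDiffZeta h𝔠 A Z ∧
      ∀ 𝔟 : Ideal (𝓞 K), InClass 𝔟 A⁻¹ →
        ∃ (M : Matrix (Fin 2) (Fin 2) ℝ) (q : Fin 2 → ℚ),
          M.IsSymm ∧ HasSignature M 1 1 ∧ (∃ r, IsNegSqrt M r) ∧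
          ∀ r, IsNegSqrt M r →
            ∃ c₁ c₂ : Fin 2 → ℝ,
              (fun i => (c₁ i : ℂ)) ∈ negRegion M ∧ (fun i => (c₂ i : ℂ)) ∈ negRegion M ∧
              -- the theta series and the Mellin integral converge
              (∀ t : ℝ, 0 < t → Summable (thetaTerm (scaleBranch r t)
                (fun i => (c₁ i : ℂ)) (fun i => (c₂ i : ℂ))
                (charPoint 0 (fun i => (q i : ℝ)) ((t : ℂ) • (Complex.I • toC M)))
                ((t : ℂ) • (Complex.I • toC M)))) ∧
              (∀ s : ℂ, MellinConvergent (thetaRay r (fun i => (c₁ i : ℂ)) (fun i => (c₂ i : ℂ))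
                0 (fun i => (q i : ℝ)) (Complex.I • toC M)) s) ∧
              -- the right-hand side is entire, so the identity below, stated away from the
              -- poles of `Γ`, determines the left-hand side there too (removable singularities)
              Differentiable ℂ (zetaHat r (fun i => (c₁ i : ℂ)) (fun i => (c₂ i : ℂ))
                0 (fun i => (q i : ℝ)) (Complex.I • toC M)) ∧
              ∀ s : ℂ, (∀ k : ℕ, s ≠ -(k : ℂ)) →
                (2 * Real.pi * (Ideal.absNorm 𝔟 : ℂ)) ^ (-s) * Complex.Gamma s * Z s =
                  zetaHat r (fun i => (c₁ i : ℂ)) (fun i => (c₂ i : ℂ))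
                    0 (fun i => (q i : ℝ)) (Complex.I • toC M) s := by
  obtain ⟨E⟩ := exists_realQuadratic K hK
  -- The continuation has to be fixed before 𝔟 is given, so it is built from one auxiliary ideal.
  obtain ⟨𝔟₀, h𝔟₀⟩ := exists_inClass E h𝔠 A⁻¹
  obtain ⟨M₀, q₀, -, -, ⟨r₀, hr₀⟩, h₀⟩ := exists_zetaHat_eq E hK h𝔠 h𝔟₀
  obtain ⟨c, c', -, -, -, -, hdiff₀, heq₀⟩ := h₀ r₀ hr₀
  set f₀ := zetaHat r₀ (fun i => (c i : ℂ)) (fun i => (c' i : ℂ)) 0 (fun i => (q₀ i : ℝ))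
    (Complex.I • toC M₀)
  have hne : ∀ 𝔟 : Ideal (𝓞 K), InClass 𝔟 A⁻¹ → (2 * Real.pi * (Ideal.absNorm 𝔟 : ℂ)) ≠ 0 :=
    fun 𝔟 h𝔟 => mul_ne_zero (mul_ne_zero two_ne_zero (Complex.ofReal_ne_zero.2 Real.pi_ne_zero))
      (Nat.cast_ne_zero.2 h𝔟.absNorm_pos.ne')
  have hcancel : ∀ 𝔟 : Ideal (𝓞 K), InClass 𝔟 A⁻¹ → ∀ s : ℂ,
      (2 * Real.pi * (Ideal.absNorm 𝔟 : ℂ)) ^ s * (2 * Real.pi * (Ideal.absNorm 𝔟 : ℂ)) ^ (-s) = 1 :=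
    fun 𝔟 h𝔟 s => by
      rw [← Complex.cpow_add _ _ (hne 𝔟 h𝔟), add_neg_cancel, Complex.cpow_zero]
  -- The reciprocal of Γ is entire, so dividing by Γ introduces no poles.
  have hdiff : ∀ 𝔟 : Ideal (𝓞 K), InClass 𝔟 A⁻¹ → ∀ f : ℂ → ℂ, Differentiable ℂ f →
      Differentiable ℂ fun s =>
        (2 * Real.pi * (Ideal.absNorm 𝔟 : ℂ)) ^ s * (Complex.Gamma s)⁻¹ * f s :=
    fun 𝔟 h𝔟 f hf => (((differentiable_id.const_cpow (Or.inl (hne 𝔟 h𝔟))).mul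
      Complex.differentiable_one_div_Gamma).mul hf)
  have hzeta : ∀ 𝔟 : Ideal (𝓞 K), InClass 𝔟 A⁻¹ → ∀ f : ℂ → ℂ, (∀ s : ℂ, 1 < s.re →
      f s = (2 * Real.pi * (Ideal.absNorm 𝔟 : ℂ)) ^ (-s) * Complex.Gamma s *
        (zeta A s - zeta (negClass 𝔠 h𝔠 Set.univ * A) s)) → ∀ s : ℂ, 1 < s.re →
      (2 * Real.pi * (Ideal.absNorm 𝔟 : ℂ)) ^ s * (Complex.Gamma s)⁻¹ * f s =
        zeta A s - zeta (negClass 𝔠 h𝔠 Set.univ * A) s := by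
    intro 𝔟 h𝔟 f hf s hs
    have hΓ := mul_inv_cancel₀ (Complex.Gamma_ne_zero_of_re_pos (one_pos.trans hs))
    rw [hf s hs]
    linear_combination (zeta A s - zeta (negClass 𝔠 h𝔠 Set.univ * A) s) *
      (Complex.Gamma s * (Complex.Gamma s)⁻¹ * hcancel 𝔟 h𝔟 s + hΓ)
  refine ⟨fun s => (2 * Real.pi * (Ideal.absNorm 𝔟₀ : ℂ)) ^ s * (Complex.Gamma s)⁻¹ * f₀ s,
    ⟨hdiff 𝔟₀ h𝔟₀ f₀ hdiff₀, fun s hs => ⟨summable_zetaTerm A hs, summable_zetaTerm _ hs,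
      hzeta 𝔟₀ h𝔟₀ f₀ heq₀ s hs⟩⟩, fun 𝔟 h𝔟 => ?_⟩
  obtain ⟨M, q, hM, hsig, hbr, h⟩ := exists_zetaHat_eq E hK h𝔠 h𝔟
  refine ⟨M, q, hM, hsig, hbr, fun r hr => ?_⟩
  obtain ⟨c₁, c₂, hc₁, hc₂, hsum, hconv, hd, heq⟩ := h r hr
  refine ⟨c₁, c₂, hc₁, hc₂, hsum, hconv, hd, fun s hs => ?_⟩
  -- The expressions built from 𝔟₀ and from 𝔟 are both entire and agree with the Dirichlet series
  -- for Re s > 1, hence everywhere.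
  have hext := congrFun (eq_of_eq_of_one_lt_re (hdiff 𝔟₀ h𝔟₀ f₀ hdiff₀) (hdiff 𝔟 h𝔟 _ hd)
    fun s hs => (hzeta 𝔟₀ h𝔟₀ f₀ heq₀ s hs).trans (hzeta 𝔟 h𝔟 _ heq s hs).symm) s
  have hΓ := mul_inv_cancel₀ (Complex.Gamma_ne_zero hs)
  beta_reduce at hext ⊢
  rw [hext]
  linear_combination (zetaHat r (fun i => (c₁ i : ℂ)) (fun i => (c₂ i : ℂ)) 0
    (fun i => (q i : ℝ)) (Complex.I • toC M) s) *
      (Complex.Gamma s * (Complex.Gamma s)⁻¹ * hcancel 𝔟 h𝔟 s + hΓ)
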